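/- Let $d\in\{1,2,3\}$, $\alpha\in(0,1)$, $T>0$, $r\ge 1$ and $p\in\{2,\infty\}$. Let $\Omega\subset\mathbb R^d$ be a bounded open set that equals the interior of its closure (e.g. a bounded Lipschitz domain). Let $a_k,b_k\in C^1(\Omega)\cap C(\bar\Omega)$ and $c\in C(\bar\Omega)$ with $a_k>0$ on $\bar\Omega$ ($k=1,\dots,d$), put $$\mathcal Lv=\sum_{k=1}^d\{-\partial_{x_k}(a_k\partial_{x_k}v)+b_k\partial_{x_k}v\}+cv,\qquad \mathring{\mathcal L}=\mathcal L-c,\qquad \mathring{\mathcal A}(v,w)=\int_\Omega\sum_{k=1}^d\{a_k\,\partial_{x_k}v\,\partial_{x_k}w+b_k\,\partial_{x_k}v\;w\},$$ and assume $c-p^{-1}\sum_{k}\partial_{x_k}b_k\ge0$ in $\Omega$ (with $\infty^{-1}=0$). Then there is a constant $C$, depending only on these data, such that the following holds. **Continuous problem.** Let $u\in C(\bar\Omega\times[0,T])$ be a solution of $$D_t^\alpha u+\mathcal Lu=f\ \text{ in }\Omega\times(0,T],\qquad u=0\ \text{ on }\partial\Omega\times(0,T],\qquad u(\cdot,0)=u_0\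 \text{ in }\Omega,$$ where $D_t^\alpha u(\cdot,t)=\frac1{\Gamma(1-\alpha)}\int_0^t(t-s)^{-\alpha}\partial_su(\cdot,s)\,ds$, $u(x,\cdot)$ is $C^2$ on $(0,T)$ for each $x\in\Omega$, and for some constant $K$ one has $|\partial_t^lu(x,t)|\le K(1+t^{\alpha-l})$ for $l=0,1,2$, $x\in\Omega$, $t\in(0,T)$; for each $t\in[0,T]$, $\mathring{\mathcal L}u(\cdot,t)$ (in the sense of distributions) is a function in $L_1(\Omega)$. **Discretization.** Let $\mathcal T$ be a conforming simplicial triangulation that covers $\Omega$ exactly, $\ell\ge1$, and $S_h\subset H_0^1(\Omega)\cap C(\bar\Omega)$ the Lagrange finite element space of degree $\ell$. Let $\langle\cdot,\cdot\rangle_h$ be either the $L_2(\Omega)$ inner product or $\langle v,w\rangle_h=\sum_{K\in\mathcal T}Q_K[vw]$, with quadrature formulas $Q_K$ that use finitely many points of $K$ and positive weights, where $\langle 1,\phi_z\rangle_h>0$ for the piecewise linear hat function $\phi_z$ of every interior node $z$ (this holds whenever $\langle\cdot,\cdot\rangle_h$ is an inner product on the space of piecewise linear elements). Put $\mathcal A_h(v,w)=\mathring{\mathcal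 A}(v,w)+\langle cv,w\rangle_h$. Let $M\ge1$, $t_j=T(j/M)^r$, $\tau_j=t_j-t_{j-1}$, $\delta_tU^j=\tau_j^{-1}(U^j-U^{j-1})$, and $$\delta_t^\alpha U^m=\frac1{\Gamma(1-\alpha)}\sum_{j=1}^m\delta_tU^j\int_{t_{j-1}}^{t_j}(t_m-s)^{-\alpha}ds,\qquad \kappa_{m,m}=\frac{\tau_m^{-1}}{\Gamma(1-\alpha)}\int_{t_{m-1}}^{t_m}(t_m-s)^{-\alpha}ds .$$ Assume condition $\mathrm A_p$: * $\mathrm A_2$: $\langle\cdot,\cdot\rangle_h$ is the exact $L_2(\Omega)$ inner product; * $\mathrm A_\infty$: $\ell=1$, and $\mathcal A_h(\phi_{z'},\phi_z)+\kappa_{m,m}\langle\phi_{z'},\phi_z\rangle_h\le0$ for $m=1,\dots,M$, every interior node $z$ and every mesh node $z'\neq z$ (interior or on the boundary). (i) For every $u_h^0\in C(\bar\Omega)$ the scheme $$u_h^m\in S_h,\qquad \langle\delta_t^\alpha u_h^m,v_h\rangle_h+\mathcal A_h(u_h^m,v_h)=\langle f(\cdot,t_m),v_h\rangle_h\quad\forall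 v_h\in S_h,\ m=1,\dots,M,$$ has a unique solution $\{u_h^m\}_{m=0}^M$ with this initial value. Moreover, let $\mathcal R_hu(t)\in S_h$, $t\in[0,T]$, be a Ritz projection of $u$, i.e. $\mathring{\mathcal A}(\mathcal R_hu(t),v_h)=\langle\mathring{\mathcal L}u(\cdot,t),v_h\rangle_h$ for all $v_h\in S_h$, such that $\mathcal R_hu$ is continuous in $t$ on $[0,T]$ and differentiable in $t$ on $(0,T)$ at each point of $\Omega$, and let $\rho(\cdot,t)=\mathcal R_hu(t)-u(\cdot,t)$. Then, for $m=1,\dots,M$, $$\|u(\cdot,t_m)-u_h^m\|_{L_p(\Omega)}\le C\Bigl\{\|u_0-u_h^0\|_{L_p(\Omega)}+\max_{1\le j\le m}\|\psi^j\|_{L_p(\Omega)}+\max_{t\in\{0,t_m\}}\|\rho(\cdot,t)\|_{L_p(\Omega)}+\int_0^{t_m}\|\partial_t\rho(\cdot,t)\|_{L_p(\Omega)}dt\Bigr\},$$ where $$\psi^1=\tau_1^\alpha\sup_{s\in(0,t_1)}s^{1-\alpha}|\delta_tu(\cdot,t_1)-\partial_su(\cdot,s)|,\qquad \psi^j=\tau_j^{2-\alpha}t_j^\alpha\sup_{s\in(t_{j-1},t_j)}|\partial_s^2u(\cdot,s)|\quad(j\ge2).$$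 (ii) If $r=1$, then, with $\tau=T/M$ and $\gamma=\min\{\alpha,1-\alpha\}$, the term $\max_{1\le j\le m}\|\psi^j\|_{L_p(\Omega)}$ in this bound can be replaced by $$t_m^{\alpha-1}\max_{1\le j\le m}\bigl\{\tau^{-\gamma}t_j^{1-\alpha+\gamma}\|\psi^j\|_{L_p(\Omega)}\bigr\}.$$ The constant $C$ depends only on $d,\alpha,T,r,p,\Omega$ and the coefficients; it does not depend on $f,u_0,u,K,\mathcal T,\ell,\langle\cdot,\cdot\rangle_h,M$ or $u_h^0$. -/

import Mathlib

open MeasureTheory Set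
open scoped ENNReal NNReal

noncomputable section

namespace L1FEM

/-- Points of `ℝ^d`, with the Euclidean norm and Lebesgue measure. -/
abbrev Pt (d : ℕ) := EuclideanSpace ℝ (Fin d)

/-- The partial derivative `∂_{x_k} v` at `x`. -/
def pd {d : ℕ} (k : Fin d) (v : Pt d → ℝ) (x : Pt d) : ℝ :=
  fderiv ℝ v x (EuclideanSpace.single k 1)

/-! ### Temporal mesh and (discrete) fractional derivative -/

/-- The graded mesh `t_j = T (j/M)^r`. -/
def mesh (T r : ℝ) (M j : ℕ) : ℝ := T * ((j : ℝ) / (M : ℝ)) ^ r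

/-- The Caputo derivative `D_t^α g(t) = Γ(1-α)⁻¹ ∫_0^t (t-s)^{-α} g'(s) ds`. -/
def caputo (α : ℝ) (g : ℝ → ℝ) (t : ℝ) : ℝ :=
  1 / Real.Gamma (1 - α) * ∫ s in (0 : ℝ)..t, (t - s) ^ (-α) * deriv g s

/-- The L1 operator `δ_t^α U^m` on the temporal mesh `t`. -/
def l1 (α : ℝ) (t : ℕ → ℝ) (U : ℕ → ℝ) (m : ℕ) : ℝ :=
  1 / Real.Gamma (1 - α) * ∑ j ∈ Finset.Icc 1 m,
    (U j - U (j - 1)) / (t j - t (j - 1)) * ∫ s in t (j - 1)..t j, (t m - s) ^ (-α)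

/-- The coefficient `κ_{m,m}` of `U^m` in `δ_t^α U^m`. -/
def kappa (α : ℝ) (t : ℕ → ℝ) (m : ℕ) : ℝ :=
  (t m - t (m - 1))⁻¹ / Real.Gamma (1 - α) * ∫ s in t (m - 1)..t m, (t m - s) ^ (-α)

/-! ### The continuous problem -/

/-- The formal adjoint of `v ↦ ∑_k (-∂_k (a_k ∂_k v) + b_k ∂_k v)`. -/
def adjL {d : ℕ} (a b : Fin d → Pt d → ℝ) (φ : Pt d → ℝ) (x : Pt d) : ℝ :=
  ∑ k, (-pd k (fun y => a k y * pd k φ y) x - pd k (fun y => b k y * φ y) x)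

/-- `∑_k (-∂_k (a_k ∂_k v) + b_k ∂_k v) = g` in `Ω` in the sense of distributions, where
`g ∈ L_1(Ω)`. -/
def DistribL {d : ℕ} (Ω : Set (Pt d)) (a b : Fin d → Pt d → ℝ) (v g : Pt d → ℝ) : Prop :=
  IntegrableOn g Ω ∧
    ∀ φ : Pt d → ℝ, ContDiff ℝ ((⊤ : ℕ∞) : WithTop ℕ∞) φ → HasCompactSupport φ → tsupport φ ⊆ Ω →
      ∫ x in Ω, v x * adjL a b φ x = ∫ x in Ω, g x * φ x

/-- The coefficients of the operator: `a_k, b_k ∈ C^1(Ω) ∩ C(Ω̄)`, `c ∈ C(Ω̄)`, `a_k > 0` on `Ω̄`. -/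
structure IsCoeff {d : ℕ} (Ω : Set (Pt d)) (a b : Fin d → Pt d → ℝ) (c : Pt d → ℝ) : Prop where
  a_cont : ∀ k, ContinuousOn (a k) (closure Ω)
  a_smooth : ∀ k, ContDiffOn ℝ 1 (a k) Ω
  a_pos : ∀ k, ∀ x ∈ closure Ω, 0 < a k x
  b_cont : ∀ k, ContinuousOn (b k) (closure Ω)
  b_smooth : ∀ k, ContDiffOn ℝ 1 (b k) Ω
  c_cont : ContinuousOn c (closure Ω)

/-- `u` solves `D_t^α u + ℒu = f` in `Ω × (0,T]`, `u = 0` on `∂Ω × (0,T]`, `u(·,0) = u₀`, is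
continuous on `Ω̄ × [0,T]`, and satisfies `|∂_t^l u(·,t)| ≲ 1 + t^{α-l}` for `l = 0,1,2`.
The spatial operator without its zero-order term, `ℒu - cu`, is understood in the sense of
distributions; `w t` is the function that it is at time `t`. -/
structure IsSolution {d : ℕ} (Ω : Set (Pt d)) (α T : ℝ) (a b : Fin d → Pt d → ℝ) (c : Pt d → ℝ)
    (f : Pt d → ℝ → ℝ) (u₀ : Pt d → ℝ) (u : Pt d → ℝ → ℝ) (w : ℝ → Pt d → ℝ) : Prop where
  cont : ContinuousOn (fun q : Pt d × ℝ => u q.1 q.2) (closure Ω ×ˢ Icc 0 T)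
  smooth : ∀ x ∈ Ω, ContDiffOn ℝ 2 (u x) (Ioo 0 T)
  bound : ∃ K : ℝ, ∀ x ∈ Ω, ∀ t ∈ Ioo 0 T, ∀ l ≤ 2,
    |iteratedDeriv l (u x) t| ≤ K * (1 + t ^ (α - (l : ℝ)))
  elliptic : ∀ t ∈ Icc 0 T, DistribL Ω a b (fun x => u x t) (w t)
  eqn : ∀ x ∈ Ω, ∀ t ∈ Ioc 0 T, caputo α (u x) t + (w t x + c x * u x t) = f x t
  bdry : ∀ x ∈ frontier Ω, ∀ t ∈ Ioc 0 T, u x t = 0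
  init : ∀ x ∈ Ω, u x 0 = u₀ x

/-- `ψ^1 = τ_1^α sup_{s ∈ (0,t_1)} s^{1-α} |δ_t u(t_1) - ∂_s u(s)|` and
`ψ^j = τ_j^{2-α} t_j^α sup_{s ∈ (t_{j-1},t_j)} |∂_s² u(s)|` for `j ≥ 2`, at the point `x`. -/
def psi {d : ℕ} (α : ℝ) (t : ℕ → ℝ) (u : Pt d → ℝ → ℝ) (j : ℕ) (x : Pt d) : ℝ≥0∞ :=
  if j = 1 then
    ENNReal.ofReal ((t 1 - t 0) ^ α) * ⨆ s ∈ Ioo (t 0) (t 1),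
      ENNReal.ofReal (s ^ (1 - α) * |(u x (t 1) - u x (t 0)) / (t 1 - t 0) - deriv (u x) s|)
  else
    ENNReal.ofReal ((t j - t (j - 1)) ^ (2 - α) * t j ^ α) * ⨆ s ∈ Ioo (t (j - 1)) (t j),
      ENNReal.ofReal |iteratedDeriv 2 (u x) s|

/-! ### Finite elements -/

/-- A conforming simplicial triangulation that covers `Ω̄` exactly. A cell is given by the set of
its `d + 1` vertices. -/
structure Triangulation {d : ℕ} (Ω : Set (Pt d)) where
  cells : Finset (Finset (Pt d))
  card_eq : ∀ K ∈ cells, K.card = d + 1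
  indep : ∀ K ∈ cells, AffineIndependent ℝ (fun z : K => (z : Pt d))
  conforming : ∀ K ∈ cells, ∀ L ∈ cells,
    convexHull ℝ (K : Set (Pt d)) ∩ convexHull ℝ (L : Set (Pt d))
      = convexHull ℝ ((K : Set (Pt d)) ∩ (L : Set (Pt d)))
  cover : ⋃ K ∈ cells, convexHull ℝ (K : Set (Pt d)) = closure Ω

namespace Triangulation

variable {d : ℕ} {Ω : Set (Pt d)}

/-- All mesh nodes (vertices), including those on the boundary. -/
def nodes (𝒯 : Triangulation Ω) : Set (Pt d) := {z | ∃ K ∈ 𝒯.cells, z ∈ K}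

/-- On each cell, `v` is a polynomial of degree at most `ℓ`. -/
def PiecewisePoly (𝒯 : Triangulation Ω) (ℓ : ℕ) (v : Pt d → ℝ) : Prop :=
  ∀ K ∈ 𝒯.cells, ∃ P : MvPolynomial (Fin d) ℝ, P.totalDegree ≤ ℓ ∧
    ∀ x ∈ convexHull ℝ (K : Set (Pt d)), v x = MvPolynomial.eval (fun i => x i) P

/-- The Lagrange finite element space `S_h ⊂ H_0^1(Ω) ∩ C(Ω̄)` of degree `ℓ`; its elements are
extended by zero outside `Ω`. -/
def feSpace (𝒯 : Triangulation Ω) (ℓ : ℕ) : Submodule ℝ (Pt d → ℝ) where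
  carrier := {v | Continuous v ∧ 𝒯.PiecewisePoly ℓ v ∧ ∀ x, x ∉ Ω → v x = 0}
  add_mem' := by
    rintro v w ⟨hv, hv', hv''⟩ ⟨hw, hw', hw''⟩
    refine ⟨hv.add hw, fun K hK => ?_, fun x hx => by simp [hv'' x hx, hw'' x hx]⟩
    obtain ⟨P, hP, hP'⟩ := hv' K hK
    obtain ⟨Q, hQ, hQ'⟩ := hw' K hK
    exact ⟨P + Q, (MvPolynomial.totalDegree_add P Q).trans (max_le hP hQ),
      fun x hx => by simp [hP' x hx, hQ' x hx]⟩
  zero_mem' := ⟨continuous_const, fun K _ => ⟨0, by simp, fun x _ => by simp⟩, fun x _ => rfl⟩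
  smul_mem' := by
    rintro r v ⟨hv, hv', hv''⟩
    refine ⟨hv.const_smul r, fun K hK => ?_, fun x hx => by simp [hv'' x hx]⟩
    obtain ⟨P, hP, hP'⟩ := hv' K hK
    exact ⟨r • P, (MvPolynomial.totalDegree_smul_le r P).trans hP,
      fun x hx => by simp [hP' x hx, MvPolynomial.smul_eval]⟩

/-- `φ` is, on `Ω̄`, the piecewise linear hat function of the node `z`. -/
def IsHat (𝒯 : Triangulation Ω) (z : Pt d) (φ : Pt d → ℝ) : Prop :=
  𝒯.PiecewisePoly 1 φ ∧ φ z = 1 ∧ ∀ z' ∈ 𝒯.nodes, z' ≠ z → φ z' = 0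

end Triangulation

/-- On each cell `K`, a quadrature formula `Q_K[g] = ∑_y wt_K(y) g(y)` with finitely many points in
`K` and positive weights. -/
structure Quadrature {d : ℕ} {Ω : Set (Pt d)} (𝒯 : Triangulation Ω) where
  pts : Finset (Pt d) → Finset (Pt d)
  wt : Finset (Pt d) → Pt d → ℝ
  pts_mem : ∀ K ∈ 𝒯.cells, ∀ y ∈ pts K, y ∈ convexHull ℝ (K : Set (Pt d))
  wt_pos : ∀ K ∈ 𝒯.cells, ∀ y ∈ pts K, 0 < wt K y

variable {d : ℕ} {Ω : Set (Pt d)} {𝒯 : Triangulation Ω}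

/-- `⟨v, w⟩_h`: the exact `L_2(Ω)` product (`none`), or `∑_K Q_K[vw]` (`some Q`). -/
def ip : Option (Quadrature 𝒯) → (Pt d → ℝ) → (Pt d → ℝ) → ℝ
  | none, v, w => ∫ x in Ω, v x * w x
  | some Q, v, w => ∑ K ∈ 𝒯.cells, ∑ y ∈ Q.pts K, Q.wt K y * (v y * w y)

/-- The bilinear form of `v ↦ ∑_k (-∂_k (a_k ∂_k v) + b_k ∂_k v)`. For a continuous piecewise
polynomial the classical gradient used here exists a.e. and is the weak gradient. -/
def formA0 (Ω : Set (Pt d)) (a b : Fin d → Pt d → ℝ) (v w : Pt d → ℝ) : ℝ :=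
  ∫ x in Ω, ∑ k, (a k x * pd k v x * pd k w x + b k x * pd k v x * w x)

/-- The bilinear form `𝒜_h(v,w) = 𝒜°(v,w) + ⟨cv,w⟩_h`. -/
def formAh (q : Option (Quadrature 𝒯)) (a b : Fin d → Pt d → ℝ) (c : Pt d → ℝ)
    (v w : Pt d → ℝ) : ℝ :=
  formA0 Ω a b v w + ip q (fun x => c x * v x) w

/-- `{U^m}_{m=0}^M` solves the fully discrete scheme with initial value `U⁰`. -/
def IsFESolution (𝒯 : Triangulation Ω) (ℓ : ℕ) (q : Option (Quadrature 𝒯)) (α : ℝ) (t : ℕ → ℝ)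
    (M : ℕ) (a b : Fin d → Pt d → ℝ) (c : Pt d → ℝ) (f : Pt d → ℝ → ℝ) (U₀ : Pt d → ℝ)
    (U : ℕ → Pt d → ℝ) : Prop :=
  U 0 = U₀ ∧ ∀ m ∈ Finset.Icc 1 M, U m ∈ 𝒯.feSpace ℓ ∧
    ∀ v ∈ 𝒯.feSpace ℓ,
      ip q (fun x => l1 α t (fun j => U j x) m) v + formAh q a b c (U m) v
        = ip q (fun x => f x (t m)) v

/-- `R t` is a Ritz projection of `u(·,t)` for `t ∈ [0,T]`, where `w t` is `ℒu(·,t) - cu(·,t)`: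
`𝒜°(R t, v) = ⟨w t, v⟩_h` for all `v ∈ S_h`. It is continuous in time on `[0,T]` and
differentiable in time on `(0,T)`. -/
structure IsRitz (𝒯 : Triangulation Ω) (ℓ : ℕ) (q : Option (Quadrature 𝒯)) (T : ℝ)
    (a b : Fin d → Pt d → ℝ) (w R : ℝ → Pt d → ℝ) : Prop where
  mem : ∀ t ∈ Icc 0 T, R t ∈ 𝒯.feSpace ℓ
  eqn : ∀ t ∈ Icc 0 T, ∀ v ∈ 𝒯.feSpace ℓ, formA0 Ω a b (R t) v = ip q (w t) v
  cont : ∀ x ∈ Ω, ContinuousOn (fun t => R t x) (Icc 0 T)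
  diff : ∀ x ∈ Ω, DifferentiableOn ℝ (fun t => R t x) (Ioo 0 T)

/-- Condition `A_p`. For `p = 2`: the product `⟨·,·⟩_h` is exact. For `p = ∞`: linear elements, and
the entries `𝒜_h(φ_{z'}, φ_z) + κ_{m,m} ⟨φ_{z'}, φ_z⟩_h` are nonpositive for every interior node `z`
and every other node `z'`. -/
def CondA (𝒯 : Triangulation Ω) (ℓ : ℕ) (q : Option (Quadrature 𝒯)) (α : ℝ) (t : ℕ → ℝ) (M : ℕ)
    (a b : Fin d → Pt d → ℝ) (c : Pt d → ℝ) (p : ℝ≥0∞) : Prop :=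
  (p = 2 → q = none) ∧
  (p = ⊤ → ℓ = 1 ∧ ∀ m ∈ Finset.Icc 1 M, ∀ z ∈ 𝒯.nodes, z ∈ Ω → ∀ z' ∈ 𝒯.nodes, z' ≠ z →
    ∀ φ φ' : Pt d → ℝ, 𝒯.IsHat z φ → 𝒯.IsHat z' φ' →
      formAh q a b c φ' φ + kappa α t m * ip q φ' φ ≤ 0)

/-- The norm of `L_p(Ω)`, with values in `[0,∞]`. -/
def nrm {ε : Type*} [ENorm ε] (Ω : Set (Pt d)) (p : ℝ≥0∞) (v : Pt d → ε) : ℝ≥0∞ :=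
  eLpNorm v p (volume.restrict Ω)

/-- `max_{t ∈ {0,t_m}} ‖ρ(·,t)‖ + ∫_0^{t_m} ‖∂_t ρ(·,t)‖ dt`, with `s = t_m`. -/
def ritzError (Ω : Set (Pt d)) (p : ℝ≥0∞) (ρ : Pt d → ℝ → ℝ) (s : ℝ) : ℝ≥0∞ :=
  max (nrm Ω p (fun x => ρ x 0)) (nrm Ω p (fun x => ρ x s))
    + ∫⁻ t in Ioo 0 s, nrm Ω p (fun x => deriv (ρ x) t)

end L1FEM

end

open L1FEM

/-!
The error `e^j = R_h u(t_j) - u_h^j` is bounded by reducing the scheme to a scalar inequality for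
the numbers `‖e^j‖`, to which the theory of the L1 operator on the real line applies.

*Stability of one step.* Condition `A_p` is used only to show that `v ∈ S_h` with
`κ_{m,m} ⟨v, φ⟩_h + 𝒜_h(v, φ) = ⟨H, φ⟩_h` for all `φ ∈ S_h` satisfies `κ_{m,m} ‖v‖ ≤ ‖H‖`
in `L_p(Ω)` (`stepStable_of_condA`). For `p = 2` one tests with `v` and needs `𝒜_h(v, v) ≥ 0`
(`formAh_self_nonneg`). Since `div b` need not be integrable up to the boundary, the convection term
is integrated by parts for the compactly supported truncations `max (v² - ε) 0`, and `ε → 0`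
(`integral_convection_truncated`, `integral_convection_ge`). For `p = ∞` one tests with the hat
function of the node where `v` attains its positive maximum; all off-diagonal terms then have a
favourable sign (`le_of_hat_nonpos`, `stable_of_hat_nonpos`). The hat functions of the nodes in `Ω`
vanish on `∂Ω`, so that they belong to `S_h`, because `Ω` is the interior of its closure
(`Triangulation.mem_of_hat_pos`).

*Solvability.* In the finite-dimensional space `S_h`, stability gives uniqueness for one step and
hence existence (`StepStable.exists_eq`, `exists_isFESolution`, `isFESolution_unique`).

*Reduction to scalars.* In the L1 operator `δ_t^α` the newest value has the coefficient `κ_{m,m}`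
and all older values have coefficients of the opposite sign. So stability turns
`⟨δ_t^α e^m, φ⟩_h + 𝒜_h(e^m, φ) = ⟨F^m, φ⟩_h` into `δ_t^α ‖e^m‖ ≤ ‖F^m‖` (`l1_nn_le`). By the
error equation (`error_equation`), `F^m` consists of `δ_t^α ρ^m`, of `c ρ^m` and of the truncation
error `(δ_t^α - D_t^α) u(t_m)`.

* The norm of `δ_t^α ρ^m` is at most `δ_t^α` of the variation of `ρ` up to `t_m`. This variation is
  bounded by `∫ ‖∂_t ρ‖`, by duality for `p = 2` and pointwise for `p = ∞` (`nrm_ritz_sub_le`).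
* The truncation error at time `t_k` is a sum over the mesh intervals (`TimeRegular.l1_sub_caputo`),
  the `j`-th term being at most a weight times `ψ^j` (`ofReal_abs_locRes_le`). On a graded mesh the
  weights sum up to `O(t_k^{-α})` (`sum_resWgt_le`). On a uniform mesh, when they are multiplied by
  the bounds of `ψ^j` assumed in part (ii), they sum up to `O(τ^{-1} k^{-1-γ})`
  (`sum_resWgt_mul_le`).

*The scalar inequality.* For part (i), `δ_t^α` obeys a comparison principle (`le_of_l1_le`), and the
step function `1_{j ≥ 1}` is a barrier for the right-hand side `t_k^{-α}` (`rpow_le_l1_step`). For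
part (ii), `δ_t^α` on a uniform mesh is a discrete convolution and can be inverted. The weights are
log-convex, so by Kaluza's theorem (`coeff_inv_nonpos`) the kernel of the inverse is nonnegative
and decreasing, hence bounded by the reciprocals of the partial sums of the weights
(`compl_mul_partialSum_le`), which gives its decay `t^{α-1}`. Its convolution with the summable
sequence `k^{-1-γ}` decays at the same rate (`le_of_l1_le_rpow`).
-/

namespace L1FEM

/-! ### The weights of the L1 operator and the discrete comparison principle -/

/-- The weight of `U^j - U^{j-1}` in the L1 operator `δ_t^α U^m`. -/
noncomputable def wgt (α : ℝ) (t : ℕ → ℝ) (m j : ℕ) : ℝ :=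
  1 / Real.Gamma (1 - α) * ((t j - t (j - 1))⁻¹ * ∫ s in t (j - 1)..t j, (t m - s) ^ (-α))

lemma l1_eq_sum_wgt (α : ℝ) (t U : ℕ → ℝ) (m : ℕ) :
    l1 α t U m = ∑ j ∈ Finset.Icc 1 m, wgt α t m j * (U j - U (j - 1)) := by
  rw [l1, Finset.mul_sum]
  refine Finset.sum_congr rfl fun j _ => ?_
  rw [wgt, div_eq_mul_inv (U j - U (j - 1))]; ring

lemma kappa_eq_wgt (α : ℝ) (t : ℕ → ℝ) (m : ℕ) : kappa α t m = wgt α t m m := by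
  rw [kappa, wgt]; ring

lemma intervalIntegrable_sub_rpow {α : ℝ} (hα : α < 1) (c a b : ℝ) :
    IntervalIntegrable (fun s => (c - s) ^ (-α)) volume a b := by
  have h := (intervalIntegral.intervalIntegrable_rpow' (r := -α) (a := c - a) (b := c - b)
    (by linarith)).comp_sub_left c
  simpa using h

lemma integral_sub_rpow {α : ℝ} (hα : α < 1) (c a b : ℝ) :
    ∫ s in a..b, (c - s) ^ (-α) = ((c - a) ^ (1 - α) - (c - b) ^ (1 - α)) / (1 - α) := by
  rw [intervalIntegral.integral_comp_sub_left (fun s => s ^ (-α)) c,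
    integral_rpow (Or.inl (by linarith))]
  ring_nf

lemma gamma_pos_of_mem {α : ℝ} (hα : α ∈ Ioo (0 : ℝ) 1) : 0 < Real.Gamma (1 - α) :=
  Real.Gamma_pos_of_pos (by linarith [hα.2])

section weights

variable {α : ℝ} {t : ℕ → ℝ}

/-- The kernel `(t_m - s)^{-α}` increases with `s`, so its mean over a mesh interval is at least its
value at any point to the left. -/
lemma rpow_le_wgt (hα : α ∈ Ioo (0 : ℝ) 1) (ht : StrictMono t) {m j : ℕ} (hj : 1 ≤ j) (hjm : j ≤ m)
    {x : ℝ} (hx : x ≤ t (j - 1)) :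
    (t m - x) ^ (-α) / Real.Gamma (1 - α) ≤ wgt α t m j := by
  have h1 : t (j - 1) < t j := ht (by omega)
  have h2 : t j ≤ t m := ht.monotone hjm
  have hτ : 0 < t j - t (j - 1) := by linarith
  have key : (t m - x) ^ (-α) * (t j - t (j - 1)) ≤ ∫ s in t (j - 1)..t j, (t m - s) ^ (-α) := by
    have : (t m - x) ^ (-α) * (t j - t (j - 1))
        = ∫ _ in t (j - 1)..t j, (t m - x) ^ (-α) := by simp [mul_comm]
    rw [this]
    refine intervalIntegral.integral_mono_on_of_le_Ioo h1.le (by simp)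
      (intervalIntegrable_sub_rpow hα.2 _ _ _) fun s hs => ?_
    exact Real.rpow_le_rpow_of_nonpos (by linarith [hs.2]) (by linarith [hs.1]) (by linarith [hα.1])
  rw [wgt, div_eq_inv_mul, one_div]
  refine mul_le_mul_of_nonneg_left ?_ (inv_nonneg.2 (gamma_pos_of_mem hα).le)
  rw [inv_mul_eq_div, le_div_iff₀ hτ]
  exact key

lemma wgt_le_rpow (hα : α ∈ Ioo (0 : ℝ) 1) (ht : StrictMono t) {m j : ℕ} (hj : 1 ≤ j)
    (hjm : j < m) :
    wgt α t m j ≤ (t m - t j) ^ (-α) / Real.Gamma (1 - α) := by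
  have h1 : t (j - 1) < t j := ht (by omega)
  have h2 : t j < t m := ht hjm
  have hτ : 0 < t j - t (j - 1) := by linarith
  have key : ∫ s in t (j - 1)..t j, (t m - s) ^ (-α) ≤ (t m - t j) ^ (-α) * (t j - t (j - 1)) := by
    have : (t m - t j) ^ (-α) * (t j - t (j - 1))
        = ∫ _ in t (j - 1)..t j, (t m - t j) ^ (-α) := by simp [mul_comm]
    rw [this]
    refine intervalIntegral.integral_mono_on_of_le_Ioo h1.le
      (intervalIntegrable_sub_rpow hα.2 _ _ _) (by simp) fun s hs => ?_
    exact Real.rpow_le_rpow_of_nonpos (by linarith [hs.2]) (by linarith [hs.2]) (by linarith [hα.1])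
  rw [wgt, div_eq_inv_mul ((t m - t j) ^ (-α)), one_div]
  refine mul_le_mul_of_nonneg_left ?_ (inv_nonneg.2 (gamma_pos_of_mem hα).le)
  rw [inv_mul_eq_div, div_le_iff₀ hτ]
  exact key

lemma wgt_pos (hα : α ∈ Ioo (0 : ℝ) 1) (ht : StrictMono t) {m j : ℕ} (hj : 1 ≤ j) (hjm : j ≤ m) :
    0 < wgt α t m j := by
  refine lt_of_lt_of_le ?_ (rpow_le_wgt hα ht hj hjm le_rfl)
  have : t (j - 1) < t m := ht (by omega)
  exact div_pos (Real.rpow_pos_of_pos (by linarith) _) (gamma_pos_of_mem hα)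

lemma wgt_mono (hα : α ∈ Ioo (0 : ℝ) 1) (ht : StrictMono t) {m j : ℕ} (hj : 1 ≤ j) (hjm : j < m) :
    wgt α t m j ≤ wgt α t m (j + 1) :=
  (wgt_le_rpow hα ht hj hjm).trans (rpow_le_wgt hα ht (by omega) hjm (by simp))

/-- The coefficient of `-U^j`, `j < m`, in the L1 operator `δ_t^α U^m`. -/
noncomputable def histCoeff (α : ℝ) (t : ℕ → ℝ) (m j : ℕ) : ℝ :=
  if j = 0 then wgt α t m 1 else wgt α t m (j + 1) - wgt α t m j

lemma histCoeff_nonneg (hα : α ∈ Ioo (0 : ℝ) 1) (ht : StrictMono t) {m j : ℕ} (hjm : j < m) :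
    0 ≤ histCoeff α t m j := by
  unfold histCoeff
  split_ifs with h
  · exact (wgt_pos hα ht le_rfl (by omega)).le
  · exact sub_nonneg.2 (wgt_mono hα ht (by omega) hjm)

/-- Summation by parts: the L1 operator as `κ_{m,m} U^m` minus a combination of earlier values. -/
lemma l1_eq_kappa_sub_hist (α : ℝ) (t U : ℕ → ℝ) {m : ℕ} (hm : 1 ≤ m) :
    l1 α t U m = kappa α t m * U m - ∑ j ∈ Finset.range m, histCoeff α t m j * U j := by
  rw [l1_eq_sum_wgt, kappa_eq_wgt]
  have key : ∀ n, 1 ≤ n → ∑ j ∈ Finset.Icc 1 n, wgt α t m j * (U j - U (j - 1))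
      = wgt α t m n * U n - ∑ j ∈ Finset.range n, histCoeff α t m j * U j := by
    intro n hn
    induction n, hn using Nat.le_induction with
    | base => simp [histCoeff]; ring
    | succ n hn ih =>
      rw [Finset.sum_Icc_succ_top (by omega), ih, Finset.sum_range_succ, histCoeff,
        if_neg (by omega)]
      simp only [Nat.add_sub_cancel]; ring
  exact key m hm

lemma kappa_pos (hα : α ∈ Ioo (0 : ℝ) 1) (ht : StrictMono t) {m : ℕ} (hm : 1 ≤ m) :
    0 < kappa α t m := kappa_eq_wgt α t m ▸ wgt_pos hα ht hm le_rfl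

/-- The discrete comparison principle for the L1 operator. -/
lemma le_of_l1_le (hα : α ∈ Ioo (0 : ℝ) 1) (ht : StrictMono t) {E V : ℕ → ℝ} {n : ℕ}
    (h0 : E 0 ≤ V 0) (h : ∀ m ∈ Finset.Icc 1 n, l1 α t E m ≤ l1 α t V m) :
    ∀ m ≤ n, E m ≤ V m := by
  intro m
  induction m using Nat.strong_induction_on with
  | _ m ih =>
    intro hmn
    rcases Nat.eq_zero_or_pos m with rfl | hm
    · exact h0
    have h1 := h m (Finset.mem_Icc.2 ⟨hm, hmn⟩)
    rw [l1_eq_kappa_sub_hist _ _ _ hm, l1_eq_kappa_sub_hist _ _ _ hm] at h1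
    have h2 : ∑ j ∈ Finset.range m, histCoeff α t m j * E j
        ≤ ∑ j ∈ Finset.range m, histCoeff α t m j * V j :=
      Finset.sum_le_sum fun j hj => by
        have hj := Finset.mem_range.1 hj
        exact mul_le_mul_of_nonneg_left (ih j hj (by omega)) (histCoeff_nonneg hα ht hj)
    have h3 : kappa α t m * E m ≤ kappa α t m * V m := by linarith
    exact le_of_mul_le_mul_left h3 (kappa_pos hα ht hm)

lemma l1_add (α : ℝ) (t U V : ℕ → ℝ) (m : ℕ) :
    l1 α t (fun j => U j + V j) m = l1 α t U m + l1 α t V m := by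
  simp only [l1_eq_sum_wgt, ← Finset.sum_add_distrib]
  exact Finset.sum_congr rfl fun j _ => by ring

lemma l1_sub (α : ℝ) (t U V : ℕ → ℝ) (m : ℕ) :
    l1 α t (fun j => U j - V j) m = l1 α t U m - l1 α t V m := by
  simp only [l1_eq_sum_wgt, ← Finset.sum_sub_distrib]
  exact Finset.sum_congr rfl fun j _ => by ring

lemma l1_const_mul (α : ℝ) (t U : ℕ → ℝ) (k : ℝ) (m : ℕ) :
    l1 α t (fun j => k * U j) m = k * l1 α t U m := by
  simp only [l1_eq_sum_wgt, Finset.mul_sum]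
  exact Finset.sum_congr rfl fun j _ => by ring

/-- The step function that jumps from `0` to `Γ(1-α)` in the first mesh interval is a barrier for
the weight `t_m^{-α}`. -/
lemma rpow_le_l1_step (hα : α ∈ Ioo (0 : ℝ) 1) (ht : StrictMono t) (ht0 : t 0 = 0) {m : ℕ}
    (hm : 1 ≤ m) :
    t m ^ (-α) ≤ l1 α t (fun j => if j = 0 then 0 else Real.Gamma (1 - α)) m := by
  have hΓ := gamma_pos_of_mem hα
  rw [l1_eq_sum_wgt, Finset.sum_eq_single_of_mem 1 (by simp [hm])]
  · have h := rpow_le_wgt hα ht le_rfl hm (x := 0) (by simp [ht0])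
    rw [sub_zero, div_le_iff₀ hΓ] at h
    simpa using h
  · intro j hj hj1
    have hj := Finset.mem_Icc.1 hj
    rw [if_neg (by omega), if_neg (by omega)]; ring

end weights

/-! ### The graded mesh -/

section mesh

variable {T r : ℝ} {M : ℕ}

lemma mesh_zero (hr : 1 ≤ r) : mesh T r M 0 = 0 := by
  simp [mesh, Real.zero_rpow (by linarith : r ≠ 0)]

lemma mesh_self (hM : 1 ≤ M) : mesh T r M M = T := by
  have : (M : ℝ) ≠ 0 := by positivity
  simp [mesh, this]

lemma mesh_strictMono (hT : 0 < T) (hr : 1 ≤ r) (hM : 1 ≤ M) : StrictMono (mesh T r M) := by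
  intro i j hij
  have hM' : (0 : ℝ) < M := by positivity
  have : (i : ℝ) < j := by exact_mod_cast hij
  unfold mesh
  gcongr

lemma mesh_nonneg (hT : 0 < T) (j : ℕ) : 0 ≤ mesh T r M j := by unfold mesh; positivity

lemma mesh_one (j : ℕ) : mesh T 1 M j = T / M * j := by simp [mesh]; ring

lemma mesh_sub_le (hT : 0 < T) (hr : 1 ≤ r) {j : ℕ} (hj : 1 ≤ j) :
    mesh T r M j - mesh T r M (j - 1) ≤ r / j * mesh T r M j := by
  have hj' : (1 : ℝ) ≤ j := by exact_mod_cast hj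
  have hj0 : (0 : ℝ) < j := by linarith
  have hB := one_add_mul_self_le_rpow_one_add (s := -(1 / (j : ℝ)))
    (by rw [neg_le_neg_iff, div_le_one hj0]; exact hj') hr
  have e : ((j - 1 : ℕ) : ℝ) / M = (1 + -(1 / (j : ℝ))) * (j / M) := by
    rw [Nat.cast_sub hj]; field_simp; simp; ring
  have hnn : 0 ≤ 1 + -(1 / (j : ℝ)) := by
    rw [← sub_eq_add_neg, sub_nonneg, div_le_one hj0]; exact hj'
  unfold mesh
  rw [e, Real.mul_rpow hnn (by positivity)]
  have : 0 ≤ T * ((j : ℝ) / M) ^ r := by positivity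
  calc _ = (1 - (1 + -(1 / (j : ℝ))) ^ r) * (T * ((j : ℝ) / M) ^ r) := by ring
    _ ≤ (r / j) * (T * ((j : ℝ) / M) ^ r) := by
      gcongr
      have : r * -(1 / (j : ℝ)) = - (r / j) := by ring
      linarith

lemma mesh_div_le_sub (hT : 0 < T) (hr : 1 ≤ r) {j : ℕ} (hj : 1 ≤ j) :
    mesh T r M j / j ≤ mesh T r M j - mesh T r M (j - 1) := by
  have hj' : (1 : ℝ) ≤ j := by exact_mod_cast hj
  have hj0 : (0 : ℝ) < j := by linarith
  have e : ((j - 1 : ℕ) : ℝ) / M = (1 - 1 / (j : ℝ)) * (j / M) := by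
    rw [Nat.cast_sub hj]; field_simp; simp
  have hnn : 0 ≤ 1 - 1 / (j : ℝ) := by
    rw [sub_nonneg, div_le_one hj0]; exact hj'
  have h1 : (1 - 1 / (j : ℝ)) ^ r ≤ 1 - 1 / (j : ℝ) :=
    Real.rpow_le_self_of_le_one hnn (by simp) hr
  unfold mesh
  rw [e, Real.mul_rpow hnn (by positivity)]
  have : 0 ≤ T * ((j : ℝ) / M) ^ r := by positivity
  calc _ = (1 / (j : ℝ)) * (T * ((j : ℝ) / M) ^ r) := by ring
    _ ≤ (1 - (1 - 1 / (j : ℝ)) ^ r) * (T * ((j : ℝ) / M) ^ r) := by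
      gcongr; linarith
    _ = _ := by ring

lemma mesh_le_half (hT : 0 < T) (hr : 1 ≤ r) {i j : ℕ} (hij : 2 * i ≤ j) :
    mesh T r M i ≤ mesh T r M j / 2 := by
  have h : (i : ℝ) / M ≤ (1 / 2) * (j / M) := by
    have : 2 * (i : ℝ) ≤ j := by exact_mod_cast hij
    rw [← mul_div_assoc]
    gcongr; linarith
  have h2 : ((1 : ℝ) / 2) ^ r ≤ 1 / 2 :=
    Real.rpow_le_self_of_le_one (by norm_num) (by norm_num) hr
  unfold mesh
  have : 0 ≤ T * ((j : ℝ) / M) ^ r := by positivity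
  calc _ ≤ T * ((1 / 2) * (j / M)) ^ r := by gcongr
    _ = (1 / 2) ^ r * (T * ((j : ℝ) / M) ^ r) := by
      rw [Real.mul_rpow (by norm_num) (by positivity)]; ring
    _ ≤ 1 / 2 * (T * ((j : ℝ) / M) ^ r) := by gcongr
    _ = _ := by ring

end mesh

/-! ### Sums of powers -/

/-- An upper bound for all partial sums of `∑_j j^{-q}`. -/
noncomputable def zetaBound (q : ℝ) : ℝ := ∑' n : ℕ, (n : ℝ) ^ (-q)

lemma zetaBound_nonneg (q : ℝ) : 0 ≤ zetaBound q := tsum_nonneg fun n => by positivity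

lemma sum_rpow_neg_le {q : ℝ} (hq : 1 < q) (s : Finset ℕ) :
    ∑ j ∈ s, (j : ℝ) ^ (-q) ≤ zetaBound q :=
  (Real.summable_nat_rpow.2 (by linarith : -q < -1)).sum_le_tsum s fun n _ => by positivity

lemma rpow_neg_le_of_half_le {p : ℝ} (hp : 0 ≤ p) {x y : ℝ} (hx : 0 < x) (h : x ≤ 2 * y) :
    y ^ (-p) ≤ 2 ^ p * x ^ (-p) := by
  have h1 : y ^ (-p) ≤ (x / 2) ^ (-p) :=
    Real.rpow_le_rpow_of_nonpos (by linarith) (by linarith) (by linarith)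
  rwa [Real.div_rpow hx.le (by norm_num), Real.rpow_neg (by norm_num : (0:ℝ) ≤ 2), div_inv_eq_mul,
    mul_comm] at h1

lemma sum_Icc_reflect (f : ℕ → ℝ) (k : ℕ) :
    ∑ j ∈ Finset.Icc 1 (k - 1), f (k - j) = ∑ j ∈ Finset.Icc 1 (k - 1), f j := by
  refine Finset.sum_bij' (fun j _ => k - j) (fun j _ => k - j) ?_ ?_ ?_ ?_ ?_ <;>
    intro j hj <;> simp only [Finset.mem_Icc] at * <;> omega

/-- The discrete convolution of two summable powers decays like the slower of the two. -/
lemma sum_rpow_mul_rpow_le {p q : ℝ} (hq : 1 < q) (hqp : q ≤ p) {k : ℕ} (hk : 1 ≤ k) :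
    ∑ j ∈ Finset.Icc 1 (k - 1), (j : ℝ) ^ (-q) * ((k : ℝ) - j) ^ (-p)
      ≤ 2 ^ p * (zetaBound q + zetaBound p) * (k : ℝ) ^ (-q) := by
  have hk1 : (1 : ℝ) ≤ k := by exact_mod_cast hk
  have hk0 : (0 : ℝ) < k := by linarith
  have term : ∀ j ∈ Finset.Icc 1 (k - 1), (j : ℝ) ^ (-q) * ((k : ℝ) - j) ^ (-p)
      ≤ 2 ^ p * (k : ℝ) ^ (-q) * ((j : ℝ) ^ (-q) + ((k - j : ℕ) : ℝ) ^ (-p)) := by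
    intro j hj
    have hj := Finset.mem_Icc.1 hj
    have hjk : j ≤ k := by omega
    rw [Nat.cast_sub hjk]
    have hj' : (j : ℝ) ≤ k := by exact_mod_cast hjk
    have ha : 0 ≤ (j : ℝ) ^ (-q) := by positivity
    have hb : 0 ≤ ((k : ℝ) - j) ^ (-p) := Real.rpow_nonneg (by linarith) _
    have hc : 0 ≤ 2 ^ p * (k : ℝ) ^ (-q) := by positivity
    rcases le_total (k : ℝ) (2 * j) with h | h
    · have h1 := rpow_neg_le_of_half_le (by linarith : 0 ≤ q) hk0 h
      have h2 : (2 : ℝ) ^ q * (k : ℝ) ^ (-q) ≤ 2 ^ p * (k : ℝ) ^ (-q) := by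
        gcongr; norm_num
      nlinarith [mul_le_mul_of_nonneg_right (h1.trans h2) hb, mul_nonneg hc ha]
    · have h1 := rpow_neg_le_of_half_le (by linarith : 0 ≤ p) hk0
        (by linarith : (k : ℝ) ≤ 2 * (k - j))
      have h2 : (2 : ℝ) ^ p * (k : ℝ) ^ (-p) ≤ 2 ^ p * (k : ℝ) ^ (-q) := by
        gcongr
      nlinarith [mul_le_mul_of_nonneg_right (h1.trans h2) ha, mul_nonneg hc hb]
  refine (Finset.sum_le_sum term).trans ?_
  rw [← Finset.mul_sum, Finset.sum_add_distrib,
    sum_Icc_reflect (fun j => (j : ℝ) ^ (-p)) k]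
  have h1 := sum_rpow_neg_le hq (Finset.Icc 1 (k - 1))
  have h2 := sum_rpow_neg_le (by linarith : 1 < p) (Finset.Icc 1 (k - 1))
  calc _ ≤ 2 ^ p * (k : ℝ) ^ (-q) * (zetaBound q + zetaBound p) := by gcongr
    _ = _ := by ring

lemma sum_rpow_neg_le_rpow {β : ℝ} (hβ : β ∈ Ioo (0 : ℝ) 1) (m : ℕ) :
    ∑ j ∈ Finset.Icc 1 m, (j : ℝ) ^ (-β) ≤ (m : ℝ) ^ (1 - β) / (1 - β) := by
  induction m with
  | zero => simp [Real.zero_rpow (by linarith [hβ.2] : 1 - β ≠ 0)]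
  | succ m ih =>
    rw [Finset.sum_Icc_succ_top (by omega)]
    have h1 : 0 < 1 - β := by linarith [hβ.2]
    have hm : (0 : ℝ) < (m : ℝ) + 1 := by positivity
    have key : (m : ℝ) ^ (1 - β) + (1 - β) * ((m : ℝ) + 1) ^ (-β) ≤ ((m : ℝ) + 1) ^ (1 - β) := by
      have hB := rpow_one_add_le_one_add_mul_self (s := -(1 / ((m : ℝ) + 1)))
        (by rw [neg_le_neg_iff, div_le_one hm]; linarith [(Nat.cast_nonneg m : (0 : ℝ) ≤ m)])
        h1.le (by linarith [hβ.1])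
      have e : (m : ℝ) = ((m : ℝ) + 1) * (1 + -(1 / ((m : ℝ) + 1))) := by field_simp; ring
      have e2 : ((m : ℝ) + 1) ^ (1 - β) = (m + 1) * ((m : ℝ) + 1) ^ (-β) := by
        rw [sub_eq_add_neg, Real.rpow_add hm, Real.rpow_one]
      have hnn : 0 ≤ 1 + -(1 / ((m : ℝ) + 1)) := by
        rw [← sub_eq_add_neg, sub_nonneg, div_le_one hm]
        linarith [(Nat.cast_nonneg m : (0 : ℝ) ≤ m)]
      have e3 : (m : ℝ) ^ (1 - β)
          = ((m : ℝ) + 1) ^ (1 - β) * (1 + -(1 / ((m : ℝ) + 1))) ^ (1 - β) := by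
        rw [← Real.mul_rpow hm.le hnn, ← e]
      rw [e3]
      have hp : 0 ≤ ((m : ℝ) + 1) ^ (1 - β) := by positivity
      have h3 := mul_le_mul_of_nonneg_left hB hp
      have h4 : ((m : ℝ) + 1) ^ (1 - β) * (1 + (1 - β) * -(1 / ((m : ℝ) + 1)))
          = ((m : ℝ) + 1) ^ (1 - β) - (1 - β) * ((m : ℝ) + 1) ^ (-β) := by
        rw [e2]; field_simp
        ring
      linarith
    push_cast
    rw [le_div_iff₀ h1] at ih ⊢
    linarith

/-- The discrete convolution of a summable and a non-summable power decays like the latter. -/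
lemma sum_rpow_mul_rpow_le' {β q : ℝ} (hβ : β ∈ Ioo (0 : ℝ) 1) (hq : 1 < q) {m : ℕ} (hm : 1 ≤ m) :
    ∑ j ∈ Finset.Icc 1 m, ((m : ℝ) - j + 1) ^ (-β) * (j : ℝ) ^ (-q)
      ≤ 2 ^ q * (zetaBound q + 1 / (1 - β)) * (m : ℝ) ^ (-β) := by
  have hm1 : (1 : ℝ) ≤ m := by exact_mod_cast hm
  have hm0 : (0 : ℝ) < m := by linarith
  have h1β : 0 < 1 - β := by linarith [hβ.2]
  have term : ∀ j ∈ Finset.Icc 1 m, ((m : ℝ) - j + 1) ^ (-β) * (j : ℝ) ^ (-q)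
      ≤ 2 ^ q * (m : ℝ) ^ (-β) * (j : ℝ) ^ (-q)
        + 2 ^ q * (m : ℝ) ^ (-q) * ((m + 1 - j : ℕ) : ℝ) ^ (-β) := by
    intro j hj
    have hj := Finset.mem_Icc.1 hj
    have hj' : (j : ℝ) ≤ m := by exact_mod_cast hj.2
    have e : ((m + 1 - j : ℕ) : ℝ) = (m : ℝ) - j + 1 := by
      rw [Nat.cast_sub (by omega)]; push_cast; ring
    rw [e]
    have ha : 0 ≤ (j : ℝ) ^ (-q) := by positivity
    have hb : 0 ≤ ((m : ℝ) - j + 1) ^ (-β) := Real.rpow_nonneg (by linarith) _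
    have hc : 0 ≤ 2 ^ q * (m : ℝ) ^ (-β) := by positivity
    have hd : 0 ≤ 2 ^ q * (m : ℝ) ^ (-q) := by positivity
    rcases le_total (m : ℝ) (2 * j) with h | h
    · have h1 := rpow_neg_le_of_half_le (by linarith : 0 ≤ q) hm0 h
      nlinarith [mul_le_mul_of_nonneg_right h1 hb, mul_nonneg hc ha]
    · have h1 := rpow_neg_le_of_half_le hβ.1.le hm0 (by linarith : (m : ℝ) ≤ 2 * (m - j + 1))
      have h2 : (2 : ℝ) ^ β * (m : ℝ) ^ (-β) ≤ 2 ^ q * (m : ℝ) ^ (-β) := by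
        gcongr
        · norm_num
        · linarith [hβ.2]
      nlinarith [mul_le_mul_of_nonneg_right (h1.trans h2) ha, mul_nonneg hd hb]
  refine (Finset.sum_le_sum term).trans ?_
  have hr := sum_Icc_reflect (fun j => (j : ℝ) ^ (-β)) (m + 1)
  simp only [Nat.add_sub_cancel] at hr
  rw [Finset.sum_add_distrib, ← Finset.mul_sum, ← Finset.mul_sum, hr]
  have h1 := sum_rpow_neg_le hq (Finset.Icc 1 m)
  have h2 := sum_rpow_neg_le_rpow hβ m
  have h3 : (m : ℝ) ^ (-q) * ((m : ℝ) ^ (1 - β) / (1 - β)) ≤ 1 / (1 - β) * (m : ℝ) ^ (-β) := by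
    rw [mul_div_assoc', ← Real.rpow_add hm0, div_mul_eq_mul_div, one_mul]
    gcongr
    linarith
  have h2q : (0 : ℝ) < 2 ^ q := by positivity
  calc _ ≤ 2 ^ q * (m : ℝ) ^ (-β) * zetaBound q
        + 2 ^ q * (m : ℝ) ^ (-q) * ((m : ℝ) ^ (1 - β) / (1 - β)) := by gcongr
    _ = 2 ^ q * (m : ℝ) ^ (-β) * zetaBound q
        + 2 ^ q * ((m : ℝ) ^ (-q) * ((m : ℝ) ^ (1 - β) / (1 - β))) := by ring
    _ ≤ 2 ^ q * (m : ℝ) ^ (-β) * zetaBound q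
        + 2 ^ q * (1 / (1 - β) * (m : ℝ) ^ (-β)) := by gcongr
    _ = _ := by ring

/-! ### The inverse of the L1 operator on the uniform mesh -/

/-- The ratios `a (n + 1) / a n` of a positive log-convex sequence increase. -/
lemma mul_le_mul_of_logConvex {a : ℕ → ℝ} (hpos : ∀ n, 0 < a n)
    (hlog : ∀ n, a (n + 1) ^ 2 ≤ a n * a (n + 2)) {i n : ℕ} (hin : i ≤ n) :
    a (i + 1) * a n ≤ a i * a (n + 1) := by
  induction n, hin using Nat.le_induction with
  | base => exact (mul_comm _ _).le
  | succ n _ ih =>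
    refine le_of_mul_le_mul_right ?_ (hpos n)
    calc a (i + 1) * a (n + 1) * a n = a (i + 1) * a n * a (n + 1) := by ring
      _ ≤ a i * a (n + 1) * a (n + 1) := mul_le_mul_of_nonneg_right ih (hpos _).le
      _ = a i * a (n + 1) ^ 2 := by ring
      _ ≤ a i * (a n * a (n + 2)) := mul_le_mul_of_nonneg_left (hlog n) (hpos _).le
      _ = a i * a (n + 1 + 1) * a n := by ring

lemma coeff_inv_mul_sum {a : ℕ → ℝ} (h0 : a 0 = 1) (n : ℕ) :
    ∑ i ∈ Finset.range (n + 1), (PowerSeries.mk a)⁻¹.coeff i * a (n - i)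
      = if n = 0 then 1 else 0 := by
  have h : (PowerSeries.mk a)⁻¹ * PowerSeries.mk a = 1 :=
    PowerSeries.inv_mul_cancel _ (by simp [← PowerSeries.coeff_zero_eq_constantCoeff_apply, h0])
  have h1 := congrArg (PowerSeries.coeff n) h
  rw [PowerSeries.coeff_mul, PowerSeries.coeff_one,
    Finset.Nat.sum_antidiagonal_eq_sum_range_succ_mk] at h1
  simpa using h1

/-- Kaluza's theorem: the reciprocal of a power series with positive log-convex coefficients has
nonpositive coefficients after the first one. -/
lemma coeff_inv_nonpos {a : ℕ → ℝ} (h0 : a 0 = 1) (hpos : ∀ n, 0 < a n)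
    (hlog : ∀ n, a (n + 1) ^ 2 ≤ a n * a (n + 2)) (n : ℕ) :
    (PowerSeries.mk a)⁻¹.coeff (n + 1) ≤ 0 := by
  set q := fun n => (PowerSeries.mk a)⁻¹.coeff n with hq
  have hsum : ∀ n, ∑ i ∈ Finset.range (n + 1), q i * a (n - i) = if n = 0 then 1 else 0 :=
    coeff_inv_mul_sum h0
  change q (n + 1) ≤ 0
  have hq0 : q 0 = 1 := by simpa [h0] using hsum 0
  induction n using Nat.strong_induction_on with
  | _ n ih =>
    have h1 := hsum (n + 1)
    rw [Finset.sum_range_succ, Nat.sub_self, h0, mul_one, if_neg (by omega)] at h1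
    suffices 0 ≤ ∑ i ∈ Finset.range (n + 1), q i * a (n + 1 - i) by linarith
    have h2 : 0 ≤ ∑ i ∈ Finset.range (n + 1), q i * a (n - i) := by
      rw [hsum n]; split_ifs <;> norm_num
    have h3 : ∀ i ∈ Finset.range (n + 1),
        q i * a (n - i) * a (n + 1) ≤ q i * a (n + 1 - i) * a n := by
      intro i hi
      have hi := Finset.mem_range.1 hi
      rcases Nat.eq_zero_or_pos i with rfl | hi0
      · simp [hq0, mul_comm]
      · obtain ⟨k, rfl⟩ : ∃ k, i = k + 1 := ⟨i - 1, by omega⟩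
        have hneg := ih k (by omega)
        have hx := mul_le_mul_of_logConvex hpos hlog (Nat.sub_le n (k + 1))
        rw [show n - (k + 1) + 1 = n + 1 - (k + 1) by omega] at hx
        nlinarith
    have h4 : (∑ i ∈ Finset.range (n + 1), q i * a (n - i)) * a (n + 1)
        ≤ (∑ i ∈ Finset.range (n + 1), q i * a (n + 1 - i)) * a n := by
      rw [Finset.sum_mul, Finset.sum_mul]
      exact Finset.sum_le_sum h3
    exact nonneg_of_mul_nonneg_left ((mul_nonneg h2 (hpos _).le).trans h4) (hpos n)

/-- The complementary kernel of `a`: the coefficients of `1 / ((1 - X) ∑ a_n X^n)`. -/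
noncomputable def compl (a : ℕ → ℝ) (n : ℕ) : ℝ :=
  ∑ i ∈ Finset.range (n + 1), (PowerSeries.mk a)⁻¹.coeff i

lemma mk_compl (a : ℕ → ℝ) :
    PowerSeries.mk (compl a) = (PowerSeries.mk a)⁻¹ * PowerSeries.mk 1 := by
  ext n
  rw [PowerSeries.coeff_mk, compl, PowerSeries.coeff_mul,
    Finset.Nat.sum_antidiagonal_eq_sum_range_succ_mk]
  simp

lemma compl_mul_sum {a : ℕ → ℝ} (h0 : a 0 = 1) (n : ℕ) :
    ∑ i ∈ Finset.range (n + 1), compl a i * a (n - i) = 1 := by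
  have h : PowerSeries.mk (compl a) * PowerSeries.mk a = PowerSeries.mk 1 := by
    rw [mk_compl, mul_right_comm, PowerSeries.inv_mul_cancel _
      (by simp [← PowerSeries.coeff_zero_eq_constantCoeff_apply, h0]), one_mul]
  have h1 := congrArg (PowerSeries.coeff n) h
  rw [PowerSeries.coeff_mul, Finset.Nat.sum_antidiagonal_eq_sum_range_succ_mk] at h1
  simpa using h1

section compl

variable {a : ℕ → ℝ} (h0 : a 0 = 1) (hpos : ∀ n, 0 < a n)
    (hlog : ∀ n, a (n + 1) ^ 2 ≤ a n * a (n + 2))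

include h0 hpos hlog

lemma compl_antitone : Antitone (compl a) := by
  refine antitone_nat_of_succ_le fun n => ?_
  rw [compl, Finset.sum_range_succ]
  have := coeff_inv_nonpos h0 hpos hlog n
  rw [← compl]; linarith

/-- As `a` decreases and the coefficients of `1 / ∑ a_n X^n` after the first one are nonpositive,
`compl a n * a n` is at least the `n`-th coefficient of the product of the two series. -/
lemma compl_nonneg (hanti : Antitone a) (n : ℕ) : 0 ≤ compl a n := by
  have h1 : 0 ≤ ∑ i ∈ Finset.range (n + 1), (PowerSeries.mk a)⁻¹.coeff i * a (n - i) := by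
    rw [coeff_inv_mul_sum h0]; split_ifs <;> norm_num
  have h2 : ∑ i ∈ Finset.range (n + 1), (PowerSeries.mk a)⁻¹.coeff i * a (n - i)
      ≤ compl a n * a n := by
    rw [compl, Finset.sum_mul]
    refine Finset.sum_le_sum fun i _ => ?_
    rcases Nat.eq_zero_or_pos i with rfl | hi0
    · simp
    · obtain ⟨k, rfl⟩ : ∃ k, i = k + 1 := ⟨i - 1, by omega⟩
      exact mul_le_mul_of_nonpos_left (hanti (Nat.sub_le _ _)) (coeff_inv_nonpos h0 hpos hlog k)
  exact nonneg_of_mul_nonneg_left (h1.trans h2) (hpos n)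

/-- As the complementary kernel decreases, it is bounded by the reciprocal of the partial sum. -/
lemma compl_mul_partialSum_le (n : ℕ) : compl a n * ∑ i ∈ Finset.range (n + 1), a i ≤ 1 := by
  rw [← compl_mul_sum h0 n, Finset.mul_sum, ← Finset.sum_range_reflect]
  refine Finset.sum_le_sum fun i hi => ?_
  have hi := Finset.mem_range.1 hi
  rw [Nat.add_sub_cancel]
  exact mul_le_mul_of_nonneg_right (compl_antitone h0 hpos hlog (by omega)) (hpos _).le

end compl

lemma sum_Icc_one_eq (f : ℕ → ℝ) (n : ℕ) :
    ∑ j ∈ Finset.Icc 1 n, f j = ∑ j ∈ Finset.range n, f (j + 1) := by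
  induction n with
  | zero => simp
  | succ n ih => rw [Finset.sum_Icc_succ_top (by omega), ih, Finset.sum_range_succ]

/-- Inversion of a discrete convolution by the complementary kernel. -/
lemma sub_eq_sum_compl {a : ℕ → ℝ} (h0 : a 0 = 1) (E : ℕ → ℝ) (m : ℕ) :
    E m - E 0 = ∑ k ∈ Finset.Icc 1 m, compl a (m - k) *
      ∑ j ∈ Finset.Icc 1 k, a (k - j) * (E j - E (j - 1)) := by
  have e1 : ∀ k, ∑ j ∈ Finset.Icc 1 k, a (k - j) * (E j - E (j - 1))
      = (PowerSeries.mk a * PowerSeries.mk fun j => E j - E (j - 1)).coeff k := by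
    intro k
    rw [mul_comm, PowerSeries.coeff_mul, Finset.Nat.sum_antidiagonal_eq_sum_range_succ_mk,
      Finset.sum_range_succ', sum_Icc_one_eq]
    simp [mul_comm]
  have e2 : ∑ k ∈ Finset.Icc 1 m, compl a (m - k) *
      ∑ j ∈ Finset.Icc 1 k, a (k - j) * (E j - E (j - 1))
      = (PowerSeries.mk (compl a) * (PowerSeries.mk a *
          PowerSeries.mk fun j => E j - E (j - 1))).coeff m := by
    rw [mul_comm, PowerSeries.coeff_mul, Finset.Nat.sum_antidiagonal_eq_sum_range_succ_mk,
      Finset.sum_range_succ', sum_Icc_one_eq]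
    simp only [e1]
    simp [mul_comm]
  have e3 : PowerSeries.mk (compl a) * (PowerSeries.mk a * PowerSeries.mk fun j => E j - E (j - 1))
      = (PowerSeries.mk fun j => E j - E (j - 1)) * PowerSeries.mk 1 := by
    rw [mk_compl, ← mul_assoc, mul_right_comm _ (PowerSeries.mk 1), PowerSeries.inv_mul_cancel _
      (by simp [← PowerSeries.coeff_zero_eq_constantCoeff_apply, h0]), one_mul, mul_comm]
  rw [e2, e3, PowerSeries.coeff_mul, Finset.Nat.sum_antidiagonal_eq_sum_range_succ_mk,
    Finset.sum_range_succ']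
  simp [← Finset.sum_range_sub E]

/-- The weights of the L1 operator on a uniform mesh, up to a constant factor. -/
noncomputable def unifWgt (α : ℝ) (n : ℕ) : ℝ := ((n : ℝ) + 1) ^ (1 - α) - (n : ℝ) ^ (1 - α)

lemma unifWgt_zero {α : ℝ} (hα : α < 1) : unifWgt α 0 = 1 := by
  simp [unifWgt, Real.zero_rpow (by linarith : 1 - α ≠ 0)]

lemma unifWgt_pos {α : ℝ} (hα : α < 1) (n : ℕ) : 0 < unifWgt α n := by
  have : (n : ℝ) ^ (1 - α) < ((n : ℝ) + 1) ^ (1 - α) :=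
    Real.rpow_lt_rpow (by positivity) (by linarith) (by linarith)
  unfold unifWgt; linarith

lemma sum_unifWgt {α : ℝ} (hα : α < 1) (n : ℕ) :
    ∑ i ∈ Finset.range (n + 1), unifWgt α i = ((n : ℝ) + 1) ^ (1 - α) := by
  have h := Finset.sum_range_sub (fun i : ℕ => (i : ℝ) ^ (1 - α)) (n + 1)
  simp only [Nat.cast_add, Nat.cast_one, Nat.cast_zero,
    Real.zero_rpow (by linarith : 1 - α ≠ 0), sub_zero] at h
  exact h

lemma unifWgt_eq_integral {α : ℝ} (hα : α < 1) (n : ℕ) :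
    unifWgt α n = (1 - α) * ∫ s in (0 : ℝ)..1, (s + n) ^ (-α) := by
  have h : 1 - α ≠ 0 := by linarith
  rw [intervalIntegral.integral_comp_add_right (fun s : ℝ => s ^ (-α)) (n : ℝ),
    integral_rpow (Or.inl (by linarith)), unifWgt]
  rw [zero_add, show -α + 1 = 1 - α by ring, mul_div_cancel₀ _ h, add_comm (1 : ℝ)]

lemma intervalIntegrable_add_rpow {α : ℝ} (hα : α < 1) (n : ℝ) :
    IntervalIntegrable (fun s : ℝ => (s + n) ^ (-α)) volume 0 1 := by
  have h := (intervalIntegral.intervalIntegrable_rpow' (r := -α) (a := 0 + n) (b := 1 + n)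
    (by linarith)).comp_add_right n
  simpa using h

lemma unifWgt_antitone {α : ℝ} (hα : α ∈ Ioo (0 : ℝ) 1) : Antitone (unifWgt α) := by
  refine antitone_nat_of_succ_le fun n => ?_
  rw [unifWgt_eq_integral hα.2, unifWgt_eq_integral hα.2]
  refine mul_le_mul_of_nonneg_left ?_ (by linarith [hα.2])
  refine intervalIntegral.integral_mono_on_of_le_Ioo zero_le_one
    (intervalIntegrable_add_rpow hα.2 _) (intervalIntegrable_add_rpow hα.2 _) fun s hs => ?_
  refine Real.rpow_le_rpow_of_nonpos ?_ ?_ (by linarith [hα.1])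
  · have := hs.1; positivity
  · push_cast; linarith

lemma unifWgt_logConvex {α : ℝ} (hα : α ∈ Ioo (0 : ℝ) 1) (n : ℕ) :
    unifWgt α (n + 1) ^ 2 ≤ unifWgt α n * unifWgt α (n + 2) := by
  -- Nonnegativity of a quadratic polynomial for all arguments yields its discriminant inequality.
  have key : ∀ x : ℝ, 0 ≤ unifWgt α n * (x * x) + (-2 * unifWgt α (n + 1)) * x
      + unifWgt α (n + 2) := by
    intro x
    have hi := fun k : ℕ => intervalIntegrable_add_rpow hα.2 (k : ℝ)
    have e : unifWgt α n * (x * x) + (-2 * unifWgt α (n + 1)) * x + unifWgt α (n + 2)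
        = (1 - α) * ∫ s in (0 : ℝ)..1, ((x * x) * (s + n) ^ (-α)
          + (-2 * x) * (s + (n + 1 : ℕ)) ^ (-α) + (s + (n + 2 : ℕ)) ^ (-α)) := by
      rw [intervalIntegral.integral_add (((hi n).const_mul _).add ((hi _).const_mul _)) (hi _),
        intervalIntegral.integral_add ((hi n).const_mul _) ((hi _).const_mul _),
        intervalIntegral.integral_const_mul, intervalIntegral.integral_const_mul,
        unifWgt_eq_integral hα.2, unifWgt_eq_integral hα.2, unifWgt_eq_integral hα.2]
      ring
    rw [e]
    refine mul_nonneg (by linarith [hα.2]) ?_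
    refine intervalIntegral.integral_nonneg_of_ae_restrict zero_le_one ?_
    filter_upwards [ae_restrict_mem measurableSet_Icc,
      ae_restrict_of_ae (Measure.ae_ne volume (0 : ℝ))] with s hs hs0
    have hs' : 0 < s := lt_of_le_of_ne hs.1 (Ne.symm hs0)
    set y := s + (n : ℝ) with hy
    have hy0 : 0 < y := by positivity
    have e1 : s + ((n + 1 : ℕ) : ℝ) = y + 1 := by push_cast; ring
    have e2 : s + ((n + 2 : ℕ) : ℝ) = y + 2 := by push_cast; ring
    simp only [e1, e2, Pi.zero_apply]
    set A := y ^ (-α / 2)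
    set B := (y + 2) ^ (-α / 2)
    have hA : y ^ (-α) = A ^ 2 := by
      rw [← Real.rpow_natCast, ← Real.rpow_mul hy0.le]; congr 1; push_cast; ring
    have hB : (y + 2) ^ (-α) = B ^ 2 := by
      rw [← Real.rpow_natCast, ← Real.rpow_mul (by linarith)]; congr 1; push_cast; ring
    have hAB : (y + 1) ^ (-α) ≤ A * B := by
      rw [← Real.mul_rpow hy0.le (by linarith)]
      have : (y + 1) ^ (-α) = ((y + 1) ^ 2) ^ (-α / 2) := by
        rw [← Real.rpow_natCast, ← Real.rpow_mul (by linarith)]; congr 1; push_cast; ring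
      rw [this]
      exact Real.rpow_le_rpow_of_nonpos (by positivity) (by nlinarith) (by linarith [hα.1])
    have hP : 0 ≤ (y + 1) ^ (-α) := by positivity
    rw [hA, hB]
    rcases le_total 0 x with hx | hx
    · nlinarith [sq_nonneg (x * A - B), mul_le_mul_of_nonneg_left hAB hx]
    · nlinarith [sq_nonneg (x * A), sq_nonneg B, mul_nonneg (neg_nonneg.2 hx) hP]
  have h := discrim_le_zero key
  rw [discrim] at h
  nlinarith

lemma wgt_mesh_one {α : ℝ} (hα : α ∈ Ioo (0 : ℝ) 1) {T : ℝ} (hT : 0 < T) {M : ℕ} (hM : 1 ≤ M)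
    {m j : ℕ} (hj : 1 ≤ j) (hjm : j ≤ m) :
    wgt α (mesh T 1 M) m j
      = (T / M) ^ (-α) / (Real.Gamma (1 - α) * (1 - α)) * unifWgt α (m - j) := by
  have hτ : 0 < T / M := by positivity
  have hjm' : (j : ℝ) ≤ m := by exact_mod_cast hjm
  have h1 : ((j - 1 : ℕ) : ℝ) = j - 1 := by push_cast [hj]; ring
  have h2 : ((m - j : ℕ) : ℝ) = m - j := by push_cast [hjm]; ring
  rw [wgt, integral_sub_rpow hα.2, unifWgt, h2]
  simp only [mesh_one, h1]
  set τ := T / M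
  rw [show τ * j - τ * (j - 1) = τ by ring, show τ * m - τ * (j - 1) = τ * (m - j + 1) by ring,
    show τ * (m : ℝ) - τ * j = τ * (m - j) by ring, Real.mul_rpow hτ.le (by linarith),
    Real.mul_rpow hτ.le (by linarith), sub_eq_add_neg 1 α, Real.rpow_add hτ, Real.rpow_one]
  have : 1 + -α ≠ 0 := by linarith [hα.2]
  have hΓ : Real.Gamma (1 + -α) ≠ 0 := by
    have := (gamma_pos_of_mem hα).ne'; rwa [sub_eq_add_neg] at this
  field_simp

/-- Stability of the L1 operator on the uniform mesh for a right-hand side that decays faster than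
the reciprocal of time: the solution decays like `t^{α-1}`. -/
lemma le_of_l1_le_rpow {α : ℝ} (hα : α ∈ Ioo (0 : ℝ) 1) {q : ℝ} (hq : 1 < q) {T : ℝ} (hT : 0 < T)
    {M : ℕ} (hM : 1 ≤ M) {E : ℕ → ℝ} {F : ℝ} (hF : 0 ≤ F) {m : ℕ} (hm : 1 ≤ m)
    (h : ∀ k ∈ Finset.Icc 1 m, l1 α (mesh T 1 M) E k ≤ F * (k : ℝ) ^ (-q)) :
    E m - E 0 ≤ (Real.Gamma (1 - α) * (1 - α)) * (2 ^ q * (zetaBound q + 1 / α))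
      * (T / M) ^ α * F * (m : ℝ) ^ (α - 1) := by
  have hτ : 0 < T / M := by positivity
  have hG : 0 < Real.Gamma (1 - α) * (1 - α) :=
    mul_pos (gamma_pos_of_mem hα) (by linarith [hα.2])
  have ha0 := unifWgt_zero hα.2
  have hapos := unifWgt_pos hα.2
  have halog := unifWgt_logConvex hα
  have hS : ∀ k ∈ Finset.Icc 1 m, ∑ j ∈ Finset.Icc 1 k, unifWgt α (k - j) * (E j - E (j - 1))
      ≤ (Real.Gamma (1 - α) * (1 - α)) * (T / M) ^ α * (F * (k : ℝ) ^ (-q)) := by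
    intro k hk
    have h1 := h k hk
    have e : l1 α (mesh T 1 M) E k = (T / M) ^ (-α) / (Real.Gamma (1 - α) * (1 - α)) *
        ∑ j ∈ Finset.Icc 1 k, unifWgt α (k - j) * (E j - E (j - 1)) := by
      rw [l1_eq_sum_wgt, Finset.mul_sum]
      refine Finset.sum_congr rfl fun j hj => ?_
      have hj := Finset.mem_Icc.1 hj
      rw [wgt_mesh_one hα hT hM hj.1 hj.2, mul_assoc]
    rw [e, Real.rpow_neg hτ.le, div_mul_eq_mul_div, div_le_iff₀ hG,
      inv_mul_le_iff₀ (Real.rpow_pos_of_pos hτ _)] at h1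
    linarith
  rw [sub_eq_sum_compl ha0 E m]
  have hP : ∀ k ∈ Finset.Icc 1 m, compl (unifWgt α) (m - k) ≤ ((m : ℝ) - k + 1) ^ (-(1 - α)) := by
    intro k hk
    have hk := Finset.mem_Icc.1 hk
    have h1 := compl_mul_partialSum_le ha0 hapos halog (m - k)
    have h2 : ((m - k : ℕ) : ℝ) = m - k := by push_cast [hk.2]; ring
    have hk' : (k : ℝ) ≤ m := by exact_mod_cast hk.2
    rw [sum_unifWgt hα.2, h2] at h1
    have h3 : (0 : ℝ) < (m : ℝ) - k + 1 := by linarith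
    rw [Real.rpow_neg h3.le, ← one_div, le_div_iff₀ (Real.rpow_pos_of_pos h3 _)]
    exact h1
  have hsum := sum_rpow_mul_rpow_le' (β := 1 - α) (q := q)
    ⟨by linarith [hα.2], by linarith [hα.1]⟩ hq hm
  rw [sub_sub_cancel] at hsum
  have hGτ : 0 ≤ (Real.Gamma (1 - α) * (1 - α)) * (T / M) ^ α * F := by positivity
  calc _ ≤ ∑ k ∈ Finset.Icc 1 m, ((m : ℝ) - k + 1) ^ (-(1 - α)) *
        ((Real.Gamma (1 - α) * (1 - α)) * (T / M) ^ α * (F * (k : ℝ) ^ (-q))) := by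
        refine Finset.sum_le_sum fun k hk => ?_
        have hP0 := compl_nonneg ha0 hapos halog (unifWgt_antitone hα) (m - k)
        exact (mul_le_mul_of_nonneg_left (hS k hk) hP0).trans
          (mul_le_mul_of_nonneg_right (hP k hk) (by positivity))
    _ = (Real.Gamma (1 - α) * (1 - α)) * (T / M) ^ α * F *
        ∑ k ∈ Finset.Icc 1 m, ((m : ℝ) - k + 1) ^ (-(1 - α)) * (k : ℝ) ^ (-q) := by
        rw [Finset.mul_sum]; exact Finset.sum_congr rfl fun k _ => by ring
    _ ≤ (Real.Gamma (1 - α) * (1 - α)) * (T / M) ^ α * F *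
        (2 ^ q * (zetaBound q + 1 / α) * (m : ℝ) ^ (-(1 - α))) :=
        mul_le_mul_of_nonneg_left hsum hGτ
    _ = _ := by rw [neg_sub]; ring

/-! ### The truncation error in time -/

/-- The factor of `ψ^j` in the bound of the contribution of the `j`-th mesh interval to the
truncation error at time `t_k`. -/
noncomputable def resWgt (α : ℝ) (t : ℕ → ℝ) (k j : ℕ) : ℝ :=
  if j = k then (2 / α + 2 / (1 - α)) * t k ^ (-α)
  else 1 / α * (((t j - t (j - 1)) / t j) ^ α *
    ((t k - t j) ^ (-α) - (t k - t (j - 1)) ^ (-α)))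

lemma resWgt_pos {α : ℝ} (hα : α ∈ Ioo (0 : ℝ) 1) {t : ℕ → ℝ} (ht : StrictMono t) (ht0 : t 0 = 0)
    {k j : ℕ} (hj : 1 ≤ j) (hjk : j ≤ k) : 0 < resWgt α t k j := by
  have h1 : 0 < α := hα.1
  have h2 : 0 < 1 - α := by linarith [hα.2]
  have htj : 0 < t j := ht0 ▸ ht (by omega)
  have htk : 0 < t k := ht0 ▸ ht (by omega)
  have hτ : 0 < t j - t (j - 1) := sub_pos.2 (ht (by omega))
  unfold resWgt
  split_ifs with h
  · positivity
  · have h3 : 0 < t k - t j := sub_pos.2 (ht (by omega))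
    have h4 : (t k - t (j - 1)) ^ (-α) < (t k - t j) ^ (-α) :=
      Real.rpow_lt_rpow_of_neg h3 (by linarith) (by linarith)
    have h5 : 0 < (t k - t j) ^ (-α) - (t k - t (j - 1)) ^ (-α) := by linarith
    positivity

/-- On the graded mesh the truncation error weights sum up to a multiple of `t_k^{-α}`. The
intervals in the first half of `(0, t_k)` stay away from the singularity of the kernel; in the
second half `τ_j / t_j` is of order `1 / k`. -/
lemma sum_resWgt_le {α : ℝ} (hα : α ∈ Ioo (0 : ℝ) 1) {T r : ℝ} (hT : 0 < T) (hr : 1 ≤ r)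
    {M : ℕ} (hM : 1 ≤ M) {k : ℕ} (hk : 1 ≤ k) :
    ∑ j ∈ Finset.Icc 1 k, resWgt α (mesh T r M) k j
      ≤ ((2 + 2 * r) / α + (2 / α + 2 / (1 - α))) * mesh T r M k ^ (-α) := by
  have hα0 := hα.1
  have hα1 : 0 < 1 - α := by linarith [hα.2]
  set t := mesh T r M with ht_def
  have ht : StrictMono t := mesh_strictMono hT hr hM
  have ht0 : t 0 = 0 := mesh_zero hr
  have htk : 0 < t k := ht0 ▸ ht (by omega)
  have hk0 : (0 : ℝ) < k := by exact_mod_cast hk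
  obtain ⟨n, rfl⟩ : ∃ n, k = n + 1 := ⟨k - 1, by omega⟩
  rw [Finset.sum_Icc_succ_top (by omega)]
  set d : ℕ → ℝ := fun j => (t (n + 1) - t j) ^ (-α) - (t (n + 1) - t (j - 1)) ^ (-α) with hd
  have hdnn : ∀ j, 1 ≤ j → j ≤ n → 0 ≤ d j := fun j h1 h2 => by
    have h3 : t j < t (n + 1) := ht (by omega)
    have h4 : t (j - 1) < t j := ht (by omega)
    exact sub_nonneg.2 (Real.rpow_le_rpow_of_nonpos (by linarith) (by linarith) (by linarith))
  have htel : ∀ l, ∑ j ∈ Finset.Icc 1 l, d j = (t (n + 1) - t l) ^ (-α) - t (n + 1) ^ (-α) := by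
    intro l
    rw [sum_Icc_one_eq]
    simp only [hd, Nat.add_sub_cancel]
    rw [Finset.sum_range_sub (fun j => (t (n + 1) - t j) ^ (-α)), ht0, sub_zero]
  set A : ℝ := t (n + 1) ^ (-α) with hA
  have hA0 : 0 < A := Real.rpow_pos_of_pos htk _
  -- the first half
  have hS1 : ∑ j ∈ Finset.Icc 1 ((n + 1) / 2), d j ≤ 2 * A := by
    rw [htel]
    have h1 : t ((n + 1) / 2) ≤ t (n + 1) / 2 := mesh_le_half hT hr (by omega)
    have h2 := rpow_neg_le_of_half_le hα0.le htk
      (by linarith : t (n + 1) ≤ 2 * (t (n + 1) - t ((n + 1) / 2)))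
    have h3 : (2 : ℝ) ^ α ≤ 2 := by
      simpa using Real.rpow_le_rpow_of_exponent_le (by norm_num : (1 : ℝ) ≤ 2) hα.2.le
    have h4 := mul_le_mul_of_nonneg_right h3 hA0.le
    linarith
  -- the whole interval
  have hS2 : (2 * r / ((n + 1 : ℕ) : ℝ)) ^ α * ∑ j ∈ Finset.Icc 1 n, d j ≤ 2 * r * A := by
    rw [htel]
    have h1 : t (n + 1) / ((n + 1 : ℕ) : ℝ) ≤ t (n + 1) - t n := mesh_div_le_sub hT hr hk
    have h2 : (t (n + 1) - t n) ^ (-α) ≤ (t (n + 1) / ((n + 1 : ℕ) : ℝ)) ^ (-α) :=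
      Real.rpow_le_rpow_of_nonpos (by positivity) h1 (by linarith)
    have h3 : (2 * r) ^ α ≤ 2 * r := by
      simpa using Real.rpow_le_rpow_of_exponent_le (by linarith : (1 : ℝ) ≤ 2 * r) hα.2.le
    have hp : 0 < ((n + 1 : ℕ) : ℝ) ^ α := Real.rpow_pos_of_pos hk0 _
    calc _ ≤ (2 * r / ((n + 1 : ℕ) : ℝ)) ^ α * (t (n + 1) / ((n + 1 : ℕ) : ℝ)) ^ (-α) := by
          gcongr; linarith
      _ = (2 * r) ^ α * A := by
          rw [Real.div_rpow (by linarith) hk0.le, Real.div_rpow htk.le hk0.le,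
            Real.rpow_neg hk0.le, ← hA]
          field_simp
      _ ≤ _ := by gcongr
  have hterm : ∀ j ∈ Finset.Icc 1 n, resWgt α t (n + 1) j
      ≤ 1 / α * ((if j ∈ Finset.Icc 1 ((n + 1) / 2) then d j else 0)
        + (2 * r / ((n + 1 : ℕ) : ℝ)) ^ α * d j) := by
    intro j hj
    have hj := Finset.mem_Icc.1 hj
    rw [resWgt, if_neg (by omega)]
    refine mul_le_mul_of_nonneg_left ?_ (by positivity)
    change _ * d j ≤ _
    have hdj := hdnn j hj.1 hj.2
    have htj : 0 < t j := ht0 ▸ ht (by omega)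
    have hτ : 0 < t j - t (j - 1) := sub_pos.2 (ht (by omega))
    have htj1 : 0 ≤ t (j - 1) := mesh_nonneg hT _
    have hq0 : 0 ≤ (2 * r / ((n + 1 : ℕ) : ℝ)) ^ α * d j := by positivity
    split_ifs with h
    · have : ((t j - t (j - 1)) / t j) ^ α ≤ 1 :=
        Real.rpow_le_one (by positivity) (by rw [div_le_one htj]; linarith) hα0.le
      nlinarith
    · rw [zero_add]
      refine mul_le_mul_of_nonneg_right (Real.rpow_le_rpow (by positivity) ?_ hα0.le) hdj
      have h1 : t j - t (j - 1) ≤ r / j * t j := mesh_sub_le hT hr hj.1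
      have hj0 : (0 : ℝ) < j := by exact_mod_cast hj.1
      have h2 : ((n + 1 : ℕ) : ℝ) ≤ 2 * j := by
        simp only [Finset.mem_Icc] at h
        exact_mod_cast (by omega : n + 1 ≤ 2 * j)
      rw [div_le_iff₀ htj]
      refine h1.trans (mul_le_mul_of_nonneg_right ?_ htj.le)
      rw [div_le_div_iff₀ hj0 hk0]
      nlinarith
  have hsum := Finset.sum_le_sum hterm
  rw [← Finset.mul_sum, Finset.sum_add_distrib, ← Finset.mul_sum, Finset.sum_ite_mem] at hsum
  have hint : Finset.Icc 1 n ∩ Finset.Icc 1 ((n + 1) / 2) ⊆ Finset.Icc 1 ((n + 1) / 2) :=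
    Finset.inter_subset_right
  have hS1' : ∑ j ∈ Finset.Icc 1 n ∩ Finset.Icc 1 ((n + 1) / 2), d j ≤ 2 * A := by
    rcases Nat.eq_zero_or_pos n with rfl | hn
    · simp; linarith
    · have : Finset.Icc 1 n ∩ Finset.Icc 1 ((n + 1) / 2) = Finset.Icc 1 ((n + 1) / 2) :=
        Finset.inter_eq_right.2 (Finset.Icc_subset_Icc le_rfl (by omega))
      rw [this]; exact hS1
  have hlast : resWgt α t (n + 1) (n + 1) = (2 / α + 2 / (1 - α)) * A := by simp [resWgt, hA]
  rw [hlast]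
  have : 1 / α * (∑ j ∈ Finset.Icc 1 n ∩ Finset.Icc 1 ((n + 1) / 2), d j
      + (2 * r / ((n + 1 : ℕ) : ℝ)) ^ α * ∑ j ∈ Finset.Icc 1 n, d j)
      ≤ 1 / α * (2 * A + 2 * r * A) := by gcongr
  calc _ ≤ 1 / α * (2 * A + 2 * r * A) + (2 / α + 2 / (1 - α)) * A := by linarith
    _ = _ := by ring

lemma rpow_neg_sub_le {α : ℝ} (hα : α ∈ Ioo (0 : ℝ) 1) {x : ℝ} (hx : 0 < x) :
    x ^ (-α) - (x + 1) ^ (-α) ≤ α * x ^ (-(1 + α)) := by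
  have h1 := rpow_one_add_le_one_add_mul_self (s := 1 / x)
    (by have : 0 < 1 / x := by positivity
        linarith) hα.1.le hα.2.le
  have h2 : 0 < (1 + 1 / x) ^ α := by positivity
  have e : (x + 1) ^ (-α) = x ^ (-α) * ((1 + 1 / x) ^ α)⁻¹ := by
    rw [← Real.rpow_neg (by positivity), ← Real.mul_rpow hx.le (by positivity)]
    congr 1; field_simp
  have h3 : 1 - α * (1 / x) ≤ ((1 + 1 / x) ^ α)⁻¹ := by
    refine le_trans ?_ (inv_anti₀ h2 h1)
    have : 0 < 1 + α * (1 / x) := by have := hα.1; positivity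
    rw [← one_div (1 + _), le_div_iff₀ this]
    nlinarith [sq_nonneg (α * (1 / x))]
  have e2 : x ^ (-(1 + α)) = x ^ (-α) * (1 / x) := by
    rw [neg_add, add_comm, Real.rpow_add hx, Real.rpow_neg_one, one_div]
  rw [e, e2]
  have h4 : 0 < x ^ (-α) := Real.rpow_pos_of_pos hx _
  nlinarith

/-- On the uniform mesh the truncation error weights, combined with `ψ^j` of order
`j^{α-1-γ}`, sum up to an integrable power of time. -/
lemma sum_resWgt_mul_le {α : ℝ} (hα : α ∈ Ioo (0 : ℝ) 1) {γ : ℝ} (hγ : 0 < γ) (hγα : γ ≤ α)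
    {T : ℝ} (hT : 0 < T) {M : ℕ} (hM : 1 ≤ M) {k : ℕ} (hk : 1 ≤ k) :
    ∑ j ∈ Finset.Icc 1 k, resWgt α (mesh T 1 M) k j *
        ((T / M) ^ (α - 1) * (j : ℝ) ^ (α - 1 - γ))
      ≤ (2 / α + 2 / (1 - α) + 2 ^ (1 + α) * (zetaBound (1 + γ) + zetaBound (1 + α)))
        * (T / M)⁻¹ * (k : ℝ) ^ (-(1 + γ)) := by
  have hα0 := hα.1
  have hα1 : 0 < 1 - α := by linarith [hα.2]
  have hk0 : (0 : ℝ) < k := by exact_mod_cast hk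
  have hτ : 0 < T / M := by positivity
  set τ := T / M with hτd
  have hτα : τ ^ (-α) * τ ^ (α - 1) = τ⁻¹ := by
    rw [← Real.rpow_add hτ, show -α + (α - 1) = -1 by ring, Real.rpow_neg_one]
  have hpow : ∀ x : ℝ, 0 < x → x ^ (-α) * x ^ (α - 1 - γ) = x ^ (-(1 + γ)) := fun x hx => by
    rw [← Real.rpow_add hx]; congr 1; ring
  obtain ⟨n, rfl⟩ : ∃ n, k = n + 1 := ⟨k - 1, by omega⟩
  rw [Finset.sum_Icc_succ_top (by omega)]
  have hlast : resWgt α (mesh T 1 M) (n + 1) (n + 1)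
      * (τ ^ (α - 1) * ((n + 1 : ℕ) : ℝ) ^ (α - 1 - γ))
      = (2 / α + 2 / (1 - α)) * τ⁻¹ * ((n + 1 : ℕ) : ℝ) ^ (-(1 + γ)) := by
    rw [resWgt, if_pos rfl, mesh_one, Real.mul_rpow hτ.le hk0.le, ← hpow _ hk0, ← hτα]; ring
  have hterm : ∀ j ∈ Finset.Icc 1 n, resWgt α (mesh T 1 M) (n + 1) j
      * (τ ^ (α - 1) * (j : ℝ) ^ (α - 1 - γ))
      ≤ τ⁻¹ * ((j : ℝ) ^ (-(1 + γ)) * (((n + 1 : ℕ) : ℝ) - j) ^ (-(1 + α))) := by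
    intro j hj
    have hj := Finset.mem_Icc.1 hj
    have hj0 : (0 : ℝ) < j := by exact_mod_cast hj.1
    have hjn : (0 : ℝ) < ((n + 1 : ℕ) : ℝ) - j :=
      sub_pos.2 (by exact_mod_cast (by omega : j < n + 1))
    rw [resWgt, if_neg (by omega)]
    have hj1 : ((j - 1 : ℕ) : ℝ) = j - 1 := by push_cast [hj.1]; ring
    simp only [mesh_one, hj1]
    rw [← hτd, show (τ * (j : ℝ) - τ * (j - 1)) / (τ * j) = (j : ℝ)⁻¹ by field_simp; ring,
      show τ * ((n + 1 : ℕ) : ℝ) - τ * j = τ * (((n + 1 : ℕ) : ℝ) - j) by ring,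
      show τ * ((n + 1 : ℕ) : ℝ) - τ * (j - 1) = τ * (((n + 1 : ℕ) : ℝ) - j + 1) by ring,
      Real.mul_rpow hτ.le hjn.le, Real.mul_rpow hτ.le (by linarith), Real.inv_rpow hj0.le,
      ← Real.rpow_neg hj0.le]
    have h1 := rpow_neg_sub_le hα hjn
    calc _ = (τ ^ (-α) * τ ^ (α - 1)) * ((j : ℝ) ^ (-α) * (j : ℝ) ^ (α - 1 - γ)) * (1 / α) *
          ((((n + 1 : ℕ) : ℝ) - j) ^ (-α) - (((n + 1 : ℕ) : ℝ) - j + 1) ^ (-α)) := by ring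
      _ ≤ (τ ^ (-α) * τ ^ (α - 1)) * ((j : ℝ) ^ (-α) * (j : ℝ) ^ (α - 1 - γ)) * (1 / α) *
          (α * (((n + 1 : ℕ) : ℝ) - j) ^ (-(1 + α))) := by gcongr
      _ = _ := by rw [hτα, hpow _ hj0]; field_simp
  have hsum := Finset.sum_le_sum hterm
  rw [← Finset.mul_sum] at hsum
  have hconv := sum_rpow_mul_rpow_le (p := 1 + α) (q := 1 + γ) (by linarith) (by linarith) hk
  rw [Nat.add_sub_cancel] at hconv
  have h5 := mul_le_mul_of_nonneg_left hconv (inv_pos.2 hτ).le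
  rw [hlast]
  calc _ ≤ _ := add_le_add_left (hsum.trans h5) _
    _ = _ := by ring

/-- The sum of the two integrable one-sided singularities bounds their product. -/
lemma rpow_mul_rpow_le_add {α : ℝ} (hα : α ∈ Ioo (0 : ℝ) 1) {t s : ℝ} (hs : s ∈ Ioo 0 t) :
    (t - s) ^ (-α) * s ^ (α - 1)
      ≤ (t / 2) ^ (-α) * s ^ (α - 1) + (t / 2) ^ (α - 1) * (t - s) ^ (-α) := by
  have h0 : 0 < t := hs.1.trans hs.2
  have h1 : 0 < t - s := sub_pos.2 hs.2
  have ha : 0 < s ^ (α - 1) := Real.rpow_pos_of_pos hs.1 _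
  have hb : 0 < (t - s) ^ (-α) := Real.rpow_pos_of_pos h1 _
  rcases le_total s (t / 2) with h | h
  · have : (t - s) ^ (-α) ≤ (t / 2) ^ (-α) :=
      Real.rpow_le_rpow_of_nonpos (by linarith) (by linarith) (by linarith [hα.1])
    have h2 : 0 < (t / 2) ^ (α - 1) := by positivity
    nlinarith [mul_pos h2 hb]
  · have : s ^ (α - 1) ≤ (t / 2) ^ (α - 1) :=
      Real.rpow_le_rpow_of_nonpos (by linarith) (by linarith) (by linarith [hα.2])
    have h2 : 0 < (t / 2) ^ (-α) := by positivity
    nlinarith [mul_pos h2 ha]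

lemma intervalIntegrable_rpow_sub_one {α : ℝ} (hα : α ∈ Ioo (0 : ℝ) 1) (a b : ℝ) :
    IntervalIntegrable (fun s : ℝ => s ^ (α - 1)) volume a b :=
  intervalIntegral.intervalIntegrable_rpow' (by linarith [hα.1])

lemma intervalIntegrable_rpow_mul_rpow {α : ℝ} (hα : α ∈ Ioo (0 : ℝ) 1) {t : ℝ} (ht : 0 ≤ t) :
    IntervalIntegrable (fun s => (t - s) ^ (-α) * s ^ (α - 1)) volume 0 t := by
  have hb : IntervalIntegrable (fun s =>
      (t / 2) ^ (-α) * s ^ (α - 1) + (t / 2) ^ (α - 1) * (t - s) ^ (-α)) volume 0 t :=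
    ((intervalIntegrable_rpow_sub_one hα _ _).const_mul _).add
      ((intervalIntegrable_sub_rpow hα.2 _ _ _).const_mul _)
  rw [intervalIntegrable_iff_integrableOn_Ioo_of_le ht] at hb ⊢
  refine Integrable.mono' hb (by fun_prop) ?_
  filter_upwards [ae_restrict_mem measurableSet_Ioo] with s hs
  have h1 : 0 < t - s := sub_pos.2 hs.2
  have h2 : 0 < s := hs.1
  rw [Real.norm_of_nonneg (by positivity)]
  exact rpow_mul_rpow_le_add hα hs

lemma integral_rpow_mul_rpow_le {α : ℝ} (hα : α ∈ Ioo (0 : ℝ) 1) {t : ℝ} (ht : 0 < t) :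
    ∫ s in (0 : ℝ)..t, (t - s) ^ (-α) * s ^ (α - 1) ≤ 2 / α + 2 / (1 - α) := by
  have hα0 := hα.1
  have hα1 : 0 < 1 - α := by linarith [hα.2]
  have hi1 := (intervalIntegrable_rpow_sub_one hα 0 t).const_mul ((t / 2) ^ (-α))
  have hi2 := (intervalIntegrable_sub_rpow hα.2 t 0 t).const_mul ((t / 2) ^ (α - 1))
  have h1 := intervalIntegral.integral_mono_on_of_le_Ioo ht.le
    (intervalIntegrable_rpow_mul_rpow hα ht.le) (hi1.add hi2)
    fun s hs => rpow_mul_rpow_le_add hα hs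
  refine h1.trans ?_
  rw [intervalIntegral.integral_add hi1 hi2, intervalIntegral.integral_const_mul,
    intervalIntegral.integral_const_mul, integral_sub_rpow hα.2,
    integral_rpow (Or.inl (by linarith))]
  have hne : 1 - α ≠ 0 := hα1.ne'
  rw [sub_self, Real.zero_rpow hne, sub_zero, sub_zero, show α - 1 + 1 = α by ring,
    Real.zero_rpow hα0.ne', sub_zero]
  have e1 : (t / 2) ^ (-α) * t ^ α = 2 ^ α := by
    rw [Real.div_rpow ht.le (by norm_num), Real.rpow_neg ht.le, Real.rpow_neg (by norm_num)]
    have := (Real.rpow_pos_of_pos ht α).ne'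
    field_simp
  have e2 : (t / 2) ^ (α - 1) * t ^ (1 - α) = 2 ^ (1 - α) := by
    rw [show α - 1 = -(1 - α) by ring, Real.div_rpow ht.le (by norm_num), Real.rpow_neg ht.le,
      Real.rpow_neg (by norm_num)]
    have := (Real.rpow_pos_of_pos ht (1 - α)).ne'
    field_simp
  rw [mul_div_assoc', mul_div_assoc', e1, e2]
  have h2 : (2 : ℝ) ^ α ≤ 2 := by
    simpa using Real.rpow_le_rpow_of_exponent_le (by norm_num : (1 : ℝ) ≤ 2) hα.2.le
  have h3 : (2 : ℝ) ^ (1 - α) ≤ 2 := by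
    simpa using Real.rpow_le_rpow_of_exponent_le (by norm_num : (1 : ℝ) ≤ 2)
      (by linarith : 1 - α ≤ 1)
  gcongr

/-- The regularity in time of the solution at a fixed point in space. -/
structure TimeRegular (α T K : ℝ) (g : ℝ → ℝ) : Prop where
  cont : ContinuousOn g (Icc 0 T)
  smooth : ContDiffOn ℝ 2 g (Ioo 0 T)
  deriv_le : ∀ s ∈ Ioo 0 T, |deriv g s| ≤ K * (1 + s ^ (α - 1))
  deriv2_le : ∀ s ∈ Ioo 0 T, |iteratedDeriv 2 g s| ≤ K * (1 + s ^ (α - 2))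

/-- The contribution of the `j`-th mesh interval to `Γ(1-α)` times the truncation error at `t_k`. -/
noncomputable def locRes (α : ℝ) (t : ℕ → ℝ) (k j : ℕ) (g : ℝ → ℝ) : ℝ :=
  ∫ s in t (j - 1)..t j,
    (t k - s) ^ (-α) * ((g (t j) - g (t (j - 1))) / (t j - t (j - 1)) - deriv g s)

namespace TimeRegular

variable {α T K : ℝ} {g : ℝ → ℝ}

lemma differentiableAt (h : TimeRegular α T K g) {s : ℝ} (hs : s ∈ Ioo 0 T) :
    DifferentiableAt ℝ g s :=
  (h.smooth.contDiffAt (isOpen_Ioo.mem_nhds hs)).differentiableAt (by norm_num)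

lemma differentiableAt_deriv (h : TimeRegular α T K g) {s : ℝ} (hs : s ∈ Ioo 0 T) :
    DifferentiableAt ℝ (deriv g) s := by
  have h1 : ContDiffOn ℝ 1 (deriv g) (Ioo 0 T) :=
    h.smooth.deriv_of_isOpen isOpen_Ioo (by norm_num)
  exact (h1.contDiffAt (isOpen_Ioo.mem_nhds hs)).differentiableAt (by norm_num)

lemma intervalIntegrable_mul_deriv (h : TimeRegular α T K g) (hα : α ∈ Ioo (0 : ℝ) 1) {c : ℝ}
    (hc : c ∈ Icc 0 T) :
    IntervalIntegrable (fun s => (c - s) ^ (-α) * deriv g s) volume 0 c := by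
  have hb : IntervalIntegrable (fun s =>
      K * (c - s) ^ (-α) + K * ((c - s) ^ (-α) * s ^ (α - 1))) volume 0 c :=
    ((intervalIntegrable_sub_rpow hα.2 _ _ _).const_mul _).add
      ((intervalIntegrable_rpow_mul_rpow hα hc.1).const_mul _)
  rw [intervalIntegrable_iff_integrableOn_Ioo_of_le hc.1] at hb ⊢
  refine Integrable.mono' hb
    ((by fun_prop : Measurable fun s : ℝ => (c - s) ^ (-α)).mul
      (measurable_deriv g)).aestronglyMeasurable ?_
  filter_upwards [ae_restrict_mem measurableSet_Ioo] with s hs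
  have h1 : 0 ≤ (c - s) ^ (-α) := Real.rpow_nonneg (sub_nonneg.2 hs.2.le) _
  rw [norm_mul, Real.norm_of_nonneg h1, Real.norm_eq_abs]
  have h2 := mul_le_mul_of_nonneg_left (h.deriv_le s ⟨hs.1, hs.2.trans_le hc.2⟩) h1
  linarith

lemma intervalIntegrable_deriv (h : TimeRegular α T K g) (hα : α ∈ Ioo (0 : ℝ) 1) {a b : ℝ}
    (ha : 0 ≤ a) (hab : a ≤ b) (hb : b ≤ T) : IntervalIntegrable (deriv g) volume a b := by
  have hi : IntervalIntegrable (fun s => K * 1 + K * s ^ (α - 1)) volume a b :=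
    (by simp : IntervalIntegrable (fun _ => K * 1) volume a b).add
      ((intervalIntegrable_rpow_sub_one hα a b).const_mul _)
  rw [intervalIntegrable_iff_integrableOn_Ioo_of_le hab] at hi ⊢
  refine Integrable.mono' hi (measurable_deriv g).aestronglyMeasurable ?_
  filter_upwards [ae_restrict_mem measurableSet_Ioo] with s hs
  have := h.deriv_le s ⟨ha.trans_lt hs.1, hs.2.trans_le hb⟩
  rw [Real.norm_eq_abs]; linarith

lemma integral_deriv (h : TimeRegular α T K g) (hα : α ∈ Ioo (0 : ℝ) 1) {a b : ℝ}
    (ha : 0 ≤ a) (hab : a ≤ b) (hb : b ≤ T) : ∫ s in a..b, deriv g s = g b - g a :=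
  intervalIntegral.integral_eq_sub_of_hasDerivAt_of_le hab
    (h.cont.mono (Icc_subset_Icc ha hb))
    (fun _ hs => (h.differentiableAt ⟨ha.trans_lt hs.1, hs.2.trans_le hb⟩).hasDerivAt)
    (h.intervalIntegrable_deriv hα ha hab hb)

variable {t : ℕ → ℝ} {k j : ℕ}

lemma intervalIntegrable_locRes (h : TimeRegular α T K g) (hα : α ∈ Ioo (0 : ℝ) 1)
    (ht : StrictMono t) (ht0 : t 0 = 0) (hkT : t k ≤ T) (hjk : j ≤ k) :
    IntervalIntegrable (fun s => (t k - s) ^ (-α) * deriv g s) volume (t (j - 1)) (t j) := by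
  have h0 : ∀ i, 0 ≤ t i := fun i => ht0 ▸ ht.monotone (Nat.zero_le i)
  refine (h.intervalIntegrable_mul_deriv hα ⟨h0 k, hkT⟩).mono_set ?_
  rw [uIcc_of_le (ht.monotone (Nat.sub_le _ _)), uIcc_of_le (h0 k)]
  exact Icc_subset_Icc (h0 _) (ht.monotone hjk)

/-- The truncation error of the L1 operator is the sum of the contributions of the mesh
intervals. -/
lemma l1_sub_caputo (h : TimeRegular α T K g) (hα : α ∈ Ioo (0 : ℝ) 1)
    (ht : StrictMono t) (ht0 : t 0 = 0) (hkT : t k ≤ T) :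
    l1 α t (fun j => g (t j)) k - caputo α g (t k)
      = 1 / Real.Gamma (1 - α) * ∑ j ∈ Finset.Icc 1 k, locRes α t k j g := by
  rw [l1, caputo, ← mul_sub]
  congr 1
  have hsplit : ∫ s in (0 : ℝ)..t k, (t k - s) ^ (-α) * deriv g s
      = ∑ j ∈ Finset.Icc 1 k, ∫ s in t (j - 1)..t j, (t k - s) ^ (-α) * deriv g s := by
    rw [sum_Icc_one_eq]
    simp only [Nat.add_sub_cancel]
    rw [intervalIntegral.sum_integral_adjacent_intervals (a := t), ht0]
    intro i hi
    simpa using h.intervalIntegrable_locRes hα ht ht0 hkT (j := i + 1) hi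
  rw [hsplit, ← Finset.sum_sub_distrib]
  refine Finset.sum_congr rfl fun j hj => ?_
  have hj := Finset.mem_Icc.1 hj
  rw [locRes, ← intervalIntegral.integral_const_mul, ← intervalIntegral.integral_sub
    ((intervalIntegrable_sub_rpow hα.2 _ _ _).const_mul _)
    (h.intervalIntegrable_locRes hα ht ht0 hkT hj.2)]
  congr 1; ext s; ring

/-- Away from the initial time, the divided difference approximates the derivative by the mean
value theorem. -/
lemma abs_slope_sub_deriv_le (h : TimeRegular α T K g) {a b : ℝ} (ha : 0 ≤ a) (hab : a < b)
    (hb : b ≤ T) {C : ℝ} (hC : ∀ s ∈ Ioo a b, |iteratedDeriv 2 g s| ≤ C) {s : ℝ}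
    (hs : s ∈ Ioo a b) : |(g b - g a) / (b - a) - deriv g s| ≤ (b - a) * C := by
  have hsub : ∀ x ∈ Ioo a b, x ∈ Ioo 0 T := fun x hx => ⟨ha.trans_lt hx.1, hx.2.trans_le hb⟩
  obtain ⟨ξ, hξ, hξe⟩ := exists_deriv_eq_slope g hab (h.cont.mono (Icc_subset_Icc ha hb))
    fun x hx => (h.differentiableAt (hsub x hx)).differentiableWithinAt
  have h1 := (convex_Ioo a b).norm_image_sub_le_of_norm_deriv_le (f := deriv g) (C := C)
    (fun x hx => h.differentiableAt_deriv (hsub x hx))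
    (fun x hx => by
      have := hC x hx
      rwa [iteratedDeriv_succ, iteratedDeriv_one] at this) hs hξ
  rw [← hξe]
  refine h1.trans ?_
  rw [mul_comm]
  have hC0 : 0 ≤ C := (abs_nonneg _).trans (hC s hs)
  refine mul_le_mul_of_nonneg_right ?_ hC0
  rw [Real.norm_eq_abs, abs_le]
  constructor <;> linarith [hs.1, hs.2, hξ.1, hξ.2]

/-- On a history interval the mean of the interpolation error of `g'` vanishes, so that only the
variation of the kernel over the interval matters. -/
lemma abs_locRes_le_of_le (h : TimeRegular α T K g) (hα : α ∈ Ioo (0 : ℝ) 1)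
    (ht : StrictMono t) (ht0 : t 0 = 0) (hkT : t k ≤ T) (hj1 : 1 ≤ j) (hjk : j < k)
    {m : ℝ → ℝ} (hm : IntervalIntegrable m volume (t (j - 1)) (t j))
    (hle : ∀ s ∈ Ioo (t (j - 1)) (t j),
      |(g (t j) - g (t (j - 1))) / (t j - t (j - 1)) - deriv g s| ≤ m s) :
    |locRes α t k j g|
      ≤ ((t k - t j) ^ (-α) - (t k - t (j - 1)) ^ (-α)) * ∫ s in t (j - 1)..t j, m s := by
  have hτ : t (j - 1) < t j := ht (by omega)
  have hjk' : t j < t k := ht hjk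
  have h0 : 0 ≤ t (j - 1) := ht0 ▸ ht.monotone (Nat.zero_le _)
  set δ := (g (t j) - g (t (j - 1))) / (t j - t (j - 1)) with hδ
  have hid := h.intervalIntegrable_deriv hα h0 hτ.le (hjk'.le.trans hkT)
  have hic : IntervalIntegrable (fun s => δ - deriv g s) volume (t (j - 1)) (t j) :=
    (by simp : IntervalIntegrable (fun _ => δ) volume (t (j - 1)) (t j)).sub hid
  -- The divided difference is the mean of the derivative, so a constant may be subtracted from the
  -- kernel.
  have hzero : ∫ s in t (j - 1)..t j, (δ - deriv g s) = 0 := by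
    rw [intervalIntegral.integral_sub (by simp) hid,
      h.integral_deriv hα h0 hτ.le (hjk'.le.trans hkT), intervalIntegral.integral_const, hδ,
      smul_eq_mul, mul_div_cancel₀ _ (by linarith : t j - t (j - 1) ≠ 0), sub_self]
  have hi1 : IntervalIntegrable (fun s => (t k - s) ^ (-α) * (δ - deriv g s)) volume
      (t (j - 1)) (t j) := by
    simpa only [mul_sub] using ((intervalIntegrable_sub_rpow hα.2 (t k) _ _).mul_const δ).sub
      (h.intervalIntegrable_locRes hα ht ht0 hkT hjk.le)
  have e : locRes α t k j g = ∫ s in t (j - 1)..t j,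
      ((t k - s) ^ (-α) - (t k - t (j - 1)) ^ (-α)) * (δ - deriv g s) := by
    have : locRes α t k j g = ∫ s in t (j - 1)..t j, (t k - s) ^ (-α) * (δ - deriv g s) := rfl
    simp only [sub_mul]
    rw [intervalIntegral.integral_sub hi1 (hic.const_mul _), intervalIntegral.integral_const_mul,
      hzero, mul_zero, sub_zero, this]
  have hi2 := (hi1.sub (hic.const_mul ((t k - t (j - 1)) ^ (-α)))).abs
  rw [e, ← intervalIntegral.integral_const_mul]
  refine (intervalIntegral.abs_integral_le_integral_abs hτ.le).trans ?_
  refine intervalIntegral.integral_mono_on_of_le_Ioo hτ.le ?_ (hm.const_mul _) fun s hs => ?_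
  · simpa only [sub_mul] using hi2
  rw [abs_mul]
  have h1 : (t k - t (j - 1)) ^ (-α) ≤ (t k - s) ^ (-α) :=
    Real.rpow_le_rpow_of_nonpos (by linarith [hs.2]) (by linarith [hs.1]) (by linarith [hα.1])
  have h2 : (t k - s) ^ (-α) ≤ (t k - t j) ^ (-α) :=
    Real.rpow_le_rpow_of_nonpos (by linarith) (by linarith [hs.2]) (by linarith [hα.1])
  rw [abs_of_nonneg (sub_nonneg.2 h1)]
  exact mul_le_mul (by linarith) (hle s hs) (abs_nonneg _) (by linarith)

/-- On the last interval the kernel is singular, and the error of `g'` is integrated against it. -/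
lemma abs_locRes_le_of_le_self (h : TimeRegular α T K g) (hα : α ∈ Ioo (0 : ℝ) 1)
    (ht : StrictMono t) (ht0 : t 0 = 0) (hkT : t k ≤ T) (hk1 : 1 ≤ k)
    {m : ℝ → ℝ} (hm : IntervalIntegrable (fun s => (t k - s) ^ (-α) * m s) volume (t (k - 1)) (t k))
    (hle : ∀ s ∈ Ioo (t (k - 1)) (t k),
      |(g (t k) - g (t (k - 1))) / (t k - t (k - 1)) - deriv g s| ≤ m s) :
    |locRes α t k k g| ≤ ∫ s in t (k - 1)..t k, (t k - s) ^ (-α) * m s := by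
  have hτ : t (k - 1) < t k := ht (by omega)
  set δ := (g (t k) - g (t (k - 1))) / (t k - t (k - 1)) with hδ
  have hi1 : IntervalIntegrable (fun s => (t k - s) ^ (-α) * (δ - deriv g s)) volume
      (t (k - 1)) (t k) := by
    simpa only [mul_sub] using ((intervalIntegrable_sub_rpow hα.2 (t k) _ _).mul_const δ).sub
      (h.intervalIntegrable_locRes hα ht ht0 hkT le_rfl)
  refine (intervalIntegral.abs_integral_le_integral_abs hτ.le).trans ?_
  refine intervalIntegral.integral_mono_on_of_le_Ioo hτ.le hi1.abs hm fun s hs => ?_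
  have h1 : 0 ≤ (t k - s) ^ (-α) := Real.rpow_nonneg (by linarith [hs.2]) _
  rw [abs_mul, abs_of_nonneg h1]
  exact mul_le_mul_of_nonneg_left (hle s hs) h1

/-- The contribution of the `j`-th mesh interval to the truncation error is controlled by `ψ^j`. -/
lemma abs_locRes_le (h : TimeRegular α T K g) (hα : α ∈ Ioo (0 : ℝ) 1)
    (ht : StrictMono t) (ht0 : t 0 = 0) (hkT : t k ≤ T) (hj1 : 1 ≤ j) (hjk : j ≤ k) {P : ℝ}
    (hP0 : 0 ≤ P)
    (hP1 : j = 1 → ∀ s ∈ Ioo (t 0) (t 1), (t 1 - t 0) ^ α *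
      (s ^ (1 - α) * |(g (t 1) - g (t 0)) / (t 1 - t 0) - deriv g s|) ≤ P)
    (hP2 : j ≠ 1 → ∀ s ∈ Ioo (t (j - 1)) (t j),
      ((t j - t (j - 1)) ^ (2 - α) * t j ^ α) * |iteratedDeriv 2 g s| ≤ P) :
    |locRes α t k j g| ≤ resWgt α t k j * P := by
  have hα0 := hα.1
  have hα1 : 0 < 1 - α := by linarith [hα.2]
  have hτ : t (j - 1) < t j := ht (by omega)
  have hτ0 : 0 < t j - t (j - 1) := sub_pos.2 hτ
  have h0 : 0 ≤ t (j - 1) := ht0 ▸ ht.monotone (Nat.zero_le _)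
  have htj : 0 < t j := h0.trans_lt hτ
  have hjk' : t j ≤ t k := ht.monotone hjk
  by_cases hj : j = 1
  · subst hj
    have hle : ∀ s ∈ Ioo (t (1 - 1)) (t 1),
        |(g (t 1) - g (t (1 - 1))) / (t 1 - t (1 - 1)) - deriv g s|
          ≤ P * t 1 ^ (-α) * s ^ (α - 1) := by
      intro s hs
      simp only [Nat.sub_self] at hs ⊢
      have hs0 : 0 < s := ht0 ▸ hs.1
      have h1 := hP1 rfl s hs
      rw [ht0, sub_zero] at h1
      rw [ht0, sub_zero, Real.rpow_neg htj.le, show α - 1 = -(1 - α) by ring, Real.rpow_neg hs0.le,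
        ← div_eq_mul_inv, ← div_eq_mul_inv, div_div, le_div_iff₀ (by positivity)]
      linarith
    rcases hjk.lt_or_eq with hlt | heq
    · refine (h.abs_locRes_le_of_le hα ht ht0 hkT le_rfl hlt
        ((intervalIntegrable_rpow_sub_one hα _ _).const_mul _) hle).trans ?_
      rw [resWgt, if_neg hlt.ne, intervalIntegral.integral_const_mul,
        integral_rpow (Or.inl (by linarith)), Nat.sub_self, ht0, sub_zero, sub_zero,
        div_self htj.ne', Real.one_rpow, sub_add_cancel, Real.zero_rpow hα0.ne', sub_zero]
      have : P * t 1 ^ (-α) * (t 1 ^ α / α) = 1 / α * P := by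
        rw [Real.rpow_neg htj.le]
        have := (Real.rpow_pos_of_pos htj α).ne'
        field_simp
      rw [this]
      exact le_of_eq (by ring)
    · subst heq
      have hint : (fun s => (t 1 - s) ^ (-α) * (P * t 1 ^ (-α) * s ^ (α - 1)))
          = fun s => P * t 1 ^ (-α) * ((t 1 - s) ^ (-α) * s ^ (α - 1)) := by ext s; ring
      refine (h.abs_locRes_le_of_le_self hα ht ht0 hkT le_rfl ?_ hle).trans ?_
      · rw [hint, Nat.sub_self, ht0]
        exact (intervalIntegrable_rpow_mul_rpow hα htj.le).const_mul _
      · rw [hint, Nat.sub_self, ht0, intervalIntegral.integral_const_mul, resWgt, if_pos rfl]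
        have h1 := integral_rpow_mul_rpow_le hα htj
        have h2 : 0 ≤ P * t 1 ^ (-α) := by positivity
        calc _ ≤ P * t 1 ^ (-α) * (2 / α + 2 / (1 - α)) := mul_le_mul_of_nonneg_left h1 h2
          _ = _ := by ring
  · have hpos : 0 < (t j - t (j - 1)) ^ (2 - α) * t j ^ α := by positivity
    have hle : ∀ s ∈ Ioo (t (j - 1)) (t j),
        |(g (t j) - g (t (j - 1))) / (t j - t (j - 1)) - deriv g s|
          ≤ (t j - t (j - 1)) * (P / ((t j - t (j - 1)) ^ (2 - α) * t j ^ α)) := by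
      intro s hs
      refine h.abs_slope_sub_deriv_le h0 hτ (hjk'.trans hkT) (fun x hx => ?_) hs
      rw [le_div_iff₀ hpos, mul_comm]
      exact hP2 hj x hx
    have e1 : (t j - t (j - 1)) ^ (2 - α)
        = (t j - t (j - 1)) * (t j - t (j - 1)) / (t j - t (j - 1)) ^ α := by
      rw [Real.rpow_sub hτ0, Real.rpow_two, sq]
    have hpα := Real.rpow_pos_of_pos hτ0 α
    have htα := Real.rpow_pos_of_pos htj α
    rcases hjk.lt_or_eq with hlt | heq
    · refine (h.abs_locRes_le_of_le hα ht ht0 hkT hj1 hlt (by simp) hle).trans ?_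
      rw [resWgt, if_neg hlt.ne, intervalIntegral.integral_const, smul_eq_mul, e1,
        Real.div_rpow hτ0.le htj.le]
      have h1 : (t k - t (j - 1)) ^ (-α) ≤ (t k - t j) ^ (-α) :=
        Real.rpow_le_rpow_of_nonpos (by linarith [ht hlt]) (by linarith) (by linarith)
      set D := (t k - t j) ^ (-α) - (t k - t (j - 1)) ^ (-α) with hD
      have hD0 : 0 ≤ D := sub_nonneg.2 h1
      have e2 : D * ((t j - t (j - 1)) * ((t j - t (j - 1)) *
          (P / ((t j - t (j - 1)) * (t j - t (j - 1)) / (t j - t (j - 1)) ^ α * t j ^ α))))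
          = 1 * ((t j - t (j - 1)) ^ α / t j ^ α * D) * P := by
        field_simp
      rw [e2]
      have h3 : (1 : ℝ) ≤ 1 / α := by rw [le_div_iff₀ hα0]; linarith [hα.2]
      gcongr
    · subst heq
      refine (h.abs_locRes_le_of_le_self hα ht ht0 hkT hj1
        ((intervalIntegrable_sub_rpow hα.2 _ _ _).mul_const _) hle).trans ?_
      rw [resWgt, if_pos rfl, intervalIntegral.integral_mul_const, integral_sub_rpow hα.2,
        sub_self, Real.zero_rpow hα1.ne', sub_zero, e1, Real.rpow_sub hτ0, Real.rpow_one,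
        Real.rpow_neg htj.le]
      have e2 : (t j - t (j - 1)) / (t j - t (j - 1)) ^ α / (1 - α) * ((t j - t (j - 1)) *
          (P / ((t j - t (j - 1)) * (t j - t (j - 1)) / (t j - t (j - 1)) ^ α * t j ^ α)))
          = 1 / (1 - α) * (t j ^ α)⁻¹ * P := by
        field_simp
      rw [e2]
      have h3 : 1 / (1 - α) ≤ 2 / α + 2 / (1 - α) := by
        have : 1 / (1 - α) ≤ 2 / (1 - α) := by gcongr; norm_num
        have : 0 < 2 / α := by positivity
        linarith
      gcongr

end TimeRegular

/-- The contribution of the `j`-th mesh interval to the truncation error is controlled by `ψ^j`. -/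
lemma ofReal_abs_locRes_le {d : ℕ} {α T K : ℝ} (hα : α ∈ Ioo (0 : ℝ) 1) {t : ℕ → ℝ}
    (ht : StrictMono t) (ht0 : t 0 = 0) {k j : ℕ} (hkT : t k ≤ T) (hj1 : 1 ≤ j) (hjk : j ≤ k)
    {u : Pt d → ℝ → ℝ} {x : Pt d} (h : TimeRegular α T K (u x)) :
    ENNReal.ofReal |locRes α t k j (u x)| ≤ ENNReal.ofReal (resWgt α t k j) * psi α t u j x := by
  have hw := resWgt_pos hα ht ht0 hj1 hjk
  have hτ0 : 0 ≤ t j - t (j - 1) := sub_nonneg.2 (ht.monotone (Nat.sub_le _ _))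
  have htj : 0 ≤ t j := ht0 ▸ ht.monotone (Nat.zero_le _)
  by_cases htop : psi α t u j x = ⊤
  · rw [htop, ENNReal.mul_top (by simpa using hw)]; exact le_top
  rw [← ENNReal.ofReal_toReal htop, ← ENNReal.ofReal_mul hw.le]
  refine ENNReal.ofReal_le_ofReal (h.abs_locRes_le hα ht ht0 hkT hj1 hjk ENNReal.toReal_nonneg
    (fun hj s hs => ?_) fun hj s hs => ?_)
  · rw [← ENNReal.ofReal_le_iff_le_toReal htop, psi, if_pos hj, ENNReal.ofReal_mul
      (Real.rpow_nonneg (by subst hj; simpa using hτ0) _)]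
    exact mul_le_mul_right (le_iSup₂ (f := fun s (_ : s ∈ Ioo (t 0) (t 1)) =>
      ENNReal.ofReal (s ^ (1 - α) * |(u x (t 1) - u x (t 0)) / (t 1 - t 0) - deriv (u x) s|))
      s hs) _
  · rw [← ENNReal.ofReal_le_iff_le_toReal htop, psi, if_neg hj, ENNReal.ofReal_mul (by positivity)]
    exact mul_le_mul_right (le_iSup₂ (f := fun s (_ : s ∈ Ioo (t (j - 1)) (t j)) =>
      ENNReal.ofReal |iteratedDeriv 2 (u x) s|) s hs) _

/-! ### Bounded continuous functions on the domain and their `L_p` norms -/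

/-- The algebra of functions that are continuous and bounded on `Ω`, with no condition off `Ω`. -/
def cb {d : ℕ} (Ω : Set (Pt d)) : Subalgebra ℝ (Pt d → ℝ) where
  carrier := {v | ContinuousOn v Ω ∧ ∃ B, ∀ x ∈ Ω, |v x| ≤ B}
  mul_mem' := by
    rintro v w ⟨hv, B, hB⟩ ⟨hw, B', hB'⟩
    refine ⟨hv.mul hw, B * B', fun x hx => ?_⟩
    rw [Pi.mul_apply, abs_mul]
    exact mul_le_mul (hB x hx) (hB' x hx) (abs_nonneg _) ((abs_nonneg _).trans (hB x hx))
  add_mem' := by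
    rintro v w ⟨hv, B, hB⟩ ⟨hw, B', hB'⟩
    exact ⟨hv.add hw, B + B', fun x hx =>
      (abs_add_le _ _).trans (add_le_add (hB x hx) (hB' x hx))⟩
  algebraMap_mem' r := ⟨continuousOn_const, |r|, fun _ _ => le_rfl⟩

section cb

variable {d : ℕ} {Ω : Set (Pt d)} {p : ℝ≥0∞} {v w : Pt d → ℝ}

lemma mem_cb_of_continuousOn_closure (hΩb : Bornology.IsBounded Ω)
    (hv : ContinuousOn v (closure Ω)) : v ∈ cb Ω := by
  refine ⟨hv.mono subset_closure, ?_⟩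
  obtain ⟨B, hB⟩ := hΩb.isCompact_closure.exists_bound_of_continuousOn hv
  exact ⟨B, fun x hx => hB x (subset_closure hx)⟩

lemma isFiniteMeasure_restrict (hΩb : Bornology.IsBounded Ω) :
    IsFiniteMeasure (volume.restrict Ω) :=
  ⟨by rw [Measure.restrict_apply_univ]; exact hΩb.measure_lt_top⟩

lemma aesm_of_mem_cb (hΩ : IsOpen Ω) (hv : v ∈ cb Ω) :
    AEStronglyMeasurable v (volume.restrict Ω) :=
  hv.1.aestronglyMeasurable hΩ.measurableSet

lemma memLp_of_mem_cb (hΩ : IsOpen Ω) (hΩb : Bornology.IsBounded Ω) (hv : v ∈ cb Ω) :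
    MemLp v p (volume.restrict Ω) := by
  have := isFiniteMeasure_restrict hΩb
  obtain ⟨B, hB⟩ := hv.2
  refine MemLp.of_bound (aesm_of_mem_cb hΩ hv) B ?_
  filter_upwards [ae_restrict_mem hΩ.measurableSet] with x hx using hB x hx

lemma integrableOn_of_mem_cb (hΩ : IsOpen Ω) (hΩb : Bornology.IsBounded Ω) (hv : v ∈ cb Ω) :
    IntegrableOn v Ω := memLp_one_iff_integrable.1 (memLp_of_mem_cb hΩ hΩb hv)

lemma integrableOn_mul_of_mem_cb (hΩ : IsOpen Ω) (hΩb : Bornology.IsBounded Ω) (hv : v ∈ cb Ω)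
    (hw : w ∈ cb Ω) : IntegrableOn (fun x => v x * w x) Ω :=
  integrableOn_of_mem_cb hΩ hΩb ((cb Ω).mul_mem hv hw)

/-- The norm of `L_p(Ω)` as a real number. -/
noncomputable def nn {d : ℕ} (Ω : Set (Pt d)) (p : ℝ≥0∞) (v : Pt d → ℝ) : ℝ := (nrm Ω p v).toReal

lemma nn_nonneg (v : Pt d → ℝ) : 0 ≤ nn Ω p v := ENNReal.toReal_nonneg

lemma nrm_ne_top (hΩ : IsOpen Ω) (hΩb : Bornology.IsBounded Ω) (hv : v ∈ cb Ω) :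
    nrm Ω p v ≠ ⊤ := (memLp_of_mem_cb hΩ hΩb hv).2.ne

lemma ofReal_nn (hΩ : IsOpen Ω) (hΩb : Bornology.IsBounded Ω) (hv : v ∈ cb Ω) :
    ENNReal.ofReal (nn Ω p v) = nrm Ω p v := ENNReal.ofReal_toReal (nrm_ne_top hΩ hΩb hv)

lemma nn_zero : nn Ω p (0 : Pt d → ℝ) = 0 := by simp [nn, nrm]

lemma nn_add_le (hΩ : IsOpen Ω) (hΩb : Bornology.IsBounded Ω) (hp : 1 ≤ p) (hv : v ∈ cb Ω)
    (hw : w ∈ cb Ω) : nn Ω p (v + w) ≤ nn Ω p v + nn Ω p w := by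
  have h := eLpNorm_add_le (aesm_of_mem_cb hΩ hv) (aesm_of_mem_cb hΩ hw) hp
  have h1 : nrm Ω p v ≠ ⊤ := nrm_ne_top hΩ hΩb hv
  have h2 : nrm Ω p w ≠ ⊤ := nrm_ne_top hΩ hΩb hw
  rw [nn, nn, nn, ← ENNReal.toReal_add h1 h2]
  exact ENNReal.toReal_mono (ENNReal.add_ne_top.2 ⟨h1, h2⟩) h

lemma nn_smul (c : ℝ) (v : Pt d → ℝ) : nn Ω p (c • v) = |c| * nn Ω p v := by
  rw [nn, nrm, eLpNorm_const_smul, ENNReal.toReal_mul]; simp [nn, nrm]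

lemma nn_sub_le (hΩ : IsOpen Ω) (hΩb : Bornology.IsBounded Ω) (hp : 1 ≤ p) (hv : v ∈ cb Ω)
    (hw : w ∈ cb Ω) : nn Ω p (v - w) ≤ nn Ω p v + nn Ω p w := by
  have h := nn_add_le hΩ hΩb hp hv ((cb Ω).neg_mem hw)
  have h1 : nn Ω p (-w) = nn Ω p w := by
    rw [← neg_one_smul ℝ w, nn_smul]; simp
  rwa [← sub_eq_add_neg, h1] at h

lemma nn_sum_le (hΩ : IsOpen Ω) (hΩb : Bornology.IsBounded Ω) (hp : 1 ≤ p) {ι : Type*}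
    (s : Finset ι) {f : ι → Pt d → ℝ} (hf : ∀ i ∈ s, f i ∈ cb Ω) :
    nn Ω p (∑ i ∈ s, f i) ≤ ∑ i ∈ s, nn Ω p (f i) := by
  classical
  induction s using Finset.induction_on with
  | empty => simp [nn_zero]
  | insert i s hi ih =>
    rw [Finset.sum_insert hi, Finset.sum_insert hi]
    have h1 := nn_add_le hΩ hΩb hp (hf i (by simp))
      ((cb Ω).sum_mem fun j hj => hf j (Finset.mem_insert_of_mem hj))
    have h2 := ih fun j hj => hf j (Finset.mem_insert_of_mem hj)
    linarith

lemma nrm_le_mul {ε : Type*} [TopologicalSpace ε] [ContinuousENorm ε] (hΩ : IsOpen Ω) {g : Pt d → ε}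
    {C : ℝ≥0} (h : ∀ x ∈ Ω, ‖v x‖ₑ ≤ C * ‖g x‖ₑ) : nrm Ω p v ≤ C * nrm Ω p g := by
  have hae : ∀ᵐ x ∂volume.restrict Ω, ‖v x‖ₑ ≤ C * ‖g x‖ₑ := by
    filter_upwards [ae_restrict_mem hΩ.measurableSet] with x hx using h x hx
  have h2 := eLpNorm_le_nnreal_smul_eLpNorm_of_ae_le_mul' hae p
  rw [ENNReal.smul_def, smul_eq_mul] at h2
  unfold nrm
  exact h2

lemma nn_mul_le (hΩ : IsOpen Ω) (hΩb : Bornology.IsBounded Ω)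
    (hv : v ∈ cb Ω) {c : Pt d → ℝ} {C : ℝ} (hC0 : 0 ≤ C) (hC : ∀ x ∈ Ω, |c x| ≤ C) :
    nn Ω p (c * v) ≤ C * nn Ω p v := by
  have h : nrm Ω p (c * v) ≤ (C.toNNReal : ℝ≥0∞) * nrm Ω p v := by
    refine nrm_le_mul hΩ fun x hx => ?_
    rw [Pi.mul_apply, enorm_mul]
    refine mul_le_mul_left ?_ _
    rw [Real.enorm_eq_ofReal_abs]
    exact ENNReal.ofReal_le_ofReal (hC x hx)
  have h2 := ENNReal.toReal_mono
    (ENNReal.mul_ne_top ENNReal.coe_ne_top (nrm_ne_top hΩ hΩb hv)) h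
  rwa [ENNReal.toReal_mul, ENNReal.coe_toReal, Real.coe_toNNReal _ hC0] at h2

/-- For a continuous function on an open set the essential supremum is a pointwise bound. -/
lemma enorm_le_nrm_top (hΩ : IsOpen Ω) (hv : ContinuousOn v Ω) {x : Pt d} (hx : x ∈ Ω) :
    ‖v x‖ₑ ≤ nrm Ω ⊤ v := by
  by_contra! hlt
  set N := nrm Ω ⊤ v with hN
  have hopen : IsOpen (Ω ∩ v ⁻¹' {y : ℝ | N < ‖y‖ₑ}) :=
    hv.isOpen_inter_preimage hΩ (isOpen_lt continuous_const continuous_enorm)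
  have hpos := hopen.measure_pos volume ⟨x, hx, hlt⟩
  have hae : ∀ᵐ y ∂volume.restrict Ω, ‖v y‖ₑ ≤ N := by
    have := enorm_ae_le_eLpNormEssSup v (volume.restrict Ω)
    rwa [← eLpNorm_exponent_top] at this
  rw [ae_restrict_iff' hΩ.measurableSet, ae_iff] at hae
  refine hpos.ne' (measure_mono_null (fun y hy => ?_) hae)
  simp only [mem_ofPred_eq, Classical.not_imp, not_le]
  exact ⟨hy.1, hy.2⟩

lemma abs_le_nn_top (hΩ : IsOpen Ω) (hΩb : Bornology.IsBounded Ω) (hv : v ∈ cb Ω) {x : Pt d}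
    (hx : x ∈ Ω) : |v x| ≤ nn Ω ⊤ v := by
  have h := ENNReal.toReal_mono (nrm_ne_top hΩ hΩb hv) (enorm_le_nrm_top hΩ hv.1 hx)
  rwa [toReal_enorm, Real.norm_eq_abs] at h

lemma nn_top_le (hΩ : IsOpen Ω) {B : ℝ} (hB0 : 0 ≤ B) (hB : ∀ x ∈ Ω, |v x| ≤ B) :
    nn Ω ⊤ v ≤ B := by
  refine ENNReal.toReal_le_of_le_ofReal hB0 ?_
  rw [nrm, eLpNorm_exponent_top]
  refine eLpNormEssSup_le_of_ae_enorm_bound ?_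
  filter_upwards [ae_restrict_mem hΩ.measurableSet] with x hx
  rw [Real.enorm_eq_ofReal_abs]
  exact ENNReal.ofReal_le_ofReal (hB x hx)

lemma enorm_integral_mul_le (hv : AEStronglyMeasurable v (volume.restrict Ω))
    (hw : AEStronglyMeasurable w (volume.restrict Ω)) :
    ‖∫ x in Ω, v x * w x‖ₑ ≤ nrm Ω 2 v * nrm Ω 2 w := by
  refine (enorm_integral_le_lintegral_enorm _).trans ?_
  rw [← eLpNorm_one_eq_lintegral_enorm]
  have h := eLpNorm_smul_le_mul_eLpNorm (p := 2) (q := 2) (r := 1) hw hv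
  exact h

lemma integral_mul_le_nn (hΩ : IsOpen Ω) (hΩb : Bornology.IsBounded Ω) (hv : v ∈ cb Ω)
    (hw : w ∈ cb Ω) : ∫ x in Ω, v x * w x ≤ nn Ω 2 v * nn Ω 2 w := by
  have h := ENNReal.toReal_mono
    (ENNReal.mul_ne_top (nrm_ne_top hΩ hΩb hv) (nrm_ne_top hΩ hΩb hw))
    (enorm_integral_mul_le (aesm_of_mem_cb hΩ hv) (aesm_of_mem_cb hΩ hw))
  rw [ENNReal.toReal_mul, toReal_enorm] at h
  exact (le_abs_self _).trans h

lemma integral_mul_self_eq (hΩ : IsOpen Ω) (hΩb : Bornology.IsBounded Ω) (hv : v ∈ cb Ω) :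
    ∫ x in Ω, v x * v x = nn Ω 2 v ^ 2 := by
  have h0 : 0 ≤ ∫ x in Ω, v x * v x := integral_nonneg fun x => mul_self_nonneg _
  have h := (memLp_of_mem_cb (p := 2) hΩ hΩb hv).eLpNorm_eq_integral_rpow_norm (by norm_num)
    (by norm_num)
  have e : ∫ x in Ω, ‖v x‖ ^ (2 : ℝ≥0∞).toReal = ∫ x in Ω, v x * v x :=
    integral_congr_ae (.of_forall fun x => by simp [sq])
  rw [nn, nrm, h, e, ENNReal.toReal_ofReal (by positivity), ← Real.rpow_natCast,
    ← Real.rpow_mul h0]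
  simp

/-- A continuous function of vanishing norm is zero. -/
lemma eq_zero_of_nn_eq_zero (hΩ : IsOpen Ω) (hΩb : Bornology.IsBounded Ω) (hp : p = 2 ∨ p = ⊤)
    (hv : v ∈ cb Ω) (h : nn Ω p v = 0) {x : Pt d} (hx : x ∈ Ω) : v x = 0 := by
  have h1 : nrm Ω p v = 0 := by rw [← ofReal_nn hΩ hΩb hv, h, ENNReal.ofReal_zero]
  rw [nrm, eLpNorm_eq_zero_iff (aesm_of_mem_cb hΩ hv) (by rcases hp with rfl | rfl <;> norm_num)]
    at h1
  have h2 : nrm Ω ⊤ v = 0 := by rw [nrm, eLpNorm_congr_ae h1]; simp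
  simpa [h2] using enorm_le_nrm_top hΩ hv.1 hx

end cb

/-! ### The solution as a function of space -/

section solution

variable {d : ℕ} {Ω : Set (Pt d)} {p : ℝ≥0∞} {α T K : ℝ} {u : Pt d → ℝ → ℝ}

lemma slice_mem_cb (hΩb : Bornology.IsBounded Ω)
    (hu : ContinuousOn (fun q : Pt d × ℝ => u q.1 q.2) (closure Ω ×ˢ Icc 0 T)) {s : ℝ}
    (hs : s ∈ Icc 0 T) : (fun x => u x s) ∈ cb Ω := by
  refine mem_cb_of_continuousOn_closure hΩb ?_
  exact hu.comp (by fun_prop : ContinuousOn (fun x : Pt d => (x, s)) (closure Ω))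
    fun x hx => ⟨hx, hs⟩

/-- The time derivative is a uniform limit of divided differences, as the second time derivative is
bounded uniformly in space, and therefore it is continuous in space. -/
lemma deriv_mem_cb (hΩb : Bornology.IsBounded Ω)
    (hu : ContinuousOn (fun q : Pt d × ℝ => u q.1 q.2) (closure Ω ×ˢ Icc 0 T))
    (hreg : ∀ x ∈ Ω, TimeRegular α T K (u x)) (hα : α ∈ Ioo (0 : ℝ) 1) (hK : 0 ≤ K) {s : ℝ}
    (hs : s ∈ Ioo 0 T) : (fun x => deriv (u x) s) ∈ cb Ω := by
  refine ⟨?_, K * (1 + s ^ (α - 1)), fun x hx => (hreg x hx).deriv_le s hs⟩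
  set C : ℝ := K * (1 + (s / 2) ^ (α - 2)) with hC
  have hs0 : 0 < s := hs.1
  have hC0 : 0 ≤ C := by positivity
  have hunif : TendstoUniformlyOn
      (fun (h : ℝ) (x : Pt d) => (u x (s + h) - u x (s - h)) / ((s + h) - (s - h)))
      (fun x => deriv (u x) s) (nhdsWithin 0 (Ioi 0)) Ω := by
    rw [Metric.tendstoUniformlyOn_iff]
    intro ε hε
    have hη : 0 < min (min (s / 2) (T - s)) (ε / (2 * (C + 1))) := by
      have : 0 < T - s := sub_pos.2 hs.2
      positivity
    filter_upwards [Ioo_mem_nhdsGT hη] with h hh x hx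
    have hh1 : h < s / 2 := hh.2.trans_le ((min_le_left _ _).trans (min_le_left _ _))
    have hh2 : h < T - s := hh.2.trans_le ((min_le_left _ _).trans (min_le_right _ _))
    have hh3 : h < ε / (2 * (C + 1)) := hh.2.trans_le (min_le_right _ _)
    have hh0 : 0 < h := hh.1
    rw [dist_comm, Real.dist_eq]
    have h1 := (hreg x hx).abs_slope_sub_deriv_le (a := s - h) (b := s + h) (C := C) (s := s)
      (by linarith) (by linarith) (by linarith)
      (fun y hy => ?_) ⟨by linarith, by linarith⟩
    · refine h1.trans_lt ?_
      rw [lt_div_iff₀ (by positivity)] at hh3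
      nlinarith
    · refine ((hreg x hx).deriv2_le y ⟨by linarith [hy.1], by linarith [hy.2]⟩).trans ?_
      have : y ^ (α - 2) ≤ (s / 2) ^ (α - 2) :=
        Real.rpow_le_rpow_of_nonpos (by positivity) (by linarith [hy.1]) (by linarith [hα.2])
      rw [hC]; gcongr
  refine hunif.continuousOn (Filter.Eventually.frequently ?_)
  have hη : 0 < min s (T - s) := lt_min hs0 (sub_pos.2 hs.2)
  filter_upwards [Ioo_mem_nhdsGT hη] with h hh
  have h1 : h < s := hh.2.trans_le (min_le_left _ _)
  have h2 : h < T - s := hh.2.trans_le (min_le_right _ _)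
  have h0 : 0 < h := hh.1
  exact ((slice_mem_cb hΩb hu ⟨by linarith, by linarith⟩).1.sub
    (slice_mem_cb hΩb hu ⟨by linarith, by linarith⟩).1).div_const _

lemma locRes_mem_cb (hΩb : Bornology.IsBounded Ω)
    (hu : ContinuousOn (fun q : Pt d × ℝ => u q.1 q.2) (closure Ω ×ˢ Icc 0 T))
    (hreg : ∀ x ∈ Ω, TimeRegular α T K (u x)) (hα : α ∈ Ioo (0 : ℝ) 1) (hK : 0 ≤ K)
    {t : ℕ → ℝ} (ht : StrictMono t) (ht0 : t 0 = 0) {k j : ℕ} (hkT : t k ≤ T) (hj1 : 1 ≤ j)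
    (hjk : j ≤ k) : (fun x => locRes α t k j (u x)) ∈ cb Ω := by
  have h0 : ∀ i, 0 ≤ t i := fun i => ht0 ▸ ht.monotone (Nat.zero_le i)
  have hτ : t (j - 1) < t j := ht (by omega)
  have hjk' : t j ≤ t k := ht.monotone hjk
  have hδ : (fun x => (u x (t j) - u x (t (j - 1))) / (t j - t (j - 1))) ∈ cb Ω := by
    have h1 := (cb Ω).smul_mem ((cb Ω).sub_mem
      (slice_mem_cb hΩb hu ⟨h0 j, hjk'.trans hkT⟩)
      (slice_mem_cb hΩb hu ⟨h0 (j - 1), hτ.le.trans (hjk'.trans hkT)⟩)) (t j - t (j - 1))⁻¹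
    convert h1 using 1
    ext x
    simp [div_eq_inv_mul]
  obtain ⟨B, hB⟩ := hδ.2
  have hbint : IntervalIntegrable (fun s => (B + K) * (t k - s) ^ (-α)
      + K * ((t k - s) ^ (-α) * s ^ (α - 1))) volume (t (j - 1)) (t j) := by
    refine ((intervalIntegrable_sub_rpow hα.2 _ _ _).const_mul _).add
      (IntervalIntegrable.const_mul ?_ _)
    refine (intervalIntegrable_rpow_mul_rpow hα (h0 k)).mono_set ?_
    rw [uIcc_of_le hτ.le, uIcc_of_le (h0 k)]
    exact Icc_subset_Icc (h0 _) hjk'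
  have hbd : ∀ x ∈ Ω, ∀ s ∈ Ioo (t (j - 1)) (t j),
      ‖(t k - s) ^ (-α) * ((u x (t j) - u x (t (j - 1))) / (t j - t (j - 1)) - deriv (u x) s)‖
        ≤ (B + K) * (t k - s) ^ (-α) + K * ((t k - s) ^ (-α) * s ^ (α - 1)) := by
    intro x hx s hs
    have hw : 0 ≤ (t k - s) ^ (-α) := Real.rpow_nonneg (by linarith [hs.2]) _
    rw [norm_mul, Real.norm_of_nonneg hw, Real.norm_eq_abs]
    have h1 := abs_sub ((u x (t j) - u x (t (j - 1))) / (t j - t (j - 1))) (deriv (u x) s)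
    have h2 := hB x hx
    have h3 := (hreg x hx).deriv_le s ⟨(h0 _).trans_lt hs.1, by linarith [hs.2]⟩
    have h4 : |(u x (t j) - u x (t (j - 1))) / (t j - t (j - 1)) - deriv (u x) s|
        ≤ (B + K) + K * s ^ (α - 1) := by linarith
    calc _ ≤ (t k - s) ^ (-α) * ((B + K) + K * s ^ (α - 1)) := by gcongr
      _ = _ := by ring
  have hmem : ∀ {P : ℝ → Prop}, (∀ s ∈ Ioo (t (j - 1)) (t j), P s) →
      ∀ᵐ s ∂volume, s ∈ uIoc (t (j - 1)) (t j) → P s := by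
    intro P hP
    filter_upwards [Measure.ae_ne volume (t j)] with s hs hs'
    rw [uIoc_of_le hτ.le] at hs'
    exact hP s ⟨hs'.1, lt_of_le_of_ne hs'.2 hs⟩
  refine ⟨fun x₀ hx₀ => ?_, ∫ s in t (j - 1)..t j, ((B + K) * (t k - s) ^ (-α)
      + K * ((t k - s) ^ (-α) * s ^ (α - 1))), fun x hx => ?_⟩
  · refine intervalIntegral.continuousWithinAt_of_dominated_interval ?_ ?_ hbint ?_
    · exact .of_forall fun x => ((by fun_prop : Measurable fun s : ℝ => (t k - s) ^ (-α)).mul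
        (measurable_const.sub (measurable_deriv (u x)))).aestronglyMeasurable
    · filter_upwards [self_mem_nhdsWithin] with x hx using hmem (hbd x hx)
    · refine hmem fun s hs => ?_
      exact continuousWithinAt_const.mul ((hδ.1 x₀ hx₀).sub
        ((deriv_mem_cb hΩb hu hreg hα hK ⟨(h0 _).trans_lt hs.1, by linarith [hs.2]⟩).1 x₀ hx₀))
  · exact intervalIntegral.norm_integral_le_of_norm_le hτ.le
      ((hmem (hbd x hx)).mono fun s hs hs' => hs (by rwa [uIoc_of_le hτ.le])) hbint

end solution

/-! ### The Ritz projection error as a function of time -/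

/-- A bound by the integral of the derivative, which is not required to be integrable. -/
lemma enorm_sub_le_lintegral_deriv {f : ℝ → ℝ} {a b : ℝ} (hab : a ≤ b)
    (hc : ContinuousOn f (Icc a b)) (hd : DifferentiableOn ℝ f (Ioo a b)) :
    ‖f b - f a‖ₑ ≤ ∫⁻ s in Ioo a b, ‖deriv f s‖ₑ := by
  by_cases hfin : ∫⁻ s in Ioo a b, ‖deriv f s‖ₑ = ⊤
  · rw [hfin]; exact le_top
  have hint : IntegrableOn (deriv f) (Ioo a b) :=
    ⟨(measurable_deriv f).aestronglyMeasurable, lt_top_iff_ne_top.2 hfin⟩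
  have h := intervalIntegral.integral_eq_sub_of_hasDerivAt_of_le hab hc
    (fun x hx => (hd.differentiableAt (Ioo_mem_nhds hx.1 hx.2)).hasDerivAt)
    ((intervalIntegrable_iff_integrableOn_Ioo_of_le hab).2 hint)
  rw [← h, intervalIntegral.integral_of_le hab, integral_Ioc_eq_integral_Ioo]
  exact enorm_integral_le_lintegral_enorm _

/-- A curve in a finite-dimensional space of functions that is regular at each point has regular
coordinates, as the coordinates are combinations of finitely many point evaluations. -/
lemma exists_regular_coords {d : ℕ} {Ω : Set (Pt d)} {T : ℝ} {V : Submodule ℝ (Pt d → ℝ)}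
    [FiniteDimensional ℝ V] (hV : ∀ v ∈ V, ∀ x, x ∉ Ω → v x = 0) {R : ℝ → Pt d → ℝ}
    (hmem : ∀ t ∈ Icc 0 T, R t ∈ V)
    (hcont : ∀ x ∈ Ω, ContinuousOn (fun t => R t x) (Icc 0 T))
    (hdiff : ∀ x ∈ Ω, DifferentiableOn ℝ (fun t => R t x) (Ioo 0 T)) :
    ∃ (n : ℕ) (e : Fin n → Pt d → ℝ) (c : Fin n → ℝ → ℝ), (∀ i, e i ∈ V) ∧
      (∀ t ∈ Icc 0 T, ∀ x, R t x = ∑ i, c i t * e i x) ∧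
      (∀ i, ContinuousOn (c i) (Icc 0 T)) ∧ ∀ i, DifferentiableOn ℝ (c i) (Ioo 0 T) := by
  classical
  let ev : Pt d → Module.Dual ℝ V := fun x => (LinearMap.proj x).comp V.subtype
  have hspan : Submodule.span ℝ (ev '' Ω) = ⊤ := by
    refine Submodule.span_eq_top_of_ne_zero fun z hz => ?_
    by_contra! hzero
    refine hz (Subtype.ext (funext fun x => ?_))
    by_cases hx : x ∈ Ω
    · exact hzero (ev x) ⟨x, hx, rfl⟩
    · exact hV z z.2 x hx
  let b := Module.finBasis ℝ V
  have hcoord : ∀ i, ∃ (m : ℕ) (β : Fin m → ℝ) (y : Fin m → Pt d), (∀ k, y k ∈ Ω) ∧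
      ∀ v : V, b.coord i v = ∑ k, β k * (v : Pt d → ℝ) (y k) := by
    intro i
    have h : b.coord i ∈ Submodule.span ℝ (ev '' Ω) := hspan ▸ Submodule.mem_top
    obtain ⟨m, β, g, hg⟩ := Submodule.mem_span_set'.1 h
    choose y hy hye using fun k => (g k).2
    refine ⟨m, β, y, hy, fun v => ?_⟩
    rw [← hg, LinearMap.sum_apply]
    refine Finset.sum_congr rfl fun k _ => ?_
    rw [LinearMap.smul_apply, ← hye k, smul_eq_mul]
    rfl
  choose m β y hy hβ using hcoord
  refine ⟨_, fun i => (b i : Pt d → ℝ), fun i t => ∑ k, β i k * R t (y i k), fun i => (b i).2,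
    fun t ht x => ?_, fun i => ?_, fun i => ?_⟩
  · have h := b.sum_repr ⟨R t, hmem t ht⟩
    have h2 := congrArg (fun v : V => (v : Pt d → ℝ) x) h
    simp only [Submodule.coe_sum, Submodule.coe_smul, Finset.sum_apply, Pi.smul_apply,
      smul_eq_mul] at h2
    rw [← h2]
    refine Finset.sum_congr rfl fun i _ => ?_
    rw [← Module.Basis.coord_apply, hβ i]
  · exact continuousOn_finsetSum _ fun k _ => continuousOn_const.mul (hcont _ (hy i k))
  · exact DifferentiableOn.fun_sum fun k _ => (hdiff _ (hy i k)).const_mul _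

section ritz

variable {d : ℕ} {Ω : Set (Pt d)} {p : ℝ≥0∞} {α T K : ℝ} {u : Pt d → ℝ → ℝ}

lemma continuousOn_integral_mul (hΩ : IsOpen Ω) (hΩb : Bornology.IsBounded Ω)
    (hu : ContinuousOn (fun q : Pt d × ℝ => u q.1 q.2) (closure Ω ×ˢ Icc 0 T))
    {D : Pt d → ℝ} (hD : D ∈ cb Ω) :
    ContinuousOn (fun t => ∫ x in Ω, D x * u x t) (Icc 0 T) := by
  obtain ⟨B, hB⟩ := (hΩb.isCompact_closure.prod isCompact_Icc).exists_bound_of_continuousOn hu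
  have hDi : Integrable D (volume.restrict Ω) := integrableOn_of_mem_cb hΩ hΩb hD
  refine continuousOn_of_dominated (bound := fun x => |D x| * B)
    (fun t ht => aesm_of_mem_cb hΩ ((cb Ω).mul_mem hD (slice_mem_cb hΩb hu ht))) (fun t ht => ?_)
    (hDi.abs.mul_const B) ?_
  · filter_upwards [ae_restrict_mem hΩ.measurableSet] with x hx
    rw [norm_mul, Real.norm_eq_abs]
    exact mul_le_mul_of_nonneg_left (hB (x, t) ⟨subset_closure hx, ht⟩) (abs_nonneg _)
  · filter_upwards [ae_restrict_mem hΩ.measurableSet] with x hx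
    exact continuousOn_const.mul (hu.comp (by fun_prop : ContinuousOn (fun t : ℝ => (x, t)) _)
      fun t ht => ⟨subset_closure hx, ht⟩)

lemma hasDerivAt_integral_mul (hΩ : IsOpen Ω) (hΩb : Bornology.IsBounded Ω)
    (hu : ContinuousOn (fun q : Pt d × ℝ => u q.1 q.2) (closure Ω ×ˢ Icc 0 T))
    (hreg : ∀ x ∈ Ω, TimeRegular α T K (u x)) (hα : α ∈ Ioo (0 : ℝ) 1) (hK : 0 ≤ K)
    {D : Pt d → ℝ} (hD : D ∈ cb Ω) {t : ℝ} (ht : t ∈ Ioo 0 T) :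
    HasDerivAt (fun t => ∫ x in Ω, D x * u x t) (∫ x in Ω, D x * deriv (u x) t) t := by
  have hDi : Integrable D (volume.restrict Ω) := integrableOn_of_mem_cb hΩ hΩb hD
  have ht0 : 0 < t := ht.1
  refine (hasDerivAt_integral_of_dominated_loc_of_deriv_le (μ := volume.restrict Ω)
    (F := fun t x => D x * u x t) (F' := fun t x => D x * deriv (u x) t)
    (bound := fun x => |D x| * (K * (1 + (t / 2) ^ (α - 1)))) (s := Ioo (t / 2) T)
    (Ioo_mem_nhds (by linarith) ht.2) ?_
    (integrableOn_of_mem_cb hΩ hΩb ((cb Ω).mul_mem hD (slice_mem_cb hΩb hu ⟨ht.1.le, ht.2.le⟩)))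
    (aesm_of_mem_cb hΩ ((cb Ω).mul_mem hD (deriv_mem_cb hΩb hu hreg hα hK ht))) ?_
    (hDi.abs.mul_const _) ?_).2
  · filter_upwards [Ioo_mem_nhds ht.1 ht.2] with s hs
    exact aesm_of_mem_cb hΩ ((cb Ω).mul_mem hD (slice_mem_cb hΩb hu ⟨hs.1.le, hs.2.le⟩))
  · filter_upwards [ae_restrict_mem hΩ.measurableSet] with x hx s hs
    rw [norm_mul, Real.norm_eq_abs, Real.norm_eq_abs]
    refine mul_le_mul_of_nonneg_left
      (((hreg x hx).deriv_le s ⟨by linarith [hs.1], hs.2⟩).trans ?_) (abs_nonneg _)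
    have : s ^ (α - 1) ≤ (t / 2) ^ (α - 1) :=
      Real.rpow_le_rpow_of_nonpos (by positivity) hs.1.le (by linarith [hα.2])
    gcongr
  · filter_upwards [ae_restrict_mem hΩ.measurableSet] with x hx s hs
    exact ((hreg x hx).differentiableAt ⟨by linarith [hs.1], hs.2⟩).hasDerivAt.const_mul _

/-- The increment of the Ritz projection error is bounded by the integral in time of the norm of its
time derivative. For `p = ∞` this holds pointwise; for `p = 2` it follows by duality, which
needs no measurability of the integrand in time. -/
lemma nrm_ritz_sub_le (hΩ : IsOpen Ω) (hΩb : Bornology.IsBounded Ω) (hp : p = 2 ∨ p = ⊤)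
    (hu : ContinuousOn (fun q : Pt d × ℝ => u q.1 q.2) (closure Ω ×ˢ Icc 0 T))
    (hreg : ∀ x ∈ Ω, TimeRegular α T K (u x)) (hα : α ∈ Ioo (0 : ℝ) 1) (hK : 0 ≤ K)
    {V : Submodule ℝ (Pt d → ℝ)} [FiniteDimensional ℝ V]
    (hV : ∀ v ∈ V, ∀ x, x ∉ Ω → v x = 0) (hVcb : ∀ v ∈ V, v ∈ cb Ω) {R : ℝ → Pt d → ℝ}
    (hmem : ∀ t ∈ Icc 0 T, R t ∈ V)
    (hcont : ∀ x ∈ Ω, ContinuousOn (fun t => R t x) (Icc 0 T))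
    (hdiff : ∀ x ∈ Ω, DifferentiableOn ℝ (fun t => R t x) (Ioo 0 T)) {a b : ℝ} (ha : 0 ≤ a)
    (hab : a ≤ b) (hb : b ≤ T) :
    nrm Ω p (fun x => (R b x - u x b) - (R a x - u x a))
      ≤ ∫⁻ t in Ioo a b, nrm Ω p (fun x => deriv (fun t => R t x - u x t) t) := by
  obtain ⟨n, e, c, he, hRe, hcc, hcd⟩ := exists_regular_coords hV hmem hcont hdiff
  have hsub : ∀ t ∈ Ioo a b, t ∈ Ioo 0 T := fun t ht => ⟨ha.trans_lt ht.1, ht.2.trans_le hb⟩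
  have hcd' : ∀ t ∈ Ioo 0 T, ∀ i, HasDerivAt (c i) (deriv (c i) t) t := fun t ht i =>
    ((hcd i).differentiableAt (Ioo_mem_nhds ht.1 ht.2)).hasDerivAt
  have hRd : ∀ t ∈ Ioo 0 T, ∀ x, HasDerivAt (fun t => R t x) (∑ i, deriv (c i) t * e i x) t := by
    intro t ht x
    have h1 : HasDerivAt (fun t => ∑ i, c i t * e i x) (∑ i, deriv (c i) t * e i x) t :=
      HasDerivAt.fun_sum fun i _ => (hcd' t ht i).mul_const _
    refine h1.congr_of_eventuallyEq ?_
    filter_upwards [Ioo_mem_nhds ht.1 ht.2] with s hs using hRe s ⟨hs.1.le, hs.2.le⟩ x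
  have hρd : ∀ t ∈ Ioo 0 T, ∀ x ∈ Ω, HasDerivAt (fun t => R t x - u x t)
      (∑ i, deriv (c i) t * e i x - deriv (u x) t) t := fun t ht x hx =>
    (hRd t ht x).sub ((hreg x hx).differentiableAt ht).hasDerivAt
  have hρd_cb : ∀ t ∈ Ioo 0 T, (fun x => ∑ i, deriv (c i) t * e i x - deriv (u x) t) ∈ cb Ω := by
    intro t ht
    refine (cb Ω).sub_mem ?_ (deriv_mem_cb hΩb hu hreg hα hK ht)
    have := (cb Ω).sum_mem (t := Finset.univ) (f := fun i => deriv (c i) t • e i)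
      fun i _ => (cb Ω).smul_mem (hVcb _ (he i)) _
    convert this using 1
    ext x; simp
  have hnd : ∀ t ∈ Ioo 0 T, nrm Ω p (fun x => deriv (fun t => R t x - u x t) t)
      = nrm Ω p (fun x => ∑ i, deriv (c i) t * e i x - deriv (u x) t) := by
    intro t ht
    refine eLpNorm_congr_ae ?_
    filter_upwards [ae_restrict_mem hΩ.measurableSet] with x hx using (hρd t ht x hx).deriv
  have hρ_cb : ∀ t ∈ Icc 0 T, (fun x => R t x - u x t) ∈ cb Ω := fun t ht =>
    (cb Ω).sub_mem (hVcb _ (hmem t ht)) (slice_mem_cb hΩb hu ht)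
  have hD : (fun x => (R b x - u x b) - (R a x - u x a)) ∈ cb Ω :=
    (cb Ω).sub_mem (hρ_cb b ⟨ha.trans hab, hb⟩) (hρ_cb a ⟨ha, hab.trans hb⟩)
  set D := fun x => (R b x - u x b) - (R a x - u x a) with hDdef
  rcases hp with rfl | rfl
  · -- the pairing of the error with its increment `D`
    set F : ℝ → ℝ := fun t => ∑ i, c i t * (∫ x in Ω, D x * e i x) - ∫ x in Ω, D x * u x t with hF
    have hDe : ∀ i, IntegrableOn (fun x => D x * e i x) Ω := fun i =>
      integrableOn_of_mem_cb hΩ hΩb ((cb Ω).mul_mem hD (hVcb _ (he i)))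
    have hFe : ∀ t ∈ Icc 0 T, F t = ∫ x in Ω, D x * (R t x - u x t) := by
      intro t ht
      have h1 : ∀ x, D x * (R t x - u x t) = ∑ i, c i t * (D x * e i x) - D x * u x t := by
        intro x
        rw [hRe t ht x, mul_sub, Finset.mul_sum]
        congr 1
        exact Finset.sum_congr rfl fun i _ => by ring
      simp only [h1]
      rw [integral_sub (integrable_finsetSum _ fun i _ => (hDe i).const_mul _)
        (integrableOn_mul_of_mem_cb hΩ hΩb hD (slice_mem_cb hΩb hu ht)),
        integral_finsetSum _ fun i _ => (hDe i).const_mul _]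
      simp only [integral_const_mul, hF]
    have hFd : ∀ t ∈ Ioo 0 T, HasDerivAt F
        (∫ x in Ω, D x * (∑ i, deriv (c i) t * e i x - deriv (u x) t)) t := by
      intro t ht
      have h1 : ∀ x, D x * (∑ i, deriv (c i) t * e i x - deriv (u x) t)
          = ∑ i, deriv (c i) t * (D x * e i x) - D x * deriv (u x) t := by
        intro x
        rw [mul_sub, Finset.mul_sum]
        congr 1
        exact Finset.sum_congr rfl fun i _ => by ring
      simp only [h1]
      rw [integral_sub (integrable_finsetSum _ fun i _ => (hDe i).const_mul _)
        (integrableOn_mul_of_mem_cb hΩ hΩb hD (deriv_mem_cb hΩb hu hreg hα hK ht)),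
        integral_finsetSum _ fun i _ => (hDe i).const_mul _]
      simp only [integral_const_mul]
      exact (HasDerivAt.fun_sum fun i _ => (hcd' t ht i).mul_const _).sub
        (hasDerivAt_integral_mul hΩ hΩb hu hreg hα hK hD ht)
    have hFc : ContinuousOn F (Icc 0 T) :=
      (continuousOn_finsetSum _ fun i _ => (hcc i).mul continuousOn_const).sub
        (continuousOn_integral_mul hΩ hΩb hu hD)
    have h1 := enorm_sub_le_lintegral_deriv hab (hFc.mono (Icc_subset_Icc ha hb))
      fun t ht => (hFd t (hsub t ht)).differentiableAt.differentiableWithinAt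
    have h2 : F b - F a = nn Ω 2 D ^ 2 := by
      rw [hFe b ⟨ha.trans hab, hb⟩, hFe a ⟨ha, hab.trans hb⟩, ← integral_sub,
        ← integral_mul_self_eq hΩ hΩb hD]
      · simp only [← mul_sub, hDdef]
      · exact integrableOn_of_mem_cb hΩ hΩb ((cb Ω).mul_mem hD (hρ_cb b ⟨ha.trans hab, hb⟩))
      · exact integrableOn_of_mem_cb hΩ hΩb ((cb Ω).mul_mem hD (hρ_cb a ⟨ha, hab.trans hb⟩))
    have h3 : ‖F b - F a‖ₑ = nrm Ω 2 D * nrm Ω 2 D := by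
      rw [h2, Real.enorm_eq_ofReal (by positivity), sq, ENNReal.ofReal_mul (nn_nonneg _),
        ofReal_nn hΩ hΩb hD]
    have h4 : ∫⁻ t in Ioo a b, ‖deriv F t‖ₑ ≤ nrm Ω 2 D *
        ∫⁻ t in Ioo a b, nrm Ω 2 (fun x => deriv (fun t => R t x - u x t) t) := by
      rw [← lintegral_const_mul' _ _ (nrm_ne_top hΩ hΩb hD)]
      refine setLIntegral_mono' measurableSet_Ioo fun t ht => ?_
      rw [(hFd t (hsub t ht)).deriv, hnd t (hsub t ht)]
      exact enorm_integral_mul_le (aesm_of_mem_cb hΩ hD)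
        (aesm_of_mem_cb hΩ (hρd_cb t (hsub t ht)))
    rw [h3] at h1
    by_cases h0 : nrm Ω 2 D = 0
    · rw [h0]; exact zero_le
    · exact (ENNReal.mul_le_mul_iff_right h0 (nrm_ne_top hΩ hΩb hD)).1 (h1.trans h4)
  · rw [nrm, eLpNorm_exponent_top]
    refine eLpNormEssSup_le_of_ae_enorm_bound ?_
    filter_upwards [ae_restrict_mem hΩ.measurableSet] with x hx
    have hc : ContinuousOn (fun t => R t x - u x t) (Icc a b) :=
      ((hcont x hx).sub (hreg x hx).cont).mono (Icc_subset_Icc ha hb)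
    refine (enorm_sub_le_lintegral_deriv hab hc fun t ht =>
      (hρd t (hsub t ht) x hx).differentiableAt.differentiableWithinAt).trans ?_
    refine setLIntegral_mono' measurableSet_Ioo fun t ht => ?_
    rw [hnd t (hsub t ht), (hρd t (hsub t ht) x hx).deriv]
    exact enorm_le_nrm_top hΩ (hρd_cb t (hsub t ht)).1 hx

end ritz

/-! ### Piecewise polynomials -/

lemma contDiff_eval {d : ℕ} (P : MvPolynomial (Fin d) ℝ) :
    ContDiff ℝ 1 (fun x : Pt d => MvPolynomial.eval (fun i => x i) P) := by
  simp only [MvPolynomial.eval_eq]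
  fun_prop

section pd

variable {d : ℕ} {v w : Pt d → ℝ} {x : Pt d}

lemma pd_add (hv : DifferentiableAt ℝ v x) (hw : DifferentiableAt ℝ w x) (k : Fin d) :
    pd k (v + w) x = pd k v x + pd k w x := by
  simp [pd, fderiv_add hv hw]

lemma pd_smul (hv : DifferentiableAt ℝ v x) (c : ℝ) (k : Fin d) :
    pd k (c • v) x = c * pd k v x := by
  simp [pd, fderiv_const_smul hv c]

lemma pd_congr (h : v =ᶠ[nhds x] w) (k : Fin d) : pd k v x = pd k w x := by
  simp [pd, h.fderiv_eq]

lemma measurable_pd (k : Fin d) (v : Pt d → ℝ) : Measurable (pd k v) :=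
  measurable_fderiv_apply_const ℝ v _

end pd

/-- Bounded continuous functions on `Ω` that are differentiable almost everywhere, with a bounded
gradient. The forms of the discrete problem are bilinear on this space. -/
def tame {d : ℕ} (Ω : Set (Pt d)) : Submodule ℝ (Pt d → ℝ) where
  carrier := {v | v ∈ cb Ω ∧ ∃ G : ℝ, ∀ᵐ x ∂volume.restrict Ω,
    DifferentiableAt ℝ v x ∧ ∀ k, |pd k v x| ≤ G}
  add_mem' := by
    rintro v w ⟨hv, G, hG⟩ ⟨hw, G', hG'⟩
    refine ⟨(cb Ω).add_mem hv hw, G + G', ?_⟩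
    filter_upwards [hG, hG'] with x hx hx'
    refine ⟨hx.1.add hx'.1, fun k => ?_⟩
    rw [pd_add hx.1 hx'.1]
    exact (abs_add_le _ _).trans (add_le_add (hx.2 k) (hx'.2 k))
  zero_mem' := ⟨(cb Ω).zero_mem, 0, .of_forall fun x => by
    simp only [Pi.zero_def, pd, fderiv_fun_const]
    exact ⟨differentiableAt_const _, fun k => by simp⟩⟩
  smul_mem' := by
    rintro c v ⟨hv, G, hG⟩
    refine ⟨(cb Ω).smul_mem hv c, |c| * G, ?_⟩
    filter_upwards [hG] with x hx
    refine ⟨hx.1.const_smul c, fun k => ?_⟩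
    rw [pd_smul hx.1, abs_mul]
    exact mul_le_mul_of_nonneg_left (hx.2 k) (abs_nonneg _)

namespace Triangulation

variable {d : ℕ} {Ω : Set (Pt d)} (𝒯 : Triangulation Ω)

lemma isCompact_cell (K : Finset (Pt d)) : IsCompact (convexHull ℝ (K : Set (Pt d))) :=
  K.finite_toSet.isCompact_convexHull ℝ

lemma mem_closure_of_mem_cell {K : Finset (Pt d)} (hK : K ∈ 𝒯.cells) {x : Pt d}
    (hx : x ∈ convexHull ℝ (K : Set (Pt d))) : x ∈ closure Ω := by
  rw [← 𝒯.cover]; exact mem_biUnion hK hx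

lemma exists_cell {x : Pt d} (hx : x ∈ closure Ω) :
    ∃ K ∈ 𝒯.cells, x ∈ convexHull ℝ (K : Set (Pt d)) := by
  rw [← 𝒯.cover] at hx
  simpa using hx

variable {𝒯}

lemma PiecewisePoly.continuousOn {ℓ : ℕ} {v : Pt d → ℝ} (hv : 𝒯.PiecewisePoly ℓ v) :
    ContinuousOn v (closure Ω) := by
  rw [← 𝒯.cover]
  intro x _
  change Filter.Tendsto v (nhdsWithin x (⋃ K ∈ (𝒯.cells : Set (Finset (Pt d))), _)) _
  rw [nhdsWithin_biUnion (𝒯.cells.finite_toSet)]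
  simp only [Filter.tendsto_iSup]
  intro K hK
  by_cases hxK : x ∈ convexHull ℝ (K : Set (Pt d))
  · obtain ⟨P, -, hP⟩ := hv K hK
    have h1 : ContinuousWithinAt (fun x : Pt d => MvPolynomial.eval (fun i => x i) P)
      (convexHull ℝ (K : Set (Pt d))) x := (contDiff_eval P).continuous.continuousWithinAt
    exact h1.congr hP (hP x hxK)
  · have h1 : nhdsWithin x (convexHull ℝ (K : Set (Pt d))) = ⊥ := by
      rw [← notMem_closure_iff_nhdsWithin_eq_bot, (isCompact_cell K).isClosed.closure_eq]
      exact hxK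
    rw [h1]; exact Filter.tendsto_bot

lemma ae_mem_interior_cell (hΩ : IsOpen Ω) (𝒯 : Triangulation Ω) :
    ∀ᵐ x ∂volume.restrict Ω, ∃ K ∈ 𝒯.cells, x ∈ interior (convexHull ℝ (K : Set (Pt d))) := by
  have h1 : ∀ᵐ x ∂(volume : Measure (Pt d)), ∀ K ∈ 𝒯.cells,
      x ∉ frontier (convexHull ℝ (K : Set (Pt d))) := by
    rw [Filter.eventually_all_finset]
    intro K _
    exact measure_eq_zero_iff_ae_notMem.1
      ((convex_convexHull ℝ (K : Set (Pt d))).addHaar_frontier volume)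
  filter_upwards [ae_restrict_mem hΩ.measurableSet, ae_restrict_of_ae h1] with x hx hx1
  obtain ⟨K, hK, hxK⟩ := 𝒯.exists_cell (subset_closure hx)
  refine ⟨K, hK, ?_⟩
  by_contra hni
  exact hx1 K hK ⟨subset_closure hxK, hni⟩

/-- Inside a cell a piecewise polynomial is smooth, and the boundaries of the cells are null
sets. -/
lemma PiecewisePoly.mem_tame (hΩ : IsOpen Ω) (hΩb : Bornology.IsBounded Ω) {ℓ : ℕ}
    {v : Pt d → ℝ} (hv : 𝒯.PiecewisePoly ℓ v) : v ∈ tame Ω := by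
  refine ⟨mem_cb_of_continuousOn_closure hΩb hv.continuousOn, ?_⟩
  choose! P _ hP using hv
  have hbd : ∀ K ∈ 𝒯.cells, ∀ k : Fin d, ∃ G, ∀ x ∈ convexHull ℝ (K : Set (Pt d)),
      |pd k (fun x : Pt d => MvPolynomial.eval (fun i => x i) (P K)) x| ≤ G := by
    intro K _ k
    have h1 := (contDiff_eval (P K)).continuous_fderiv (by norm_num)
    have h2 : Continuous (pd k fun x : Pt d => MvPolynomial.eval (fun i => x i) (P K)) :=
      h1.clm_apply continuous_const
    exact (isCompact_cell K).exists_bound_of_continuousOn h2.continuousOn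
  choose! G hG using hbd
  refine ⟨∑ K ∈ 𝒯.cells, ∑ k, |G K k|, ?_⟩
  filter_upwards [ae_mem_interior_cell hΩ 𝒯] with x ⟨K, hK, hxK⟩
  have he : v =ᶠ[nhds x] fun x : Pt d => MvPolynomial.eval (fun i => x i) (P K) := by
    filter_upwards [mem_interior_iff_mem_nhds.1 hxK] with y hy using hP K hK y hy
  refine ⟨((contDiff_eval (P K)).differentiable (by norm_num) x).congr_of_eventuallyEq he,
    fun k => ?_⟩
  rw [pd_congr he]
  calc _ ≤ |G K k| := (hG K hK k x (interior_subset hxK)).trans (le_abs_self _)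
    _ ≤ ∑ k, |G K k| := Finset.single_le_sum (f := fun k => |G K k|)
        (fun _ _ => abs_nonneg _) (Finset.mem_univ k)
    _ ≤ _ := Finset.single_le_sum (f := fun K => ∑ k, |G K k|)
        (fun _ _ => Finset.sum_nonneg fun _ _ => abs_nonneg _) hK

lemma feSpace_mem_tame (hΩ : IsOpen Ω) (hΩb : Bornology.IsBounded Ω) {ℓ : ℕ}
    {v : Pt d → ℝ} (hv : v ∈ 𝒯.feSpace ℓ) : v ∈ tame Ω := hv.2.1.mem_tame hΩ hΩb

lemma feSpace_mem_cb (hΩ : IsOpen Ω) (hΩb : Bornology.IsBounded Ω) {ℓ : ℕ}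
    {v : Pt d → ℝ} (hv : v ∈ 𝒯.feSpace ℓ) : v ∈ cb Ω := (feSpace_mem_tame hΩ hΩb hv).1

/-- A finite element function is determined by finitely many polynomials of bounded degree. -/
lemma finiteDimensional_feSpace (𝒯 : Triangulation Ω) (ℓ : ℕ) :
    FiniteDimensional ℝ (𝒯.feSpace ℓ) := by
  classical
  let Φ : (𝒯.cells → MvPolynomial.restrictTotalDegree (Fin d) ℝ ℓ) →ₗ[ℝ] (Pt d → ℝ) :=
    { toFun := fun P x => if h : x ∈ Ω then
        MvPolynomial.eval (fun i => x i)
          (P ⟨_, (𝒯.exists_cell (subset_closure h)).choose_spec.1⟩ : MvPolynomial (Fin d) ℝ)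
        else 0
      map_add' := fun P Q => by ext x; by_cases h : x ∈ Ω <;> simp [h]
      map_smul' := fun c P => by ext x; by_cases h : x ∈ Ω <;> simp [h] }
  have hle : 𝒯.feSpace ℓ ≤ LinearMap.range Φ := by
    intro v hv
    choose! P hPd hP using hv.2.1
    refine ⟨fun K => ⟨P K, (MvPolynomial.mem_restrictTotalDegree _ _ _).2 (hPd K K.2)⟩, ?_⟩
    ext x
    by_cases h : x ∈ Ω
    · simp only [Φ, LinearMap.coe_mk, AddHom.coe_mk, h, dite_true]
      have hs := (𝒯.exists_cell (subset_closure h)).choose_spec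
      exact (hP _ hs.1 x hs.2).symm
    · simp [Φ, h, hv.2.2 x h]
  exact Submodule.finiteDimensional_of_le hle

end Triangulation

/-! ### Bilinearity of the discrete forms -/

section forms

variable {d : ℕ} {Ω : Set (Pt d)} {𝒯 : Triangulation Ω} {q : Option (Quadrature 𝒯)}

lemma integrableOn_mul_cb (hΩ : IsOpen Ω) {f v : Pt d → ℝ} (hf : IntegrableOn f Ω)
    (hv : v ∈ cb Ω) : IntegrableOn (fun x => f x * v x) Ω := by
  obtain ⟨B, hB⟩ := hv.2
  refine Integrable.mul_bdd (c := B) hf (aesm_of_mem_cb hΩ hv) ?_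
  filter_upwards [ae_restrict_mem hΩ.measurableSet] with x hx using hB x hx

lemma ip_add_left (hΩ : IsOpen Ω) {f g v : Pt d → ℝ} (hf : IntegrableOn f Ω)
    (hg : IntegrableOn g Ω) (hv : v ∈ cb Ω) : ip q (f + g) v = ip q f v + ip q g v := by
  cases q with
  | none =>
    simp only [ip, Pi.add_apply, add_mul]
    exact integral_add (integrableOn_mul_cb hΩ hf hv) (integrableOn_mul_cb hΩ hg hv)
  | some Q =>
    simp only [ip, Pi.add_apply, ← Finset.sum_add_distrib]
    exact Finset.sum_congr rfl fun K _ => Finset.sum_congr rfl fun y _ => by ring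

lemma ip_add_right (hΩ : IsOpen Ω) {f v w : Pt d → ℝ} (hf : IntegrableOn f Ω)
    (hv : v ∈ cb Ω) (hw : w ∈ cb Ω) : ip q f (v + w) = ip q f v + ip q f w := by
  cases q with
  | none =>
    simp only [ip, Pi.add_apply, mul_add]
    exact integral_add (integrableOn_mul_cb hΩ hf hv) (integrableOn_mul_cb hΩ hf hw)
  | some Q =>
    simp only [ip, Pi.add_apply, ← Finset.sum_add_distrib]
    exact Finset.sum_congr rfl fun K _ => Finset.sum_congr rfl fun y _ => by ring

lemma ip_smul_left (c : ℝ) (f v : Pt d → ℝ) : ip q (c • f) v = c * ip q f v := by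
  cases q with
  | none => simp only [ip, Pi.smul_apply, smul_eq_mul, mul_assoc, integral_const_mul]
  | some Q =>
    simp only [ip, Pi.smul_apply, smul_eq_mul, Finset.mul_sum]
    exact Finset.sum_congr rfl fun K _ => Finset.sum_congr rfl fun y _ => by ring

lemma ip_smul_right (c : ℝ) (f v : Pt d → ℝ) : ip q f (c • v) = c * ip q f v := by
  cases q with
  | none =>
    simp only [ip, Pi.smul_apply, smul_eq_mul, ← integral_const_mul]
    congr 1; ext x; ring
  | some Q =>
    simp only [ip, Pi.smul_apply, smul_eq_mul, Finset.mul_sum]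
    exact Finset.sum_congr rfl fun K _ => Finset.sum_congr rfl fun y _ => by ring

lemma ip_sub_left (hΩ : IsOpen Ω) {f g v : Pt d → ℝ} (hf : IntegrableOn f Ω)
    (hg : IntegrableOn g Ω) (hv : v ∈ cb Ω) : ip q (f - g) v = ip q f v - ip q g v := by
  rw [sub_eq_add_neg, ← neg_one_smul ℝ g, ip_add_left hΩ hf (hg.smul (-1 : ℝ)) hv, ip_smul_left]
  ring

/-- Quadrature points on the boundary do not matter for test functions that vanish there. -/
lemma ip_congr_left (hΩ : IsOpen Ω) {f g v : Pt d → ℝ} (h : ∀ x ∈ Ω, f x = g x)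
    (hv : ∀ x, x ∉ Ω → v x = 0) : ip q f v = ip q g v := by
  cases q with
  | none => exact setIntegral_congr_fun hΩ.measurableSet fun x hx => by simp only [h x hx]
  | some Q =>
    simp only [ip]
    refine Finset.sum_congr rfl fun K _ => Finset.sum_congr rfl fun y _ => ?_
    by_cases hy : y ∈ Ω
    · rw [h y hy]
    · rw [hv y hy]; ring

variable {a b : Fin d → Pt d → ℝ} {c : Pt d → ℝ}

lemma integrableOn_cb_mul_pd (hΩ : IsOpen Ω) (hΩb : Bornology.IsBounded Ω) {f v : Pt d → ℝ}
    (hf : f ∈ cb Ω) (hv : v ∈ tame Ω) (k : Fin d) :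
    IntegrableOn (fun x => f x * pd k v x) Ω := by
  obtain ⟨G, hG⟩ := hv.2
  refine Integrable.mul_bdd (c := G) (integrableOn_of_mem_cb hΩ hΩb hf)
    (measurable_pd k v).aestronglyMeasurable ?_
  filter_upwards [hG] with x hx using hx.2 k

lemma integrableOn_formA0 (hΩ : IsOpen Ω) (hΩb : Bornology.IsBounded Ω)
    (hcoef : IsCoeff Ω a b c) {v w : Pt d → ℝ} (hv : v ∈ tame Ω) (hw : w ∈ tame Ω) :
    IntegrableOn (fun x => ∑ k, (a k x * pd k v x * pd k w x + b k x * pd k v x * w x)) Ω := by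
  refine integrable_finsetSum _ fun k _ => ?_
  have ha := mem_cb_of_continuousOn_closure hΩb (hcoef.a_cont k)
  have hb := mem_cb_of_continuousOn_closure hΩb (hcoef.b_cont k)
  obtain ⟨G, hG⟩ := hw.2
  refine Integrable.add ?_ (integrableOn_mul_cb hΩ (integrableOn_cb_mul_pd hΩ hΩb hb hv k) hw.1)
  refine Integrable.mul_bdd (c := G) (integrableOn_cb_mul_pd hΩ hΩb ha hv k)
    (measurable_pd k w).aestronglyMeasurable ?_
  filter_upwards [hG] with x hx using hx.2 k

lemma formA0_add_left (hΩ : IsOpen Ω) (hΩb : Bornology.IsBounded Ω)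
    (hcoef : IsCoeff Ω a b c) {v v' w : Pt d → ℝ} (hv : v ∈ tame Ω) (hv' : v' ∈ tame Ω)
    (hw : w ∈ tame Ω) : formA0 Ω a b (v + v') w = formA0 Ω a b v w + formA0 Ω a b v' w := by
  rw [formA0, formA0, formA0, ← integral_add (integrableOn_formA0 hΩ hΩb hcoef hv hw)
    (integrableOn_formA0 hΩ hΩb hcoef hv' hw)]
  obtain ⟨G, hG⟩ := hv.2
  obtain ⟨G', hG'⟩ := hv'.2
  refine integral_congr_ae ?_
  filter_upwards [hG, hG'] with x hx hx'
  rw [← Finset.sum_add_distrib]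
  exact Finset.sum_congr rfl fun k _ => by rw [pd_add hx.1 hx'.1]; ring

lemma formA0_add_right (hΩ : IsOpen Ω) (hΩb : Bornology.IsBounded Ω)
    (hcoef : IsCoeff Ω a b c) {v w w' : Pt d → ℝ} (hv : v ∈ tame Ω) (hw : w ∈ tame Ω)
    (hw' : w' ∈ tame Ω) : formA0 Ω a b v (w + w') = formA0 Ω a b v w + formA0 Ω a b v w' := by
  rw [formA0, formA0, formA0, ← integral_add (integrableOn_formA0 hΩ hΩb hcoef hv hw)
    (integrableOn_formA0 hΩ hΩb hcoef hv hw')]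
  obtain ⟨G, hG⟩ := hw.2
  obtain ⟨G', hG'⟩ := hw'.2
  refine integral_congr_ae ?_
  filter_upwards [hG, hG'] with x hx hx'
  rw [← Finset.sum_add_distrib]
  exact Finset.sum_congr rfl fun k _ => by rw [pd_add hx.1 hx'.1, Pi.add_apply]; ring

lemma formA0_smul_left (r : ℝ) {v w : Pt d → ℝ} (hv : v ∈ tame Ω) :
    formA0 Ω a b (r • v) w = r * formA0 Ω a b v w := by
  rw [formA0, formA0, ← integral_const_mul]
  obtain ⟨G, hG⟩ := hv.2
  refine integral_congr_ae ?_
  filter_upwards [hG] with x hx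
  rw [Finset.mul_sum]
  exact Finset.sum_congr rfl fun k _ => by rw [pd_smul hx.1]; ring

lemma formA0_smul_right (r : ℝ) {v w : Pt d → ℝ} (hw : w ∈ tame Ω) :
    formA0 Ω a b v (r • w) = r * formA0 Ω a b v w := by
  rw [formA0, formA0, ← integral_const_mul]
  obtain ⟨G, hG⟩ := hw.2
  refine integral_congr_ae ?_
  filter_upwards [hG] with x hx
  rw [Finset.mul_sum]
  exact Finset.sum_congr rfl fun k _ => by
    rw [pd_smul hx.1, Pi.smul_apply, smul_eq_mul]; ring

lemma formAh_add_left (hΩ : IsOpen Ω) (hΩb : Bornology.IsBounded Ω)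
    (hcoef : IsCoeff Ω a b c) {v v' w : Pt d → ℝ} (hv : v ∈ tame Ω) (hv' : v' ∈ tame Ω)
    (hw : w ∈ tame Ω) : formAh q a b c (v + v') w = formAh q a b c v w + formAh q a b c v' w := by
  have hc := mem_cb_of_continuousOn_closure hΩb hcoef.c_cont
  have h := ip_add_left (q := q) hΩ (integrableOn_mul_of_mem_cb hΩ hΩb hc hv.1)
    (integrableOn_mul_of_mem_cb hΩ hΩb hc hv'.1) hw.1
  have e : (fun x => c x * (v + v') x) = (fun x => c x * v x) + fun x => c x * v' x := by
    ext x; simp [mul_add]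
  rw [formAh, formAh, formAh, formA0_add_left hΩ hΩb hcoef hv hv' hw, e, h]; ring

lemma formAh_add_right (hΩ : IsOpen Ω) (hΩb : Bornology.IsBounded Ω)
    (hcoef : IsCoeff Ω a b c) {v w w' : Pt d → ℝ} (hv : v ∈ tame Ω) (hw : w ∈ tame Ω)
    (hw' : w' ∈ tame Ω) :
    formAh q a b c v (w + w') = formAh q a b c v w + formAh q a b c v w' := by
  have hc := mem_cb_of_continuousOn_closure hΩb hcoef.c_cont
  rw [formAh, formAh, formAh, formA0_add_right hΩ hΩb hcoef hv hw hw',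
    ip_add_right hΩ (integrableOn_mul_of_mem_cb hΩ hΩb hc hv.1) hw.1 hw'.1]; ring

lemma formAh_smul_left (r : ℝ) {v w : Pt d → ℝ} (hv : v ∈ tame Ω) :
    formAh q a b c (r • v) w = r * formAh q a b c v w := by
  have e : (fun x => c x * (r • v) x) = r • fun x => c x * v x := by
    ext x; simp [mul_left_comm]
  rw [formAh, formAh, formA0_smul_left r hv, e, ip_smul_left]; ring

lemma formAh_smul_right (r : ℝ) {v w : Pt d → ℝ} (hw : w ∈ tame Ω) :
    formAh q a b c v (r • w) = r * formAh q a b c v w := by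
  rw [formAh, formAh, formA0_smul_right r hw, ip_smul_right]; ring

end forms

/-! ### Coercivity for the exact inner product -/

/-- A continuous function that is Lipschitz on each member of a finite closed cover is Lipschitz:
along a segment its right slopes are bounded. -/
lemma lipschitzWith_of_finite_closed_cover {E ι : Type*} [NormedAddCommGroup E] [NormedSpace ℝ E]
    {s : Finset ι} {F : ι → Set E} (hF : ∀ i ∈ s, IsClosed (F i)) (hcov : ∀ x, ∃ i ∈ s, x ∈ F i)
    {f : E → ℝ} (hf : Continuous f) {L : ℝ≥0} (hL : ∀ i ∈ s, LipschitzOnWith L f (F i)) :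
    LipschitzWith L f := by
  have key : ∀ x y, f y ≤ f x + L * ‖y - x‖ := by
    intro x y
    set γ : ℝ → E := fun s => x + s • (y - x) with hγ
    have hγc : Continuous γ := by fun_prop
    have h := image_le_of_liminf_slope_right_le_deriv_boundary (f := fun s => f (γ s)) (a := 0)
      (b := 1) (B := fun s => f x + (L * ‖y - x‖) * s) (B' := fun _ => L * ‖y - x‖)
      (hf.comp hγc).continuousOn (by simp [hγ]) (by fun_prop)
      (fun s _ => by
        simpa using ((hasDerivAt_id s).const_mul (L * ‖y - x‖)).const_add (f x)
          |>.hasDerivWithinAt)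
      (fun σ _ r hr => ?_) (right_mem_Icc.2 zero_le_one)
    · simpa [hγ] using h
    · obtain ⟨i, hi, hfreq⟩ : ∃ i ∈ s, ∃ᶠ z in nhdsWithin σ (Ioi σ), γ z ∈ F i := by
        by_contra! hno
        have h1 : ∀ᶠ z in nhdsWithin σ (Ioi σ), ∀ i ∈ s, γ z ∉ F i := by
          rw [Filter.eventually_all_finset]
          exact fun i hi => hno i hi
        obtain ⟨z, hz⟩ := h1.exists
        obtain ⟨i, hi, hzi⟩ := hcov (γ z)
        exact hz i hi hzi
      have hσ : γ σ ∈ F i := (hF i hi).mem_of_frequently_of_tendsto hfreq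
        ((hγc.tendsto σ).mono_left nhdsWithin_le_nhds)
      refine (hfreq.and_eventually self_mem_nhdsWithin).mono fun z hz => ?_
      have hzσ : 0 < z - σ := sub_pos.2 hz.2
      have h1 := (hL i hi).norm_sub_le hz.1 hσ
      have h2 : γ z - γ σ = (z - σ) • (y - x) := by simp only [hγ, sub_smul]; abel
      rw [h2, norm_smul, Real.norm_of_nonneg hzσ.le] at h1
      rw [slope_def_field, div_lt_iff₀ hzσ]
      calc f (γ z) - f (γ σ) ≤ L * ((z - σ) * ‖y - x‖) := (le_abs_self _).trans h1
        _ = L * ‖y - x‖ * (z - σ) := by ring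
        _ < r * (z - σ) := by gcongr
  refine LipschitzWith.of_dist_le_mul fun x y => ?_
  rw [Real.dist_eq, dist_eq_norm, abs_le]
  have h1 := key x y
  have h2 := key y x
  rw [norm_sub_rev y x] at h1
  constructor <;> linarith

namespace Triangulation

variable {d : ℕ} {Ω : Set (Pt d)} {𝒯 : Triangulation Ω} {ℓ : ℕ} {v : Pt d → ℝ}

lemma exists_lipschitzWith (hΩ : IsOpen Ω) (hv : v ∈ 𝒯.feSpace ℓ) : ∃ L, LipschitzWith L v := by
  classical
  have hcell : ∀ K ∈ 𝒯.cells, ∃ L, LipschitzOnWith L v (convexHull ℝ (K : Set (Pt d))) := by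
    intro K hK
    obtain ⟨P, -, hP⟩ := hv.2.1 K hK
    obtain ⟨L, hL⟩ := (contDiff_eval P).contDiffOn.exists_lipschitzOnWith (by norm_num)
      (convex_convexHull ℝ (K : Set (Pt d))) (isCompact_cell K)
    exact ⟨L, fun x hx y hy => by rw [hP x hx, hP y hy]; exact hL hx hy⟩
  choose! L hL using hcell
  refine ⟨∑ K ∈ 𝒯.cells, L K, lipschitzWith_of_finite_closed_cover
    (s := Finset.insertNone 𝒯.cells)
    (F := fun i => i.elim Ωᶜ fun K => convexHull ℝ (K : Set (Pt d))) ?_ ?_ hv.1 ?_⟩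
  · rintro (_ | K) _
    · exact hΩ.isClosed_compl
    · exact (isCompact_cell K).isClosed
  · intro x
    by_cases hx : x ∈ Ω
    · obtain ⟨K, hK, hxK⟩ := 𝒯.exists_cell (subset_closure hx)
      exact ⟨some K, by simpa using hK, hxK⟩
    · exact ⟨none, by simp, hx⟩
  · rintro (_ | K) hK
    · intro x hx y hy
      rw [hv.2.2 x hx, hv.2.2 y hy]; simp
    · have hK : K ∈ 𝒯.cells := by simpa using hK
      exact (hL K hK).weaken (Finset.single_le_sum (fun _ _ => zero_le) hK)

lemma mul_self_mem_feSpace (hv : v ∈ 𝒯.feSpace ℓ) :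
    (fun x => v x * v x) ∈ 𝒯.feSpace (ℓ + ℓ) := by
  refine ⟨hv.1.mul hv.1, fun K hK => ?_, fun x hx => by simp [hv.2.2 x hx]⟩
  obtain ⟨P, hP, hP'⟩ := hv.2.1 K hK
  exact ⟨P * P, (MvPolynomial.totalDegree_mul P P).trans (add_le_add hP hP),
    fun x hx => by simp [hP' x hx]⟩

end Triangulation

lemma pd_eq_zero_of_isLocalMin {d : ℕ} {v : Pt d → ℝ} {x : Pt d} (h : IsLocalMin v x) (k : Fin d) :
    pd k v x = 0 := by
  simp [pd, h.fderiv_eq_zero]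

/-- A smooth cutoff of a `C^1` coefficient. -/
lemma exists_cutoff {d : ℕ} {Ω S : Set (Pt d)} (hΩ : IsOpen Ω) (hS : IsCompact S) (hSΩ : S ⊆ Ω) :
    ∃ χ : Pt d → ℝ, (∀ x ∈ S, χ x = 1) ∧ ∀ b : Pt d → ℝ, ContDiffOn ℝ 1 b Ω →
      ContDiff ℝ 1 (fun x => χ x * b x) ∧ HasCompactSupport (fun x => χ x * b x) := by
  obtain ⟨t, ht, hSt, htΩ⟩ := exists_compact_between hS hΩ hSΩ
  obtain ⟨f, hf1, hf0, -⟩ := exists_contMDiffMap_one_nhds_of_subset_interior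
    (n := (⊤ : ℕ∞)) (modelWithCornersSelf ℝ (Pt d)) hS.isClosed hSt
  refine ⟨f, fun x hx => hf1.self_of_nhdsSet x hx, fun b hb => ⟨?_, ?_⟩⟩
  · rw [contDiff_iff_contDiffAt]
    intro x
    by_cases hx : x ∈ Ω
    · have h1 : ContDiff ℝ 1 f := (f.contMDiff.contDiff).of_le (by exact_mod_cast le_top)
      exact h1.contDiffAt.mul (hb.contDiffAt (hΩ.mem_nhds hx))
    · have hxt : x ∈ tᶜ := fun h => hx (htΩ h)
      refine (contDiffAt_const (c := (0 : ℝ))).congr_of_eventuallyEq ?_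
      filter_upwards [ht.isClosed.isOpen_compl.mem_nhds hxt] with y hy
      rw [hf0 y hy, zero_mul]
  · refine HasCompactSupport.intro ht fun x hx => ?_
    rw [hf0 x hx, zero_mul]

section coercive

variable {d : ℕ} {Ω : Set (Pt d)} {𝒯 : Triangulation Ω} {ℓ : ℕ} {a b : Fin d → Pt d → ℝ}
  {c : Pt d → ℝ} {ζ : Pt d → ℝ}

/-- Integration by parts in the convection term for the truncation `max (ζ - ε) 0` of a nonnegative
finite element function; the truncation is supported in a compact subset of `Ω`, where the
coefficients are `C^1`. -/
lemma integral_convection_truncated (hΩ : IsOpen Ω) (hΩb : Bornology.IsBounded Ω)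
    (hcoef : IsCoeff Ω a b c) (hsign : ∀ x ∈ Ω, 0 ≤ c x - 1 / 2 * ∑ k, pd k (b k) x)
    (hζ : ζ ∈ 𝒯.feSpace ℓ) {ε : ℝ} (hε : 0 < ε) :
    -2 * ∫ x in Ω, c x * max (ζ x - ε) 0
      ≤ ∫ x in Ω, {x | ε < ζ x}.indicator (fun x => ∑ k, b k x * pd k ζ x) x := by
  set φ : Pt d → ℝ := fun x => max (ζ x - ε) 0 with hφ
  set U : Set (Pt d) := {x | ε < ζ x} with hU
  have hUo : IsOpen U := isOpen_lt continuous_const hζ.1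
  set S : Set (Pt d) := {x | ε ≤ ζ x} with hSdef
  have hUS : U ⊆ S := fun x (hx : ε < ζ x) => hx.le
  have hSΩ : S ⊆ Ω := fun x hx => by
    by_contra hn
    have : ε ≤ ζ x := hx
    rw [hζ.2.2 x hn] at this
    linarith
  have hSc : IsCompact S :=
    Metric.isCompact_of_isClosed_isBounded (isClosed_le continuous_const hζ.1) (hΩb.subset hSΩ)
  have hφU : ∀ x, x ∉ U → φ x = 0 := fun x hx => max_eq_right (by
    have : ¬ ε < ζ x := hx
    linarith)
  have hφ0 : ∀ x, 0 ≤ φ x := fun x => le_max_right _ _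
  have hφc : Continuous φ := (hζ.1.sub continuous_const).max continuous_const
  have hφsupp : HasCompactSupport φ := HasCompactSupport.intro hSc fun x hx =>
    hφU x fun h => hx (hUS h)
  obtain ⟨L, hL⟩ := Triangulation.exists_lipschitzWith hΩ hζ
  have hφL : LipschitzWith L φ := by
    have h1 : LipschitzWith L fun x => ζ x - ε := LipschitzWith.of_dist_le_mul fun x y => by
      simpa [Real.dist_eq] using hL.dist_le_mul x y
    exact h1.max_const 0
  obtain ⟨χ, hχ1, hχ⟩ := exists_cutoff hΩ hSc hSΩ
  -- the gradient of the truncation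
  have hpdφ : ∀ k x, χ x * b k x * pd k φ x = U.indicator (fun x => b k x * pd k ζ x) x := by
    intro k x
    by_cases hx : x ∈ U
    · rw [indicator_of_mem hx, hχ1 x (hUS hx), one_mul]
      have he : φ =ᶠ[nhds x] fun y => ζ y - ε := by
        filter_upwards [hUo.mem_nhds hx] with y hy
        exact max_eq_left (by have : ε < ζ y := hy; linarith)
      rw [pd_congr he, pd, fderiv_sub_const, ← pd]
    · rw [indicator_of_notMem hx, pd_eq_zero_of_isLocalMin, mul_zero]
      exact .of_forall fun y => by rw [hφU x hx]; exact hφ0 y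
  have hpdb : ∀ k x, pd k (fun x => χ x * b k x) x * φ x = pd k (b k) x * φ x := by
    intro k x
    by_cases hx : x ∈ U
    · have he : (fun x => χ x * b k x) =ᶠ[nhds x] b k := by
        filter_upwards [hUo.mem_nhds hx] with y hy
        rw [hχ1 y (hUS hy), one_mul]
      rw [pd_congr he]
    · rw [hφU x hx]; ring
  have hbi : ∀ k, Integrable (fun x => pd k (b k) x * φ x) := by
    intro k
    have h1 : Continuous (pd k fun x => χ x * b k x) :=
      ((hχ _ (hcoef.b_smooth k)).1.continuous_fderiv (by norm_num)).clm_apply continuous_const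
    simp only [← hpdb]
    exact (h1.mul hφc).integrable_of_hasCompactSupport hφsupp.mul_left
  have hζi : ∀ k, IntegrableOn (fun x => b k x * pd k ζ x) Ω := fun k =>
    integrableOn_cb_mul_pd hΩ hΩb (mem_cb_of_continuousOn_closure hΩb (hcoef.b_cont k))
      (Triangulation.feSpace_mem_tame hΩ hΩb hζ) k
  have hUΩ : U ⊆ Ω := hUS.trans hSΩ
  have hparts : ∀ k, ∫ x in Ω, U.indicator (fun x => b k x * pd k ζ x) x
      = -∫ x in Ω, pd k (b k) x * φ x := by
    intro k
    obtain ⟨hsm, hcs⟩ := hχ _ (hcoef.b_smooth k)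
    obtain ⟨L', hL'⟩ := hsm.lipschitzWith_of_hasCompactSupport hcs (by norm_num)
    have h := LipschitzWith.integral_lineDeriv_mul_eq (μ := volume) hL' hφL hφsupp
      (EuclideanSpace.single k (1 : ℝ))
    have e1 : ∫ x, lineDeriv ℝ (fun x => χ x * b k x) x (EuclideanSpace.single k 1) * φ x
        = ∫ x, pd k (b k) x * φ x := by
      refine integral_congr_ae (.of_forall fun x => ?_)
      change lineDeriv ℝ (fun x => χ x * b k x) x (EuclideanSpace.single k 1) * φ x
        = pd k (b k) x * φ x
      rw [← hpdb k x, pd, (hsm.differentiable (by norm_num) x).lineDeriv_eq_fderiv]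
    have e2 : ∫ x, lineDeriv ℝ φ x (-EuclideanSpace.single k 1) * (χ x * b k x)
        = -∫ x, U.indicator (fun x => b k x * pd k ζ x) x := by
      rw [← integral_neg]
      refine integral_congr_ae ?_
      filter_upwards [hφL.ae_differentiableAt] with x hx
      rw [← hpdφ k x, lineDeriv_neg, hx.lineDeriv_eq_fderiv, pd]
      ring
    rw [e1, e2] at h
    rw [setIntegral_eq_integral_of_forall_compl_eq_zero, setIntegral_eq_integral_of_forall_compl_eq_zero,
      h, neg_neg]
    · intro x hx; rw [hφU x fun h => hx (hUΩ h), mul_zero]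
    · intro x hx; exact indicator_of_notMem (fun h => hx (hUΩ h)) _
  have e3 : ∀ x, U.indicator (fun x => ∑ k, b k x * pd k ζ x) x
      = ∑ k, U.indicator (fun x => b k x * pd k ζ x) x := by
    intro x
    by_cases hx : x ∈ U <;> simp [hx]
  simp only [e3]
  rw [integral_finsetSum _ fun k _ => (hζi k).indicator hUo.measurableSet]
  simp only [hparts]
  rw [Finset.sum_neg_distrib, ← integral_finsetSum _ fun k _ => (hbi k).integrableOn]
  have hcφ : IntegrableOn (fun x => c x * φ x) Ω := by
    refine integrableOn_mul_of_mem_cb hΩ hΩb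
      (mem_cb_of_continuousOn_closure hΩb hcoef.c_cont)
      (mem_cb_of_continuousOn_closure hΩb hφc.continuousOn)
  have hle : ∫ x in Ω, ∑ k, pd k (b k) x * φ x ≤ ∫ x in Ω, 2 * (c x * φ x) := by
    refine setIntegral_mono_on (integrable_finsetSum _ fun k _ => (hbi k).integrableOn)
      (hcφ.const_mul 2) hΩ.measurableSet fun x hx => ?_
    rw [← Finset.sum_mul]
    have := mul_nonneg (hsign x hx) (hφ0 x)
    linarith
  rw [integral_const_mul] at hle
  linarith

/-- The convection term and the zero-order term are together nonnegative on nonnegative finite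
element functions, although the divergence of `b` need not be integrable. -/
lemma integral_convection_ge (hΩ : IsOpen Ω) (hΩb : Bornology.IsBounded Ω)
    (hcoef : IsCoeff Ω a b c) (hsign : ∀ x ∈ Ω, 0 ≤ c x - 1 / 2 * ∑ k, pd k (b k) x)
    (hζ : ζ ∈ 𝒯.feSpace ℓ) (hζ0 : ∀ x, 0 ≤ ζ x) :
    -2 * ∫ x in Ω, c x * ζ x ≤ ∫ x in Ω, ∑ k, b k x * pd k ζ x := by
  have hgi : IntegrableOn (fun x => ∑ k, b k x * pd k ζ x) Ω := integrable_finsetSum _ fun k _ =>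
    integrableOn_cb_mul_pd hΩ hΩb (mem_cb_of_continuousOn_closure hΩb (hcoef.b_cont k))
      (Triangulation.feSpace_mem_tame hΩ hΩb hζ) k
  have hc := mem_cb_of_continuousOn_closure hΩb hcoef.c_cont
  have hζcb := Triangulation.feSpace_mem_cb hΩ hΩb hζ
  have hε : ∀ n : ℕ, 0 < 1 / ((n : ℝ) + 1) := fun n => by positivity
  have hlim := tendsto_one_div_add_atTop_nhds_zero_nat (𝕜 := ℝ)
  have h1 : Filter.Tendsto (fun n : ℕ => ∫ x in Ω, c x * max (ζ x - 1 / ((n : ℝ) + 1)) 0)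
      Filter.atTop (nhds (∫ x in Ω, c x * ζ x)) := by
    refine tendsto_integral_of_dominated_convergence (fun x => |c x * ζ x|) (fun n => ?_)
      (integrableOn_mul_of_mem_cb hΩ hΩb hc hζcb).abs (fun n => .of_forall fun x => ?_)
      (.of_forall fun x => ?_)
    · exact (aesm_of_mem_cb hΩ hc).mul
        ((hζ.1.sub continuous_const).max continuous_const).aestronglyMeasurable
    · rw [Real.norm_eq_abs, abs_mul, abs_mul, abs_of_nonneg (hζ0 x),
        abs_of_nonneg (le_max_right (ζ x - 1 / ((n : ℝ) + 1)) 0)]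
      have : max (ζ x - 1 / ((n : ℝ) + 1)) 0 ≤ ζ x := max_le (by linarith [hε n]) (hζ0 x)
      gcongr
    · have h2 : Filter.Tendsto (fun n : ℕ => max (ζ x - 1 / ((n : ℝ) + 1)) 0) Filter.atTop
          (nhds (max (ζ x - 0) 0)) := (tendsto_const_nhds.sub hlim).max tendsto_const_nhds
      rw [sub_zero, max_eq_left (hζ0 x)] at h2
      exact tendsto_const_nhds.mul h2
  have h2 : Filter.Tendsto (fun n : ℕ => ∫ x in Ω, {x | 1 / ((n : ℝ) + 1) < ζ x}.indicator
      (fun x => ∑ k, b k x * pd k ζ x) x) Filter.atTop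
      (nhds (∫ x in Ω, ∑ k, b k x * pd k ζ x)) := by
    refine tendsto_integral_of_dominated_convergence (fun x => |∑ k, b k x * pd k ζ x|)
      (fun n => ?_) hgi.abs (fun n => .of_forall fun x => ?_) (.of_forall fun x => ?_)
    · exact hgi.aestronglyMeasurable.indicator (isOpen_lt continuous_const hζ.1).measurableSet
    · exact norm_indicator_le_norm_self _ _
    · rcases (hζ0 x).eq_or_lt with h | h
      · -- at a zero of `ζ`, its minimum, the gradient vanishes
        have hz : ∑ k, b k x * pd k ζ x = 0 := Finset.sum_eq_zero fun k _ => by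
          rw [pd_eq_zero_of_isLocalMin, mul_zero]
          exact .of_forall fun y => by rw [← h]; exact hζ0 y
        refine tendsto_const_nhds.congr fun n => ?_
        rw [indicator_of_notMem, hz]
        intro hx
        have : 1 / ((n : ℝ) + 1) < ζ x := hx
        rw [← h] at this
        exact absurd (hε n) (by linarith)
      · refine tendsto_const_nhds.congr' ?_
        filter_upwards [hlim.eventually_lt_const h] with n hn
        have hx : x ∈ {x | 1 / ((n : ℝ) + 1) < ζ x} := hn
        rw [indicator_of_mem hx]
  exact le_of_tendsto_of_tendsto' (h1.const_mul (-2)) h2 fun n =>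
    integral_convection_truncated hΩ hΩb hcoef hsign hζ (hε n)

lemma formAh_self_nonneg (hΩ : IsOpen Ω) (hΩb : Bornology.IsBounded Ω)
    (hcoef : IsCoeff Ω a b c) (hsign : ∀ x ∈ Ω, 0 ≤ c x - 1 / 2 * ∑ k, pd k (b k) x)
    {v : Pt d → ℝ} (hv : v ∈ 𝒯.feSpace ℓ) :
    0 ≤ formAh (none : Option (Quadrature 𝒯)) a b c v v := by
  have hvt := Triangulation.feSpace_mem_tame hΩ hΩb hv
  have hζ := Triangulation.mul_self_mem_feSpace hv
  have h1 := integral_convection_ge hΩ hΩb hcoef hsign hζ fun x => mul_self_nonneg _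
  have hgi : IntegrableOn (fun x => ∑ k, b k x * pd k (fun x => v x * v x) x) Ω :=
    integrable_finsetSum _ fun k _ =>
      integrableOn_cb_mul_pd hΩ hΩb (mem_cb_of_continuousOn_closure hΩb (hcoef.b_cont k))
        (Triangulation.feSpace_mem_tame hΩ hΩb hζ) k
  obtain ⟨G, hG⟩ := hvt.2
  have h2 : ∫ x in Ω, 1 / 2 * ∑ k, b k x * pd k (fun x => v x * v x) x
      ≤ formA0 Ω a b v v := by
    refine integral_mono_ae (hgi.const_mul _) (integrableOn_formA0 hΩ hΩb hcoef hvt hvt) ?_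
    filter_upwards [hG, ae_restrict_mem hΩ.measurableSet] with x hx hxΩ
    change 1 / 2 * ∑ k, b k x * pd k (fun x => v x * v x) x
      ≤ ∑ k, (a k x * pd k v x * pd k v x + b k x * pd k v x * v x)
    rw [Finset.mul_sum]
    refine Finset.sum_le_sum fun k _ => ?_
    have hd : pd k (fun x => v x * v x) x = 2 * (v x * pd k v x) := by
      simp only [pd]
      rw [fderiv_fun_mul hx.1 hx.1]
      simp; ring
    have hpos := hcoef.a_pos k x (subset_closure hxΩ)
    rw [hd]
    nlinarith [mul_nonneg hpos.le (mul_self_nonneg (pd k v x))]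
  have h3 : ip (none : Option (Quadrature 𝒯)) (fun x => c x * v x) v
      = ∫ x in Ω, c x * (v x * v x) := by simp only [ip, mul_assoc]
  rw [integral_const_mul] at h2
  rw [formAh, h3]
  linarith

/-- The energy estimate for a single time step. -/
lemma stable_of_exact (hΩ : IsOpen Ω) (hΩb : Bornology.IsBounded Ω)
    (hcoef : IsCoeff Ω a b c) (hsign : ∀ x ∈ Ω, 0 ≤ c x - 1 / 2 * ∑ k, pd k (b k) x)
    {κ : ℝ} {e H : Pt d → ℝ} (he : e ∈ 𝒯.feSpace ℓ) (hH : H ∈ cb Ω)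
    (h : κ * ip (none : Option (Quadrature 𝒯)) e e + formAh (none : Option (Quadrature 𝒯)) a b c e e
      = ip (none : Option (Quadrature 𝒯)) H e) :
    κ * nn Ω 2 e ≤ nn Ω 2 H := by
  have hecb := Triangulation.feSpace_mem_cb hΩ hΩb he
  have h1 := formAh_self_nonneg hΩ hΩb hcoef hsign he
  have h2 : ip (none : Option (Quadrature 𝒯)) H e ≤ nn Ω 2 H * nn Ω 2 e :=
    integral_mul_le_nn hΩ hΩb hH hecb
  have h3 : ip (none : Option (Quadrature 𝒯)) e e = nn Ω 2 e ^ 2 :=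
    integral_mul_self_eq hΩ hΩb hecb
  rw [h3] at h
  rcases (nn_nonneg (Ω := Ω) (p := 2) e).eq_or_lt with h0 | h0
  · rw [← h0, mul_zero]; exact nn_nonneg _
  · refine le_of_mul_le_mul_right ?_ h0
    linarith

end coercive

/-! ### Piecewise linear functions and hat functions -/

section affine

variable {d : ℕ}

lemma affineMap_sum_smul (A : Pt d →ᵃ[ℝ] ℝ) {ι : Type*} (s : Finset ι) (w : ι → ℝ) (y : ι → Pt d)
    (hw : ∑ i ∈ s, w i = 1) : A (∑ i ∈ s, w i • y i) = ∑ i ∈ s, w i * A (y i) := by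
  have h : ∀ x, A x = A.linear x + A 0 := fun x => by
    simpa using congrFun A.decomp x
  rw [h, map_sum, Finset.sum_congr rfl fun i _ => show w i * A (y i)
    = A.linear (w i • y i) + w i * A 0 by rw [h (y i), map_smul, smul_eq_mul]; ring,
    Finset.sum_add_distrib, ← Finset.sum_mul, hw, one_mul]

lemma exists_affineMap_of_totalDegree_le_one {P : MvPolynomial (Fin d) ℝ}
    (hP : P.totalDegree ≤ 1) :
    ∃ A : Pt d →ᵃ[ℝ] ℝ, ∀ x : Pt d, MvPolynomial.eval (fun i => x i) P = A x := by
  classical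
  let l : Pt d →ₗ[ℝ] ℝ := ∑ i, P.coeff (Finsupp.single i 1) •
    (EuclideanSpace.proj i : Pt d →L[ℝ] ℝ).toLinearMap
  refine ⟨l.toAffineMap + AffineMap.const ℝ _ (P.coeff 0), fun x => ?_⟩
  have hl : l x = ∑ i, P.coeff (Finsupp.single i 1) * x i := by simp [l]
  have hsub : P.support ⊆ insert 0 (Finset.univ.image fun i : Fin d => Finsupp.single i 1) := by
    intro m hm
    have h1 := (MvPolynomial.le_totalDegree hm).trans hP
    rcases Nat.le_one_iff_eq_zero_or_eq_one.1 h1 with h | h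
    · simp [show m = 0 from (Finsupp.degree_eq_zero_iff m).1 h]
    · obtain ⟨i, rfl⟩ := (Finsupp.sum_eq_one_iff m).1 h
      simp
  rw [MvPolynomial.eval_eq', Finset.sum_subset hsub fun m _ hm => by
    rw [MvPolynomial.notMem_support_iff.1 hm, zero_mul], Finset.sum_insert (by simp),
    Finset.sum_image fun i _ j _ h => by
      exact Finsupp.single_left_injective one_ne_zero h]
  simp only [AffineMap.coe_add, Pi.add_apply, LinearMap.coe_toAffineMap, AffineMap.const_apply, hl]
  rw [add_comm]
  congr 1
  · refine Finset.sum_congr rfl fun i _ => ?_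
    congr 1
    rw [Finset.prod_eq_single i] <;> simp +contextual [eq_comm]
  · simp

lemma exists_mvPolynomial_of_affineMap (A : Pt d →ᵃ[ℝ] ℝ) :
    ∃ P : MvPolynomial (Fin d) ℝ, P.totalDegree ≤ 1 ∧
      ∀ x : Pt d, A x = MvPolynomial.eval (fun i => x i) P := by
  refine ⟨MvPolynomial.C (A 0) + ∑ i, MvPolynomial.C (A.linear (EuclideanSpace.single i 1)) *
    MvPolynomial.X i, ?_, fun x => ?_⟩
  · refine (MvPolynomial.totalDegree_add _ _).trans (max_le (by simp) ?_)
    refine MvPolynomial.totalDegree_finsetSum_le fun i _ => ?_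
    refine (MvPolynomial.totalDegree_mul _ _).trans ?_
    simp
  · have h : A x = A.linear x + A 0 := by simpa using congrFun A.decomp x
    have hx : x = ∑ i, x i • EuclideanSpace.single i (1 : ℝ) := by
      ext j; simp [Pi.single_apply]
    rw [h]
    conv_lhs => rw [hx, map_sum]
    simp [mul_comm, add_comm]

end affine

namespace Triangulation

variable {d : ℕ} {Ω : Set (Pt d)} {𝒯 : Triangulation Ω}

lemma piecewisePoly_one_iff {v : Pt d → ℝ} : 𝒯.PiecewisePoly 1 v ↔
    ∀ K ∈ 𝒯.cells, ∃ A : Pt d →ᵃ[ℝ] ℝ, ∀ x ∈ convexHull ℝ (K : Set (Pt d)), v x = A x := by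
  refine ⟨fun h K hK => ?_, fun h K hK => ?_⟩
  · obtain ⟨P, hP, hv⟩ := h K hK
    obtain ⟨A, hA⟩ := exists_affineMap_of_totalDegree_le_one hP
    exact ⟨A, fun x hx => by rw [hv x hx, hA]⟩
  · obtain ⟨A, hA⟩ := h K hK
    obtain ⟨P, hP, hPA⟩ := exists_mvPolynomial_of_affineMap A
    exact ⟨P, hP, fun x hx => by rw [hA x hx, hPA]⟩

/-- The vertices of a cell as an affine basis. -/
def affBasis (𝒯 : Triangulation Ω) {K : Finset (Pt d)} (hK : K ∈ 𝒯.cells) :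
    AffineBasis K ℝ (Pt d) where
  toFun := fun z => z
  ind' := 𝒯.indep K hK
  tot' := by
    rw [(𝒯.indep K hK).affineSpan_eq_top_iff_card_eq_finrank_add_one]
    simp [𝒯.card_eq K hK]

open Classical in
/-- The barycentric coordinate of the vertex `z` on the cell `K`, as an affine function on the whole
space; it is zero if `z` is not a vertex of `K`. -/
noncomputable def bary (𝒯 : Triangulation Ω) (K : Finset (Pt d)) (z : Pt d) : Pt d →ᵃ[ℝ] ℝ :=
  if h : K ∈ 𝒯.cells ∧ z ∈ K then (𝒯.affBasis h.1).coord ⟨z, h.2⟩ else 0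

variable {K L : Finset (Pt d)} {x z : Pt d}

lemma bary_of_notMem (hz : z ∉ K) : 𝒯.bary K z = 0 := by simp [bary, hz]

lemma bary_of_mem (hK : K ∈ 𝒯.cells) (hz : z ∈ K) :
    𝒯.bary K z = (𝒯.affBasis hK).coord ⟨z, hz⟩ := by simp [bary, hK, hz]

open Classical in
lemma bary_node (hK : K ∈ 𝒯.cells) {z' : Pt d} (hz' : z' ∈ K) :
    𝒯.bary K z z' = if z = z' then 1 else 0 := by
  by_cases hz : z ∈ K
  · rw [bary_of_mem hK hz]
    have h := (𝒯.affBasis hK).coord_apply ⟨z, hz⟩ ⟨z', hz'⟩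
    have e : (𝒯.affBasis hK) ⟨z', hz'⟩ = z' := rfl
    rw [e] at h
    rw [h]; simp
  · rw [bary_of_notMem hz, if_neg (by rintro rfl; exact hz hz')]; rfl

lemma sum_bary (hK : K ∈ 𝒯.cells) (x : Pt d) : ∑ z ∈ K, 𝒯.bary K z x = 1 := by
  rw [← (𝒯.affBasis hK).sum_coord_apply_eq_one x, ← Finset.sum_coe_sort]
  exact Finset.sum_congr rfl fun i _ => by rw [bary_of_mem hK i.2]

lemma sum_bary_smul (hK : K ∈ 𝒯.cells) (x : Pt d) : ∑ z ∈ K, 𝒯.bary K z x • z = x := by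
  conv_rhs => rw [← (𝒯.affBasis hK).linear_combination_coord_eq_self x]
  rw [← Finset.sum_coe_sort]
  exact Finset.sum_congr rfl fun i _ => by rw [bary_of_mem hK i.2]; rfl

lemma mem_cell_iff (hK : K ∈ 𝒯.cells) :
    x ∈ convexHull ℝ (K : Set (Pt d)) ↔ ∀ z ∈ K, 0 ≤ 𝒯.bary K z x := by
  have h := (𝒯.affBasis hK).convexHull_eq_nonneg_coord
  have e : range (𝒯.affBasis hK) = (K : Set (Pt d)) := by
    change range (fun z : K => (z : Pt d)) = _
    simp
  rw [e] at h
  rw [h]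
  constructor
  · intro hx z hz
    rw [bary_of_mem hK hz]; exact hx ⟨z, hz⟩
  · intro hx i
    have := hx i i.2
    rwa [bary_of_mem hK i.2] at this

lemma bary_nonneg (hK : K ∈ 𝒯.cells) (hx : x ∈ convexHull ℝ (K : Set (Pt d))) (z : Pt d) :
    0 ≤ 𝒯.bary K z x := by
  by_cases hz : z ∈ K
  · exact (mem_cell_iff hK).1 hx z hz
  · rw [bary_of_notMem hz]; exact le_rfl

/-- Barycentric coordinates agree on the common face of two cells. -/
lemma bary_eq_bary (hK : K ∈ 𝒯.cells) (hL : L ∈ 𝒯.cells)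
    (hxK : x ∈ convexHull ℝ (K : Set (Pt d))) (hxL : x ∈ convexHull ℝ (L : Set (Pt d)))
    (z : Pt d) : 𝒯.bary K z x = 𝒯.bary L z x := by
  classical
  have hx : x ∈ convexHull ℝ ((K ∩ L : Finset (Pt d)) : Set (Pt d)) := by
    rw [Finset.coe_inter, ← 𝒯.conforming K hK L hL]; exact ⟨hxK, hxL⟩
  obtain ⟨w, -, hw1, rfl⟩ := Finset.mem_convexHull'.1 hx
  rw [affineMap_sum_smul _ _ _ _ hw1, affineMap_sum_smul _ _ _ _ hw1]
  refine Finset.sum_congr rfl fun y hy => ?_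
  rw [bary_node hK (Finset.mem_inter.1 hy).1, bary_node hL (Finset.mem_inter.1 hy).2]

open Classical in
/-- The piecewise linear hat function of the node `z`, extended by zero off the closed domain. -/
noncomputable def hat (𝒯 : Triangulation Ω) (z x : Pt d) : ℝ :=
  if h : x ∈ closure Ω then 𝒯.bary (𝒯.exists_cell h).choose z x else 0

lemma hat_eq (hK : K ∈ 𝒯.cells) (hx : x ∈ convexHull ℝ (K : Set (Pt d))) (z : Pt d) :
    𝒯.hat z x = 𝒯.bary K z x := by
  have h := 𝒯.mem_closure_of_mem_cell hK hx
  have hs := (𝒯.exists_cell h).choose_spec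
  rw [hat, dif_pos h]
  exact bary_eq_bary hs.1 hK hs.2 hx z

lemma hat_of_notMem (hx : x ∉ closure Ω) (z : Pt d) : 𝒯.hat z x = 0 := by
  rw [hat, dif_neg hx]

lemma hat_nonneg (𝒯 : Triangulation Ω) (z x : Pt d) : 0 ≤ 𝒯.hat z x := by
  by_cases hx : x ∈ closure Ω
  · obtain ⟨K, hK, hxK⟩ := 𝒯.exists_cell hx
    rw [hat_eq hK hxK]; exact bary_nonneg hK hxK z
  · rw [hat_of_notMem hx]

lemma piecewisePoly_hat (𝒯 : Triangulation Ω) (z : Pt d) : 𝒯.PiecewisePoly 1 (𝒯.hat z) :=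
  piecewisePoly_one_iff.2 fun K hK => ⟨𝒯.bary K z, fun _ hx => hat_eq hK hx z⟩

lemma isHat_hat (hz : z ∈ 𝒯.nodes) : 𝒯.IsHat z (𝒯.hat z) := by
  refine ⟨𝒯.piecewisePoly_hat z, ?_, ?_⟩
  · obtain ⟨K, hK, hzK⟩ := hz
    rw [hat_eq hK (subset_convexHull ℝ _ hzK), bary_node hK hzK, if_pos rfl]
  · rintro z' ⟨K, hK, hzK⟩ hne
    rw [hat_eq hK (subset_convexHull ℝ _ hzK), bary_node hK hzK, if_neg hne.symm]

open Classical in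
/-- The nodes as a finite set. -/
noncomputable def nodeFinset (𝒯 : Triangulation Ω) : Finset (Pt d) := 𝒯.cells.biUnion id

lemma mem_nodeFinset : z ∈ 𝒯.nodeFinset ↔ z ∈ 𝒯.nodes := by
  simp [nodeFinset, nodes]

lemma sum_hat_mul (hK : K ∈ 𝒯.cells) (hx : x ∈ convexHull ℝ (K : Set (Pt d))) (g : Pt d → ℝ) :
    ∑ z ∈ 𝒯.nodeFinset, g z * 𝒯.hat z x = ∑ z ∈ K, g z * 𝒯.bary K z x := by
  have hsub : K ⊆ 𝒯.nodeFinset := fun z hz => mem_nodeFinset.2 ⟨K, hK, hz⟩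
  rw [← Finset.sum_subset hsub fun z _ hz => by
    rw [hat_eq hK hx, bary_of_notMem hz]; simp]
  exact Finset.sum_congr rfl fun z _ => by rw [hat_eq hK hx]

lemma sum_hat (hx : x ∈ closure Ω) : ∑ z ∈ 𝒯.nodeFinset, 𝒯.hat z x = 1 := by
  obtain ⟨K, hK, hxK⟩ := 𝒯.exists_cell hx
  have h := sum_hat_mul hK hxK fun _ => 1
  simpa [sum_bary hK] using h

lemma PiecewisePoly.eq_sum_hat {v : Pt d → ℝ} (hv : 𝒯.PiecewisePoly 1 v) (hx : x ∈ closure Ω) :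
    v x = ∑ z ∈ 𝒯.nodeFinset, v z * 𝒯.hat z x := by
  obtain ⟨K, hK, hxK⟩ := 𝒯.exists_cell hx
  obtain ⟨A, hA⟩ := piecewisePoly_one_iff.1 hv K hK
  rw [sum_hat_mul hK hxK, hA x hxK]
  conv_lhs => rw [← sum_bary_smul hK x, affineMap_sum_smul A _ _ _ (sum_bary hK x)]
  exact Finset.sum_congr rfl fun z hz => by
    rw [hA z (subset_convexHull ℝ _ hz), mul_comm]

/-- The hat function of an interior node vanishes on the boundary. At a point `x` of a cell where it
is positive, contract towards `z` until the point lies in `Ω`. A neighbourhood of the contracted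
point is covered by cells that contain both this point and the vertex `z`, and undoing the
contraction does not leave these cells. -/
lemma mem_of_hat_pos (hΩ : IsOpen Ω) (hΩr : interior (closure Ω) = Ω) (hz : z ∈ Ω)
    (hx : 0 < 𝒯.hat z x) : x ∈ Ω := by
  have hxc : x ∈ closure Ω := by
    by_contra h
    rw [hat_of_notMem h] at hx; exact lt_irrefl _ hx
  obtain ⟨K, hK, hxK⟩ := 𝒯.exists_cell hxc
  rw [hat_eq hK hxK] at hx
  have hzK : z ∈ K := by
    by_contra h
    rw [bary_of_notMem h] at hx; exact lt_irrefl _ hx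
  -- the contraction
  obtain ⟨ε, hε0, hε1, hεΩ⟩ : ∃ ε : ℝ, 0 < ε ∧ ε ≤ 1 ∧ AffineMap.lineMap z x ε ∈ Ω := by
    have hc : ContinuousAt (fun s : ℝ => AffineMap.lineMap z x s) 0 :=
      AffineMap.lineMap_continuous.continuousAt
    have h1 : ∀ᶠ s in nhdsWithin (0 : ℝ) (Ioi 0), AffineMap.lineMap z x s ∈ Ω :=
      (hc.eventually_mem (by rw [AffineMap.lineMap_apply_zero]; exact hΩ.mem_nhds hz)).filter_mono
        nhdsWithin_le_nhds
    obtain ⟨ε, h2, h3⟩ := (h1.and (Ioc_mem_nhdsGT (zero_lt_one' ℝ))).exists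
    exact ⟨ε, h3.1, h3.2, h2⟩
  set p : Pt d := AffineMap.lineMap z x ε with hp
  have hpK : p ∈ convexHull ℝ (K : Set (Pt d)) :=
    (convex_convexHull ℝ _).lineMap_mem (subset_convexHull ℝ _ hzK) hxK ⟨hε0.le, hε1⟩
  have hlm : ∀ (A : Pt d →ᵃ[ℝ] ℝ) (y : Pt d),
      A (AffineMap.lineMap z y ε) = (1 - ε) * A z + ε * A y := by
    intro A y
    rw [AffineMap.apply_lineMap, AffineMap.lineMap_apply]
    simp; ring
  rw [← hΩr, mem_interior_iff_mem_nhds]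
  have hcont : Filter.Tendsto (fun y : Pt d => AffineMap.lineMap z y ε) (nhds x) (nhds p) := by
    have : Continuous fun y : Pt d => (AffineMap.lineMap z y ε : Pt d) := by
      simp only [AffineMap.lineMap_apply]; fun_prop
    exact this.tendsto x
  have h1 : ∀ᶠ y in nhds x, AffineMap.lineMap z y ε ∈ Ω :=
    hcont.eventually_mem (hΩ.mem_nhds hεΩ)
  have h2 : ∀ᶠ y in nhds x, ∀ L ∈ 𝒯.cells, p ∉ convexHull ℝ (L : Set (Pt d)) →
      AffineMap.lineMap z y ε ∉ convexHull ℝ (L : Set (Pt d)) := by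
    rw [Filter.eventually_all_finset]
    intro L _
    by_cases hpL : p ∈ convexHull ℝ (L : Set (Pt d))
    · exact .of_forall fun _ h => absurd hpL h
    · filter_upwards [hcont.eventually_mem ((isCompact_cell L).isClosed.isOpen_compl.mem_nhds hpL)]
        with y hy _ using hy
  have h3 : ∀ᶠ y in nhds x, ∀ L ∈ 𝒯.cells, p ∈ convexHull ℝ (L : Set (Pt d)) →
      z ∈ L ∧ 0 < 𝒯.bary L z y := by
    rw [Filter.eventually_all_finset]
    intro L hL
    by_cases hpL : p ∈ convexHull ℝ (L : Set (Pt d))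
    · have e := bary_eq_bary hK hL hpK hpL z
      have hpos : 0 < 𝒯.bary K z p := by
        rw [hp, hlm, bary_node hK hzK, if_pos rfl]
        have := mul_pos hε0 hx
        linarith
      have hzL : z ∈ L := by
        by_contra h
        rw [e, bary_of_notMem h] at hpos; exact lt_irrefl _ hpos
      rw [hp, hlm, hlm, bary_node hK hzK, bary_node hL hzL] at e
      have e' : 𝒯.bary K z x = 𝒯.bary L z x := mul_left_cancel₀ hε0.ne' (by linarith)
      have hc : Continuous (𝒯.bary L z) := (𝒯.bary L z).continuous_of_finiteDimensional
      filter_upwards [hc.continuousAt.eventually_const_lt (show (0 : ℝ) < 𝒯.bary L z x by rwa [← e'])]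
        with y hy _ using ⟨hzL, hy⟩
    · exact .of_forall fun _ h => absurd h hpL
  filter_upwards [h1, h2, h3] with y hy1 hy2 hy3
  obtain ⟨L, hL, hyL⟩ := 𝒯.exists_cell (subset_closure hy1)
  have hpL : p ∈ convexHull ℝ (L : Set (Pt d)) := by
    by_contra h; exact hy2 L hL h hyL
  obtain ⟨hzL, hzy⟩ := hy3 L hL hpL
  refine 𝒯.mem_closure_of_mem_cell hL ((mem_cell_iff hL).2 fun z' hz' => ?_)
  by_cases hzz : z' = z
  · rw [hzz]; exact hzy.le
  · have h4 := (mem_cell_iff hL).1 hyL z' hz'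
    rw [hlm, bary_node hL hzL, if_neg hzz] at h4
    have : 0 ≤ ε * 𝒯.bary L z' y := by linarith
    exact nonneg_of_mul_nonneg_right this hε0

lemma hat_mem_feSpace (hΩ : IsOpen Ω) (hΩr : interior (closure Ω) = Ω) (hz : z ∈ Ω) :
    𝒯.hat z ∈ 𝒯.feSpace 1 := by
  have h0 : ∀ x, x ∉ Ω → 𝒯.hat z x = 0 := fun x hx => by
    by_contra h
    exact hx (mem_of_hat_pos hΩ hΩr hz ((𝒯.hat_nonneg z x).lt_of_ne' h))
  refine ⟨?_, 𝒯.piecewisePoly_hat z, h0⟩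
  have h1 : ContinuousOn (𝒯.hat z) (closure Ω ∪ Ωᶜ) :=
    (𝒯.piecewisePoly_hat z).continuousOn.union_of_isClosed
      (continuousOn_const.congr fun x hx => h0 x hx) isClosed_closure hΩ.isClosed_compl
  rw [← continuousOn_univ]
  refine h1.mono fun x _ => ?_
  by_cases hx : x ∈ Ω
  · exact Or.inl (subset_closure hx)
  · exact Or.inr hx

end Triangulation

/-! ### The discrete maximum principle -/

section maxPrinciple

variable {d : ℕ} {Ω : Set (Pt d)} {𝒯 : Triangulation Ω} {q : Option (Quadrature 𝒯)}
  {a b : Fin d → Pt d → ℝ} {c : Pt d → ℝ}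

lemma ip_mono_left (hΩ : IsOpen Ω) (hΩb : Bornology.IsBounded Ω) {f g v : Pt d → ℝ}
    (hf : f ∈ cb Ω) (hg : g ∈ cb Ω) (hv : v ∈ cb Ω) (hfg : ∀ x ∈ Ω, f x ≤ g x)
    (hv0 : ∀ x, 0 ≤ v x) (hvΩ : ∀ x, x ∉ Ω → v x = 0) : ip q f v ≤ ip q g v := by
  cases q with
  | none =>
    exact setIntegral_mono_on (integrableOn_mul_of_mem_cb hΩ hΩb hf hv)
      (integrableOn_mul_of_mem_cb hΩ hΩb hg hv) hΩ.measurableSet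
      fun x hx => mul_le_mul_of_nonneg_right (hfg x hx) (hv0 x)
  | some Q =>
    refine Finset.sum_le_sum fun K hK => Finset.sum_le_sum fun y hy => ?_
    refine mul_le_mul_of_nonneg_left ?_ (Q.wt_pos K hK y hy).le
    by_cases hyΩ : y ∈ Ω
    · exact mul_le_mul_of_nonneg_right (hfg y hyΩ) (hv0 y)
    · rw [hvΩ y hyΩ]; simp

lemma formA0_congr_left (hΩ : IsOpen Ω) {v v' w : Pt d → ℝ} (h : ∀ x ∈ Ω, v x = v' x) :
    formA0 Ω a b v w = formA0 Ω a b v' w := by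
  refine setIntegral_congr_fun hΩ.measurableSet fun x hx => ?_
  have he : v =ᶠ[nhds x] v' := by filter_upwards [hΩ.mem_nhds hx] with y hy using h y hy
  exact Finset.sum_congr rfl fun k _ => by rw [pd_congr he]

lemma formAh_congr_left (hΩ : IsOpen Ω) {v v' w : Pt d → ℝ} (h : ∀ x ∈ Ω, v x = v' x)
    (hw : ∀ x, x ∉ Ω → w x = 0) : formAh q a b c v w = formAh q a b c v' w := by
  rw [formAh, formAh, formA0_congr_left hΩ h,
    ip_congr_left hΩ (fun x hx => by rw [h x hx]) hw]

lemma formA0_one (w : Pt d → ℝ) : formA0 Ω a b 1 w = 0 := by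
  have : ∀ k x, pd k (1 : Pt d → ℝ) x = 0 := fun k x => by
    simp [pd, Pi.one_def]
  simp [formA0, this]

lemma one_mem_tame : (1 : Pt d → ℝ) ∈ tame Ω := by
  refine ⟨(cb Ω).one_mem, 0, .of_forall fun x => ?_⟩
  simp only [Pi.one_def, pd, fderiv_fun_const]
  exact ⟨differentiableAt_const _, fun k => by simp⟩

/-- The form `𝒜_h + κ ⟨·,·⟩_h` with a fixed test function, as a linear functional. -/
noncomputable def stepForm (hΩ : IsOpen Ω) (hΩb : Bornology.IsBounded Ω) (hcoef : IsCoeff Ω a b c)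
    (q : Option (Quadrature 𝒯)) (κ : ℝ) {w : Pt d → ℝ} (hw : w ∈ tame Ω) : tame Ω →ₗ[ℝ] ℝ where
  toFun v := formAh q a b c v w + κ * ip q v w
  map_add' v v' := by
    rw [Submodule.coe_add, formAh_add_left hΩ hΩb hcoef v.2 v'.2 hw,
      ip_add_left hΩ (integrableOn_of_mem_cb hΩ hΩb v.2.1) (integrableOn_of_mem_cb hΩ hΩb v'.2.1)
        hw.1]
    ring
  map_smul' r v := by
    rw [Submodule.coe_smul, formAh_smul_left r v.2, ip_smul_left, RingHom.id_apply, smul_eq_mul]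
    ring

/-- At a node where a discrete solution attains its positive maximum, all the off-diagonal terms of
the tested equation have a favourable sign. -/
lemma le_of_hat_nonpos (hΩ : IsOpen Ω) (hΩb : Bornology.IsBounded Ω)
    (hΩr : interior (closure Ω) = Ω) (hcoef : IsCoeff Ω a b c) (hc : ∀ x ∈ Ω, 0 ≤ c x)
    {κ : ℝ} (hκ : 0 ≤ κ)
    (hpos : ∀ z ∈ 𝒯.nodes, z ∈ Ω → ∀ φ, 𝒯.IsHat z φ → 0 < ip q (fun _ => 1) φ)
    (hA : ∀ z ∈ 𝒯.nodes, z ∈ Ω → ∀ z' ∈ 𝒯.nodes, z' ≠ z →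
      ∀ φ φ' : Pt d → ℝ, 𝒯.IsHat z φ → 𝒯.IsHat z' φ' →
        formAh q a b c φ' φ + κ * ip q φ' φ ≤ 0)
    {e H : Pt d → ℝ} (he : e ∈ 𝒯.feSpace 1) (hH : H ∈ cb Ω)
    (h : ∀ v ∈ 𝒯.feSpace 1, κ * ip q e v + formAh q a b c e v = ip q H v)
    {x : Pt d} (hx : x ∈ Ω) : κ * e x ≤ nn Ω ⊤ H := by
  classical
  have hne : 𝒯.nodeFinset.Nonempty := by
    rw [Finset.nonempty_iff_ne_empty]
    intro h0
    have := Triangulation.sum_hat (𝒯 := 𝒯) (subset_closure hx)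
    simp [h0] at this
  obtain ⟨z, hz, hzmax⟩ := 𝒯.nodeFinset.exists_max_image e hne
  have hle : ∀ x ∈ closure Ω, e x ≤ e z := by
    intro x hx
    rw [he.2.1.eq_sum_hat hx]
    calc _ ≤ ∑ z' ∈ 𝒯.nodeFinset, e z * 𝒯.hat z' x := Finset.sum_le_sum fun z' hz' =>
          mul_le_mul_of_nonneg_right (hzmax z' hz') (𝒯.hat_nonneg z' x)
      _ = e z := by rw [← Finset.mul_sum, Triangulation.sum_hat hx, mul_one]
  refine (mul_le_mul_of_nonneg_left (hle x (subset_closure hx)) hκ).trans ?_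
  rcases le_or_gt (e z) 0 with hez | hez
  · exact (mul_nonpos_of_nonneg_of_nonpos hκ hez).trans (nn_nonneg _)
  have hzΩ : z ∈ Ω := by
    by_contra hn
    rw [he.2.2 z hn] at hez; exact lt_irrefl _ hez
  have hzn := Triangulation.mem_nodeFinset.1 hz
  set φ := 𝒯.hat z with hφ
  have hφs : φ ∈ 𝒯.feSpace 1 := Triangulation.hat_mem_feSpace hΩ hΩr hzΩ
  have hφt := Triangulation.feSpace_mem_tame hΩ hΩb hφs
  have hφ1 := hpos z hzn hzΩ φ (Triangulation.isHat_hat hzn)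
  have hφ0 : ∀ x, 0 ≤ φ x := 𝒯.hat_nonneg z
  let B := stepForm hΩ hΩb hcoef q κ hφt
  have ht : ∀ z', 𝒯.hat z' ∈ tame Ω := fun z' => (𝒯.piecewisePoly_hat z').mem_tame hΩ hΩb
  have het := Triangulation.feSpace_mem_tame hΩ hΩb he
  -- `D = e(z) - e` is a nonnegative combination of the other hat functions
  let D : tame Ω := ∑ z' ∈ 𝒯.nodeFinset, (e z - e z') • (⟨𝒯.hat z', ht z'⟩ : tame Ω)
  have hBD : B D ≤ 0 := by
    rw [map_sum]
    refine Finset.sum_nonpos fun z' hz' => ?_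
    rw [map_smul, smul_eq_mul]
    by_cases hzz : z' = z
    · rw [hzz, sub_self, zero_mul]
    · have hz'n := Triangulation.mem_nodeFinset.1 hz'
      exact mul_nonpos_of_nonneg_of_nonpos (sub_nonneg.2 (hzmax z' hz'))
        (hA z hzn hzΩ z' hz'n hzz _ _ (Triangulation.isHat_hat hzn) (Triangulation.isHat_hat hz'n))
  let E : tame Ω := e z • (⟨1, one_mem_tame⟩ : tame Ω) - ⟨e, het⟩
  have hDE : ∀ x ∈ Ω, (D : Pt d → ℝ) x = (E : Pt d → ℝ) x := by
    intro x hx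
    have h1 := Triangulation.sum_hat (𝒯 := 𝒯) (subset_closure hx)
    have h2 := he.2.1.eq_sum_hat (subset_closure hx)
    have h3 : (D : Pt d → ℝ) x = ∑ z' ∈ 𝒯.nodeFinset, (e z - e z') * 𝒯.hat z' x := by
      simp [D, Finset.sum_apply]
    have h4 : (E : Pt d → ℝ) x = e z - e x := by simp [E]
    rw [h3, h4, h2]
    simp only [sub_mul, Finset.sum_sub_distrib, ← Finset.mul_sum, h1, mul_one]
  have hBE : B D = B E := by
    change formAh q a b c _ φ + κ * ip q _ φ = formAh q a b c _ φ + κ * ip q _ φ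
    rw [formAh_congr_left hΩ hDE hφs.2.2, ip_congr_left hΩ hDE hφs.2.2]
  have hB1 : κ * ip q (fun _ => 1) φ ≤ B ⟨1, one_mem_tame⟩ := by
    change _ ≤ formAh q a b c 1 φ + κ * ip q 1 φ
    have h1 : 0 ≤ ip q (fun x => c x * (1 : Pt d → ℝ) x) φ := by
      have h2 := ip_mono_left (q := q) (f := 0) (g := fun x => c x * (1 : Pt d → ℝ) x) hΩ hΩb
        (cb Ω).zero_mem
        ((cb Ω).mul_mem (mem_cb_of_continuousOn_closure hΩb hcoef.c_cont) (cb Ω).one_mem) hφt.1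
        (fun x hx => by simpa using hc x hx) hφ0 hφs.2.2
      have h3 : ip q (0 : Pt d → ℝ) φ = 0 := by
        have := ip_smul_left (q := q) 0 (0 : Pt d → ℝ) φ
        simpa using this
      rwa [h3] at h2
    rw [formAh, formA0_one]
    have : ip q (fun _ => 1) φ = ip q 1 φ := rfl
    rw [this]; linarith
  have hBe : B ⟨e, het⟩ = ip q H φ := by
    rw [← h φ hφs]; exact add_comm _ _
  have hHφ : ip q H φ ≤ nn Ω ⊤ H * ip q (fun _ => 1) φ := by
    have h2 := ip_mono_left (q := q) (f := H) (g := nn Ω ⊤ H • (1 : Pt d → ℝ)) hΩ hΩb hH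
      ((cb Ω).smul_mem (cb Ω).one_mem _) hφt.1
      (fun x hx => by simpa using (le_abs_self _).trans (abs_le_nn_top hΩ hΩb hH hx)) hφ0 hφs.2.2
    rwa [ip_smul_left] at h2
  have hfin : B E = e z * B ⟨1, one_mem_tame⟩ - ip q H φ := by
    rw [map_sub, map_smul, smul_eq_mul, hBe]
  refine le_of_mul_le_mul_right ?_ hφ1
  have := mul_le_mul_of_nonneg_left hB1 hez.le
  rw [hBE, hfin] at hBD
  linarith

/-- The maximum norm estimate for a single time step. -/
lemma stable_of_hat_nonpos (hΩ : IsOpen Ω) (hΩb : Bornology.IsBounded Ω)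
    (hΩr : interior (closure Ω) = Ω) (hcoef : IsCoeff Ω a b c) (hc : ∀ x ∈ Ω, 0 ≤ c x)
    {κ : ℝ} (hκ : 0 < κ)
    (hpos : ∀ z ∈ 𝒯.nodes, z ∈ Ω → ∀ φ, 𝒯.IsHat z φ → 0 < ip q (fun _ => 1) φ)
    (hA : ∀ z ∈ 𝒯.nodes, z ∈ Ω → ∀ z' ∈ 𝒯.nodes, z' ≠ z →
      ∀ φ φ' : Pt d → ℝ, 𝒯.IsHat z φ → 𝒯.IsHat z' φ' →
        formAh q a b c φ' φ + κ * ip q φ' φ ≤ 0)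
    {e H : Pt d → ℝ} (he : e ∈ 𝒯.feSpace 1) (hH : H ∈ cb Ω)
    (h : ∀ v ∈ 𝒯.feSpace 1, κ * ip q e v + formAh q a b c e v = ip q H v) :
    κ * nn Ω ⊤ e ≤ nn Ω ⊤ H := by
  have het := Triangulation.feSpace_mem_tame hΩ hΩb he
  have hneg : nn Ω ⊤ (-H) = nn Ω ⊤ H := by rw [← neg_one_smul ℝ H, nn_smul]; simp
  rw [mul_comm, ← le_div_iff₀ hκ]
  refine nn_top_le hΩ (div_nonneg (nn_nonneg _) hκ.le) fun x hx => ?_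
  rw [le_div_iff₀ hκ, mul_comm, ← abs_of_pos hκ, ← abs_mul, abs_le']
  refine ⟨le_of_hat_nonpos hΩ hΩb hΩr hcoef hc hκ.le hpos hA he hH h hx, ?_⟩
  rw [← hneg]
  have h2 := le_of_hat_nonpos hΩ hΩb hΩr hcoef hc hκ.le hpos hA
    ((𝒯.feSpace 1).neg_mem he) ((cb Ω).neg_mem hH) (fun v hv => ?_) hx
  · simpa using h2
  · rw [← neg_one_smul ℝ e, ← neg_one_smul ℝ H, ip_smul_left, ip_smul_left,
      formAh_smul_left _ het, ← h v hv]
    ring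

end maxPrinciple

/-! ### Stability and solvability of the scheme -/

section stability

variable {d : ℕ} {Ω : Set (Pt d)} {𝒯 : Triangulation Ω} {ℓ : ℕ} {q : Option (Quadrature 𝒯)}
  {a b : Fin d → Pt d → ℝ} {c : Pt d → ℝ} {p : ℝ≥0∞} {κ : ℝ}

/-- Stability in `L_p(Ω)` of the elliptic problem that is solved in a time step: the only
consequence of condition `A_p` that the error analysis needs. -/
def StepStable (𝒯 : Triangulation Ω) (ℓ : ℕ) (q : Option (Quadrature 𝒯))
    (a b : Fin d → Pt d → ℝ) (c : Pt d → ℝ) (p : ℝ≥0∞) (κ : ℝ) : Prop :=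
  ∀ e ∈ 𝒯.feSpace ℓ, ∀ H ∈ cb Ω,
    (∀ v ∈ 𝒯.feSpace ℓ, κ * ip q e v + formAh q a b c e v = ip q H v) →
    κ * nn Ω p e ≤ nn Ω p H

lemma stepStable_of_condA (hΩ : IsOpen Ω) (hΩb : Bornology.IsBounded Ω)
    (hΩr : interior (closure Ω) = Ω) (hcoef : IsCoeff Ω a b c) (hp : p = 2 ∨ p = ⊤)
    (hsign : ∀ x ∈ Ω, 0 ≤ c x - (p⁻¹).toReal * ∑ k, pd k (b k) x)
    {α : ℝ} (hα : α ∈ Ioo (0 : ℝ) 1) {t : ℕ → ℝ} (ht : StrictMono t) {M : ℕ}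
    (hpos : ∀ z ∈ 𝒯.nodes, z ∈ Ω → ∀ φ, 𝒯.IsHat z φ → 0 < ip q (fun _ => 1) φ)
    (hA : CondA 𝒯 ℓ q α t M a b c p) {m : ℕ} (hm : m ∈ Finset.Icc 1 M) :
    StepStable 𝒯 ℓ q a b c p (kappa α t m) := by
  intro e he H hH h
  rcases hp with rfl | rfl
  · obtain rfl := hA.1 rfl
    refine stable_of_exact hΩ hΩb hcoef (fun x hx => ?_) he hH (h e he)
    have := hsign x hx
    simpa using this
  · obtain ⟨rfl, hA2⟩ := hA.2 rfl
    exact stable_of_hat_nonpos hΩ hΩb hΩr hcoef (fun x hx => by simpa using hsign x hx)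
      (kappa_pos hα ht (Finset.mem_Icc.1 hm).1) hpos (hA2 m hm) he hH h

lemma ip_zero_left (v : Pt d → ℝ) : ip q (0 : Pt d → ℝ) v = 0 := by
  have := ip_smul_left (q := q) 0 (0 : Pt d → ℝ) v
  simpa using this

lemma StepStable.eq_zero (hS : StepStable 𝒯 ℓ q a b c p κ) (hΩ : IsOpen Ω)
    (hΩb : Bornology.IsBounded Ω) (hp : p = 2 ∨ p = ⊤) (hκ : 0 < κ) {e : Pt d → ℝ}
    (he : e ∈ 𝒯.feSpace ℓ) (h : ∀ v ∈ 𝒯.feSpace ℓ, κ * ip q e v + formAh q a b c e v = 0) :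
    e = 0 := by
  have h1 := hS e he 0 (cb Ω).zero_mem fun v hv => by rw [h v hv, ip_zero_left]
  rw [nn_zero] at h1
  have h2 : nn Ω p e = 0 :=
    le_antisymm (nonpos_of_mul_nonpos_right h1 hκ) (nn_nonneg _)
  ext x
  by_cases hx : x ∈ Ω
  · exact eq_zero_of_nn_eq_zero hΩ hΩb hp (Triangulation.feSpace_mem_cb hΩ hΩb he) h2 hx
  · exact he.2.2 x hx

/-- Injectivity gives solvability, as the finite element space has finite dimension. -/
lemma StepStable.exists_eq (hS : StepStable 𝒯 ℓ q a b c p κ) (hΩ : IsOpen Ω)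
    (hΩb : Bornology.IsBounded Ω) (hcoef : IsCoeff Ω a b c) (hp : p = 2 ∨ p = ⊤) (hκ : 0 < κ)
    {g : Pt d → ℝ} (hg : IntegrableOn g Ω) :
    ∃ e ∈ 𝒯.feSpace ℓ, ∀ v ∈ 𝒯.feSpace ℓ,
      κ * ip q e v + formAh q a b c e v = ip q g v := by
  have hcb : ∀ v : 𝒯.feSpace ℓ, (v : Pt d → ℝ) ∈ cb Ω := fun v =>
    Triangulation.feSpace_mem_cb hΩ hΩb v.2
  have htame : ∀ v : 𝒯.feSpace ℓ, (v : Pt d → ℝ) ∈ tame Ω := fun v =>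
    Triangulation.feSpace_mem_tame hΩ hΩb v.2
  have hint : ∀ v : 𝒯.feSpace ℓ, IntegrableOn (v : Pt d → ℝ) Ω := fun v =>
    integrableOn_of_mem_cb hΩ hΩb (hcb v)
  have := Triangulation.finiteDimensional_feSpace 𝒯 ℓ
  let B : 𝒯.feSpace ℓ →ₗ[ℝ] Module.Dual ℝ (𝒯.feSpace ℓ) :=
    LinearMap.mk₂ ℝ (fun e v => κ * ip q e v + formAh q a b c e v)
      (fun e e' v => by
        rw [Submodule.coe_add, ip_add_left hΩ (hint e) (hint e') (hcb v),
          formAh_add_left hΩ hΩb hcoef (htame e) (htame e') (htame v)]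
        ring)
      (fun r e v => by
        rw [Submodule.coe_smul, ip_smul_left, formAh_smul_left r (htame e), smul_eq_mul]
        ring)
      (fun e v v' => by
        rw [Submodule.coe_add, ip_add_right hΩ (hint e) (hcb v) (hcb v'),
          formAh_add_right hΩ hΩb hcoef (htame e) (htame v) (htame v')]
        ring)
      (fun r e v => by
        rw [Submodule.coe_smul, ip_smul_right, formAh_smul_right r (htame v), smul_eq_mul]
        ring)
  let G : Module.Dual ℝ (𝒯.feSpace ℓ) :=
    { toFun := fun v => ip q g v
      map_add' := fun v v' => by
        rw [Submodule.coe_add, ip_add_right hΩ hg (hcb v) (hcb v')]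
      map_smul' := fun r v => by
        rw [Submodule.coe_smul, ip_smul_right, RingHom.id_apply, smul_eq_mul] }
  have hinj : Function.Injective B := by
    rw [injective_iff_map_eq_zero]
    intro e he
    refine Subtype.ext (hS.eq_zero hΩ hΩb hp hκ e.2 fun v hv => ?_)
    exact congrArg (fun F : Module.Dual ℝ (𝒯.feSpace ℓ) => F ⟨v, hv⟩) he
  have hsurj : Function.Surjective B :=
    (LinearMap.injective_iff_surjective_of_finrank_eq_finrank
      Subspace.dual_finrank_eq.symm).1 hinj
  obtain ⟨e, he⟩ := hsurj G
  exact ⟨e, e.2, fun v hv =>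
    congrArg (fun F : Module.Dual ℝ (𝒯.feSpace ℓ) => F ⟨v, hv⟩) he⟩

end stability

section scheme

variable {d : ℕ} {Ω : Set (Pt d)} {𝒯 : Triangulation Ω} {ℓ : ℕ} {q : Option (Quadrature 𝒯)}
  {a b : Fin d → Pt d → ℝ} {c : Pt d → ℝ} {p : ℝ≥0∞} {α : ℝ} {t : ℕ → ℝ}

lemma l1_fun_eq (α : ℝ) (t : ℕ → ℝ) (U : ℕ → Pt d → ℝ) {m : ℕ} (hm : 1 ≤ m) :
    (fun x => l1 α t (fun j => U j x) m)
      = kappa α t m • U m - ∑ j ∈ Finset.range m, histCoeff α t m j • U j := by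
  ext x
  rw [l1_eq_kappa_sub_hist α t _ hm]
  simp [Finset.sum_apply]

lemma hist_mem_cb {U : ℕ → Pt d → ℝ} {m : ℕ} (hU : ∀ j < m, U j ∈ cb Ω) :
    ∑ j ∈ Finset.range m, histCoeff α t m j • U j ∈ cb Ω :=
  (cb Ω).sum_mem fun j hj => (cb Ω).smul_mem (hU j (Finset.mem_range.1 hj)) _

lemma l1_mem_cb {U : ℕ → Pt d → ℝ} {m : ℕ} (hm : 1 ≤ m) (hU : ∀ j ≤ m, U j ∈ cb Ω) :
    (fun x => l1 α t (fun j => U j x) m) ∈ cb Ω := by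
  rw [l1_fun_eq α t U hm]
  exact (cb Ω).sub_mem ((cb Ω).smul_mem (hU m le_rfl) _) (hist_mem_cb fun j hj => hU j hj.le)

lemma ip_l1_eq (hΩ : IsOpen Ω) (hΩb : Bornology.IsBounded Ω) {U : ℕ → Pt d → ℝ} {m : ℕ}
    (hm : 1 ≤ m) (hU : ∀ j ≤ m, U j ∈ cb Ω) {v : Pt d → ℝ} (hv : v ∈ cb Ω) :
    ip q (fun x => l1 α t (fun j => U j x) m) v = kappa α t m * ip q (U m) v
      - ip q (∑ j ∈ Finset.range m, histCoeff α t m j • U j) v := by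
  rw [l1_fun_eq α t U hm, ip_sub_left hΩ
    (integrableOn_of_mem_cb hΩ hΩb ((cb Ω).smul_mem (hU m le_rfl) _))
    (integrableOn_of_mem_cb hΩ hΩb (hist_mem_cb fun j hj => hU j hj.le)) hv, ip_smul_left]

/-- Solve the scheme step by step. -/
lemma exists_isFESolution (hΩ : IsOpen Ω) (hΩb : Bornology.IsBounded Ω) (hcoef : IsCoeff Ω a b c)
    (hp : p = 2 ∨ p = ⊤) (hα : α ∈ Ioo (0 : ℝ) 1) (ht : StrictMono t) {M : ℕ}
    (hS : ∀ m ∈ Finset.Icc 1 M, StepStable 𝒯 ℓ q a b c p (kappa α t m)) {f : Pt d → ℝ → ℝ}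
    (hf : ∀ m ∈ Finset.Icc 1 M, IntegrableOn (fun x => f x (t m)) Ω) {U₀ : Pt d → ℝ}
    (hU₀ : U₀ ∈ cb Ω) : ∃ U, IsFESolution 𝒯 ℓ q α t M a b c f U₀ U := by
  induction M with
  | zero => exact ⟨fun _ => U₀, rfl, by simp⟩
  | succ n ih =>
    obtain ⟨U, hU0, hU⟩ := ih (fun m hm => hS m (Finset.Icc_subset_Icc_right n.le_succ hm))
      (fun m hm => hf m (Finset.Icc_subset_Icc_right n.le_succ hm))
    have hUcb : ∀ j ≤ n, U j ∈ cb Ω := by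
      intro j hj
      rcases Nat.eq_zero_or_pos j with rfl | hj0
      · rwa [hU0]
      · exact Triangulation.feSpace_mem_cb hΩ hΩb (hU j (Finset.mem_Icc.2 ⟨hj0, hj⟩)).1
    have hn : n + 1 ∈ Finset.Icc 1 (n + 1) := by simp
    have hh := hist_mem_cb (α := α) (t := t) (m := n + 1) fun j hj => hUcb j (Nat.lt_succ_iff.1 hj)
    have hhi := integrableOn_of_mem_cb hΩ hΩb hh
    obtain ⟨e, he, hev⟩ := (hS (n + 1) hn).exists_eq hΩ hΩb hcoef hp
      (kappa_pos hα ht n.succ_pos) ((hf (n + 1) hn).add hhi)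
    let V : ℕ → Pt d → ℝ := fun j => if j ≤ n then U j else e
    have hVU : ∀ j ≤ n, V j = U j := fun j hj => if_pos hj
    have hVe : V (n + 1) = e := if_neg (by simp)
    refine ⟨V, (hVU 0 (Nat.zero_le _)).trans hU0, fun m hm => ?_⟩
    rcases (Finset.mem_Icc.1 hm).2.lt_or_eq with hlt | rfl
    · have hmn : m ≤ n := Nat.lt_succ_iff.1 hlt
      have hm1 := (Finset.mem_Icc.1 hm).1
      have h1 := hU m (Finset.mem_Icc.2 ⟨hm1, hmn⟩)
      have h2 : (fun x => l1 α t (fun j => V j x) m) = fun x => l1 α t (fun j => U j x) m := by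
        rw [l1_fun_eq α t V hm1, l1_fun_eq α t U hm1, hVU m hmn]
        congr 1
        exact Finset.sum_congr rfl fun j hj => by
          rw [hVU j ((Finset.mem_range.1 hj).le.trans hmn)]
      rw [hVU m hmn, h2]
      exact h1
    · rw [hVe]
      refine ⟨he, fun v hv => ?_⟩
      have hvcb := Triangulation.feSpace_mem_cb hΩ hΩb hv
      have hVcb : ∀ j ≤ n + 1, V j ∈ cb Ω := by
        intro j hj
        rcases hj.lt_or_eq with h | rfl
        · rw [hVU j (Nat.lt_succ_iff.1 h)]; exact hUcb j (Nat.lt_succ_iff.1 h)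
        · rw [hVe]; exact Triangulation.feSpace_mem_cb hΩ hΩb he
      have hsum : ∑ j ∈ Finset.range (n + 1), histCoeff α t (n + 1) j • V j
          = ∑ j ∈ Finset.range (n + 1), histCoeff α t (n + 1) j • U j :=
        Finset.sum_congr rfl fun j hj => by
          rw [hVU j (Nat.lt_succ_iff.1 (Finset.mem_range.1 hj))]
      have h1 := hev v hv
      have h2 := ip_add_left (q := q) hΩ (hf (n + 1) hn) hhi hvcb
      rw [ip_l1_eq hΩ hΩb n.succ_pos hVcb hvcb, hsum, hVe]
      linarith

lemma IsFESolution.mem_cb {M : ℕ} {f : Pt d → ℝ → ℝ} {U₀ : Pt d → ℝ} {U : ℕ → Pt d → ℝ}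
    (hU : IsFESolution 𝒯 ℓ q α t M a b c f U₀ U) (hΩ : IsOpen Ω) (hΩb : Bornology.IsBounded Ω)
    (hU₀ : U₀ ∈ cb Ω) {m : ℕ} (hm : m ≤ M) : U m ∈ cb Ω := by
  rcases Nat.eq_zero_or_pos m with rfl | hm0
  · rwa [hU.1]
  · exact Triangulation.feSpace_mem_cb hΩ hΩb (hU.2 m (Finset.mem_Icc.2 ⟨hm0, hm⟩)).1

lemma isFESolution_unique (hΩ : IsOpen Ω) (hΩb : Bornology.IsBounded Ω) (hcoef : IsCoeff Ω a b c)
    (hp : p = 2 ∨ p = ⊤) (hα : α ∈ Ioo (0 : ℝ) 1) (ht : StrictMono t) {M : ℕ}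
    (hS : ∀ m ∈ Finset.Icc 1 M, StepStable 𝒯 ℓ q a b c p (kappa α t m)) {f : Pt d → ℝ → ℝ}
    {U₀ : Pt d → ℝ} (hU₀ : U₀ ∈ cb Ω) {U V : ℕ → Pt d → ℝ}
    (hU : IsFESolution 𝒯 ℓ q α t M a b c f U₀ U) (hV : IsFESolution 𝒯 ℓ q α t M a b c f U₀ V) :
    ∀ m ≤ M, U m = V m := by
  intro m
  induction m using Nat.strong_induction_on with
  | _ m ih =>
    intro hm
    rcases Nat.eq_zero_or_pos m with rfl | hm0
    · rw [hU.1, hV.1]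
    · have hmM := Finset.mem_Icc.2 ⟨hm0, hm⟩
      obtain ⟨hUm, hUe⟩ := hU.2 m hmM
      obtain ⟨hVm, hVe⟩ := hV.2 m hmM
      have hUt := Triangulation.feSpace_mem_tame hΩ hΩb hUm
      have hVt := Triangulation.feSpace_mem_tame hΩ hΩb hVm
      have hsum : ∑ j ∈ Finset.range m, histCoeff α t m j • U j
          = ∑ j ∈ Finset.range m, histCoeff α t m j • V j :=
        Finset.sum_congr rfl fun j hj => by
          have hjm := Finset.mem_range.1 hj
          rw [ih j hjm (hjm.le.trans hm)]
      refine sub_eq_zero.1 ((hS m hmM).eq_zero hΩ hΩb hp (kappa_pos hα ht hm0)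
        ((𝒯.feSpace ℓ).sub_mem hUm hVm) fun v hv => ?_)
      have hvt := Triangulation.feSpace_mem_tame hΩ hΩb hv
      have h1 := hUe v hv
      have h2 := hVe v hv
      rw [ip_l1_eq hΩ hΩb hm0 (fun j hj => hU.mem_cb hΩ hΩb hU₀ (hj.trans hm)) hvt.1, hsum] at h1
      rw [ip_l1_eq hΩ hΩb hm0 (fun j hj => hV.mem_cb hΩ hΩb hU₀ (hj.trans hm)) hvt.1] at h2
      have h3 : formAh q a b c (U m - V m) v = formAh q a b c (U m) v - formAh q a b c (V m) v := by
        have h4 := formAh_add_left (q := q) hΩ hΩb hcoef ((tame Ω).sub_mem hUt hVt) hVt hvt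
        rw [sub_add_cancel] at h4
        linarith
      rw [ip_sub_left hΩ (integrableOn_of_mem_cb hΩ hΩb hUt.1)
        (integrableOn_of_mem_cb hΩ hΩb hVt.1) hvt.1, h3]
      linarith

/-- A stable time step transfers the L1 operator from the error to its norm. -/
lemma l1_nn_le (hΩ : IsOpen Ω) (hΩb : Bornology.IsBounded Ω) (hp : 1 ≤ p)
    (hα : α ∈ Ioo (0 : ℝ) 1) (ht : StrictMono t) {m : ℕ} (hm : 1 ≤ m)
    (hS : StepStable 𝒯 ℓ q a b c p (kappa α t m)) {e : ℕ → Pt d → ℝ} (he : ∀ j ≤ m, e j ∈ cb Ω)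
    (hem : e m ∈ 𝒯.feSpace ℓ) {H : Pt d → ℝ} (hH : H ∈ cb Ω)
    (h : ∀ v ∈ 𝒯.feSpace ℓ,
      ip q (fun x => l1 α t (fun j => e j x) m) v + formAh q a b c (e m) v = ip q H v) :
    l1 α t (fun j => nn Ω p (e j)) m ≤ nn Ω p H := by
  have hh := hist_mem_cb (α := α) (t := t) fun j (hj : j < m) => he j hj.le
  have h1 := hS (e m) hem (H + ∑ j ∈ Finset.range m, histCoeff α t m j • e j)
    ((cb Ω).add_mem hH hh) fun v hv => by
      have hvcb := Triangulation.feSpace_mem_cb hΩ hΩb hv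
      have h2 := h v hv
      rw [ip_l1_eq hΩ hΩb hm he hvcb] at h2
      rw [ip_add_left hΩ (integrableOn_of_mem_cb hΩ hΩb hH) (integrableOn_of_mem_cb hΩ hΩb hh) hvcb]
      linarith
  have h2 := nn_add_le hΩ hΩb hp hH hh
  have h3 : nn Ω p (∑ j ∈ Finset.range m, histCoeff α t m j • e j)
      ≤ ∑ j ∈ Finset.range m, histCoeff α t m j * nn Ω p (e j) := by
    refine (nn_sum_le hΩ hΩb hp _ fun j hj =>
      (cb Ω).smul_mem (he j (Finset.mem_range.1 hj).le) _).trans (Finset.sum_le_sum fun j hj => ?_)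
    rw [nn_smul, abs_of_nonneg (histCoeff_nonneg hα ht (Finset.mem_range.1 hj))]
  rw [l1_eq_kappa_sub_hist α t _ hm]
  linarith

/-- The variation of a sequence of functions on the first `j` mesh intervals, in `L_p(Ω)`. -/
noncomputable def variation (Ω : Set (Pt d)) (p : ℝ≥0∞) (ρ : ℕ → Pt d → ℝ) (j : ℕ) : ℝ :=
  ∑ i ∈ Finset.Icc 1 j, nn Ω p (ρ i - ρ (i - 1))

lemma variation_zero (ρ : ℕ → Pt d → ℝ) : variation Ω p ρ 0 = 0 := by simp [variation]

lemma variation_succ (ρ : ℕ → Pt d → ℝ) (j : ℕ) :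
    variation Ω p ρ (j + 1) = variation Ω p ρ j + nn Ω p (ρ (j + 1) - ρ j) := by
  rw [variation, Finset.sum_Icc_succ_top (by omega)]; simp [variation]

lemma variation_mono (ρ : ℕ → Pt d → ℝ) : Monotone (variation Ω p ρ) :=
  monotone_nat_of_le_succ fun j => by
    rw [variation_succ]; exact le_add_of_nonneg_right (nn_nonneg _)

lemma nn_le_add_variation (hΩ : IsOpen Ω) (hΩb : Bornology.IsBounded Ω) (hp : 1 ≤ p)
    {ρ : ℕ → Pt d → ℝ} {m : ℕ} (hρ : ∀ j ≤ m, ρ j ∈ cb Ω) :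
    nn Ω p (ρ m) ≤ nn Ω p (ρ 0) + variation Ω p ρ m := by
  induction m with
  | zero => simp [variation_zero]
  | succ n ih =>
    have h1 := ih fun j hj => hρ j (hj.trans n.le_succ)
    have h2 := nn_add_le hΩ hΩb hp (hρ n n.le_succ)
      ((cb Ω).sub_mem (hρ (n + 1) le_rfl) (hρ n n.le_succ))
    rw [add_sub_cancel] at h2
    rw [variation_succ]; linarith

/-- The L1 operator is a nonnegative combination of increments. -/
lemma nn_l1_le_l1_variation (hΩ : IsOpen Ω) (hΩb : Bornology.IsBounded Ω) (hp : 1 ≤ p)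
    (hα : α ∈ Ioo (0 : ℝ) 1) (ht : StrictMono t) {ρ : ℕ → Pt d → ℝ} {m : ℕ}
    (hρ : ∀ j ≤ m, ρ j ∈ cb Ω) :
    nn Ω p (fun x => l1 α t (fun j => ρ j x) m) ≤ l1 α t (variation Ω p ρ) m := by
  have e : (fun x => l1 α t (fun j => ρ j x) m)
      = ∑ j ∈ Finset.Icc 1 m, wgt α t m j • (ρ j - ρ (j - 1)) := by
    ext x; rw [l1_eq_sum_wgt]; simp [Finset.sum_apply]
  rw [e, l1_eq_sum_wgt]
  refine (nn_sum_le hΩ hΩb hp _ fun j hj => ?_).trans (Finset.sum_le_sum fun j hj => ?_)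
  · have hj2 := (Finset.mem_Icc.1 hj).2
    exact (cb Ω).smul_mem ((cb Ω).sub_mem (hρ j hj2) (hρ (j - 1) (by omega))) _
  · obtain ⟨hj1, hj2⟩ := Finset.mem_Icc.1 hj
    obtain ⟨i, rfl⟩ := Nat.exists_eq_add_of_le' hj1
    rw [nn_smul, abs_of_pos (wgt_pos hα ht hj1 hj2), Nat.add_sub_cancel, variation_succ]
    simp

end scheme

/-! ### Truncation error and error equation -/

section error

variable {d : ℕ} {Ω : Set (Pt d)} {𝒯 : Triangulation Ω} {ℓ : ℕ} {q : Option (Quadrature 𝒯)}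
  {a b : Fin d → Pt d → ℝ} {c : Pt d → ℝ} {p : ℝ≥0∞} {α T K : ℝ} {t : ℕ → ℝ}
  {f : Pt d → ℝ → ℝ} {u₀ : Pt d → ℝ} {u : Pt d → ℝ → ℝ} {w : ℝ → Pt d → ℝ}

lemma IsSolution.exists_timeRegular (h : IsSolution Ω α T a b c f u₀ u w) :
    ∃ K, 0 ≤ K ∧ ∀ x ∈ Ω, TimeRegular α T K (u x) := by
  obtain ⟨K, hK⟩ := h.bound
  have hbd : ∀ x ∈ Ω, ∀ s ∈ Ioo 0 T, ∀ l ≤ 2,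
      |iteratedDeriv l (u x) s| ≤ max K 0 * (1 + s ^ (α - (l : ℝ))) := fun x hx s hs l hl =>
    (hK x hx s hs l hl).trans (mul_le_mul_of_nonneg_right (le_max_left _ _)
      (by have := Real.rpow_nonneg hs.1.le (α - (l : ℝ)); linarith))
  refine ⟨max K 0, le_max_right _ _, fun x hx => ⟨?_, h.smooth x hx, fun s hs => ?_,
    fun s hs => ?_⟩⟩
  · exact h.cont.comp (by fun_prop : ContinuousOn (fun s : ℝ => (x, s)) (Icc 0 T))
      fun s hs => ⟨subset_closure hx, hs⟩
  · simpa [iteratedDeriv_one] using hbd x hx s hs 1 (by norm_num)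
  · simpa using hbd x hx s hs 2 le_rfl

/-- The truncation error `δ_t^α u - D_t^α u` of the L1 method at `t_k`. -/
noncomputable def truncErr (α : ℝ) (t : ℕ → ℝ) (u : Pt d → ℝ → ℝ) (k : ℕ) (x : Pt d) : ℝ :=
  1 / Real.Gamma (1 - α) * ∑ j ∈ Finset.Icc 1 k, locRes α t k j (u x)

lemma truncErr_eq (α : ℝ) (t : ℕ → ℝ) (u : Pt d → ℝ → ℝ) (k : ℕ) :
    truncErr α t u k = (1 / Real.Gamma (1 - α)) •
      ∑ j ∈ Finset.Icc 1 k, fun x => locRes α t k j (u x) := by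
  ext x; simp [truncErr, Finset.sum_apply]

lemma truncErr_mem_cb (hΩb : Bornology.IsBounded Ω)
    (hu : ContinuousOn (fun q : Pt d × ℝ => u q.1 q.2) (closure Ω ×ˢ Icc 0 T))
    (hreg : ∀ x ∈ Ω, TimeRegular α T K (u x)) (hα : α ∈ Ioo (0 : ℝ) 1) (hK : 0 ≤ K)
    (ht : StrictMono t) (ht0 : t 0 = 0) {k : ℕ} (hkT : t k ≤ T) : truncErr α t u k ∈ cb Ω := by
  rw [truncErr_eq]
  exact (cb Ω).smul_mem ((cb Ω).sum_mem fun j hj => locRes_mem_cb hΩb hu hreg hα hK ht ht0 hkT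
    (Finset.mem_Icc.1 hj).1 (Finset.mem_Icc.1 hj).2) _

lemma nn_truncErr_le (hΩ : IsOpen Ω) (hΩb : Bornology.IsBounded Ω) (hp : 1 ≤ p)
    (hu : ContinuousOn (fun q : Pt d × ℝ => u q.1 q.2) (closure Ω ×ˢ Icc 0 T))
    (hreg : ∀ x ∈ Ω, TimeRegular α T K (u x)) (hα : α ∈ Ioo (0 : ℝ) 1) (hK : 0 ≤ K)
    (ht : StrictMono t) (ht0 : t 0 = 0) {k : ℕ} (hkT : t k ≤ T) {N : ℕ → ℝ}
    (hN0 : ∀ j, 0 ≤ N j)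
    (hN : ∀ j ∈ Finset.Icc 1 k, nrm Ω p (psi α t u j) ≤ ENNReal.ofReal (N j)) :
    nn Ω p (truncErr α t u k)
      ≤ 1 / Real.Gamma (1 - α) * ∑ j ∈ Finset.Icc 1 k, resWgt α t k j * N j := by
  have hΓ := gamma_pos_of_mem hα
  rw [truncErr_eq, nn_smul, abs_of_pos (by positivity)]
  refine mul_le_mul_of_nonneg_left ?_ (by positivity)
  refine (nn_sum_le hΩ hΩb hp _ fun j hj => locRes_mem_cb hΩb hu hreg hα hK ht ht0 hkT
    (Finset.mem_Icc.1 hj).1 (Finset.mem_Icc.1 hj).2).trans (Finset.sum_le_sum fun j hj => ?_)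
  obtain ⟨hj1, hjk⟩ := Finset.mem_Icc.1 hj
  have hw := resWgt_pos hα ht ht0 hj1 hjk
  have h1 : nrm Ω p (fun x => locRes α t k j (u x))
      ≤ ((resWgt α t k j).toNNReal : ℝ≥0∞) * nrm Ω p (psi α t u j) := by
    refine nrm_le_mul hΩ fun x hx => ?_
    rw [Real.enorm_eq_ofReal_abs]
    exact ofReal_abs_locRes_le hα ht ht0 hkT hj1 hjk (hreg x hx)
  refine ENNReal.toReal_le_of_le_ofReal (mul_nonneg hw.le (hN0 j)) ?_
  rw [ENNReal.ofReal_mul hw.le]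
  exact h1.trans (mul_le_mul_right (hN j hj) _)

/-- On the domain the right-hand side is a bounded continuous function plus the distribution
`ℒu - cu`. -/
lemma IsSolution.source_eq (h : IsSolution Ω α T a b c f u₀ u w)
    (hreg : ∀ x ∈ Ω, TimeRegular α T K (u x)) (hα : α ∈ Ioo (0 : ℝ) 1) (ht : StrictMono t)
    (ht0 : t 0 = 0) {k : ℕ} (hk : 1 ≤ k) (hkT : t k ≤ T) {x : Pt d} (hx : x ∈ Ω) :
    f x (t k) = (((fun x => l1 α t (fun j => u x (t j)) k) - truncErr α t u k
      + c * fun x => u x (t k)) + w (t k)) x := by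
  have h0 : 0 < t k := ht0 ▸ ht (by omega)
  have h1 := h.eqn x hx (t k) ⟨h0, hkT⟩
  have h2 := (hreg x hx).l1_sub_caputo hα ht ht0 hkT
  simp only [Pi.add_apply, Pi.sub_apply, Pi.mul_apply, truncErr]
  linarith

lemma mem_Icc_mesh (ht : StrictMono t) (ht0 : t 0 = 0) {j k : ℕ} (hjk : j ≤ k) (hkT : t k ≤ T) :
    t j ∈ Icc 0 T :=
  ⟨ht0 ▸ ht.monotone (Nat.zero_le j), (ht.monotone hjk).trans hkT⟩

/-- The bounded continuous part of the right-hand side. -/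
lemma source_mem_cb (hΩb : Bornology.IsBounded Ω) (hcoef : IsCoeff Ω a b c)
    (hu : ContinuousOn (fun q : Pt d × ℝ => u q.1 q.2) (closure Ω ×ˢ Icc 0 T))
    (hreg : ∀ x ∈ Ω, TimeRegular α T K (u x)) (hα : α ∈ Ioo (0 : ℝ) 1) (hK : 0 ≤ K)
    (ht : StrictMono t) (ht0 : t 0 = 0) {k : ℕ} (hk : 1 ≤ k) (hkT : t k ≤ T) :
    ((fun x => l1 α t (fun j => u x (t j)) k) - truncErr α t u k + c * fun x => u x (t k))
      ∈ cb Ω :=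
  (cb Ω).add_mem ((cb Ω).sub_mem
    (l1_mem_cb (U := fun j x => u x (t j)) hk fun _ hj =>
      slice_mem_cb hΩb hu (mem_Icc_mesh ht ht0 hj hkT))
    (truncErr_mem_cb hΩb hu hreg hα hK ht ht0 hkT))
    ((cb Ω).mul_mem (mem_cb_of_continuousOn_closure hΩb hcoef.c_cont)
      (slice_mem_cb hΩb hu (mem_Icc_mesh ht ht0 le_rfl hkT)))

lemma IsSolution.integrableOn_source (h : IsSolution Ω α T a b c f u₀ u w) (hΩ : IsOpen Ω)
    (hΩb : Bornology.IsBounded Ω) (hcoef : IsCoeff Ω a b c)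
    (hreg : ∀ x ∈ Ω, TimeRegular α T K (u x)) (hα : α ∈ Ioo (0 : ℝ) 1) (hK : 0 ≤ K)
    (ht : StrictMono t) (ht0 : t 0 = 0) {k : ℕ} (hk : 1 ≤ k) (hkT : t k ≤ T) :
    IntegrableOn (fun x => f x (t k)) Ω := by
  refine IntegrableOn.congr_fun ?_
    (fun x hx => (h.source_eq hreg hα ht ht0 hk hkT hx).symm) hΩ.measurableSet
  exact (integrableOn_of_mem_cb hΩ hΩb
    (source_mem_cb hΩb hcoef h.cont hreg hα hK ht ht0 hk hkT)).add
    (h.elliptic _ (mem_Icc_mesh ht ht0 le_rfl hkT)).1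

/-- The error equation for `e = R_h u - u_h`. -/
lemma error_equation (h : IsSolution Ω α T a b c f u₀ u w) (hΩ : IsOpen Ω)
    (hΩb : Bornology.IsBounded Ω) (hcoef : IsCoeff Ω a b c)
    (hreg : ∀ x ∈ Ω, TimeRegular α T K (u x)) (hα : α ∈ Ioo (0 : ℝ) 1) (hK : 0 ≤ K)
    (ht : StrictMono t) (ht0 : t 0 = 0) {M k : ℕ} (hk : k ∈ Finset.Icc 1 M) (hMT : t M ≤ T)
    {U₀ : Pt d → ℝ} (hU₀ : U₀ ∈ cb Ω) {U : ℕ → Pt d → ℝ}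
    (hU : IsFESolution 𝒯 ℓ q α t M a b c f U₀ U) {R : ℝ → Pt d → ℝ}
    (hR : IsRitz 𝒯 ℓ q T a b w R) {v : Pt d → ℝ} (hv : v ∈ 𝒯.feSpace ℓ) :
    ip q (fun x => l1 α t (fun j => (R (t j) - U j) x) k) v + formAh q a b c (R (t k) - U k) v
      = ip q ((fun x => l1 α t (fun j => R (t j) x - u x (t j)) k) + truncErr α t u k
        + c * fun x => R (t k) x - u x (t k)) v := by
  obtain ⟨hk1, hkM⟩ := Finset.mem_Icc.1 hk
  have hkT : t k ≤ T := (ht.monotone hkM).trans hMT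
  have hI : ∀ j ≤ k, t j ∈ Icc 0 T := fun j hj => mem_Icc_mesh ht ht0 hj hkT
  have hvt := Triangulation.feSpace_mem_tame hΩ hΩb hv
  have hccb := mem_cb_of_continuousOn_closure hΩb hcoef.c_cont
  have hRcb : ∀ j ≤ k, R (t j) ∈ cb Ω := fun j hj =>
    Triangulation.feSpace_mem_cb hΩ hΩb (hR.mem _ (hI j hj))
  have hUcb : ∀ j ≤ k, U j ∈ cb Ω := fun j hj => hU.mem_cb hΩ hΩb hU₀ (hj.trans hkM)
  obtain ⟨hUk, hUe⟩ := hU.2 k hk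
  have hRt := Triangulation.feSpace_mem_tame hΩ hΩb (hR.mem _ (hI k le_rfl))
  have hUt := Triangulation.feSpace_mem_tame hΩ hΩb hUk
  set S : Pt d → ℝ := (fun x => l1 α t (fun j => u x (t j)) k) - truncErr α t u k
    + c * fun x => u x (t k) with hSdef
  have hS : S ∈ cb Ω := source_mem_cb hΩb hcoef h.cont hreg hα hK ht ht0 hk1 hkT
  have hwi := (h.elliptic _ (hI k le_rfl)).1
  have hf : ip q (fun x => f x (t k)) v = ip q S v + ip q (w (t k)) v := by
    rw [← ip_add_left hΩ (integrableOn_of_mem_cb hΩ hΩb hS) hwi hvt.1]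
    exact ip_congr_left hΩ (fun x hx => h.source_eq hreg hα ht ht0 hk1 hkT hx) hv.2.2
  have hl1R := l1_mem_cb (α := α) (t := t) (U := fun j => R (t j)) hk1 hRcb
  have hl1U := l1_mem_cb (α := α) (t := t) (U := U) hk1 hUcb
  have hcR := (cb Ω).mul_mem hccb (hRcb k le_rfl)
  have e1 : (fun x => l1 α t (fun j => (R (t j) - U j) x) k)
      = (fun x => l1 α t (fun j => R (t j) x) k) - fun x => l1 α t (fun j => U j x) k := by
    ext x
    exact l1_sub α t (fun j => R (t j) x) (fun j => U j x) k
  have e2 : (fun x => l1 α t (fun j => R (t j) x - u x (t j)) k) + truncErr α t u k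
        + (c * fun x => R (t k) x - u x (t k))
      = (fun x => l1 α t (fun j => R (t j) x) k) + c * R (t k) - S := by
    ext x
    have := l1_sub α t (fun j => R (t j) x) (fun j => u x (t j)) k
    simp only [hSdef, Pi.add_apply, Pi.sub_apply, Pi.mul_apply, this]
    ring
  have h3 : formAh q a b c (R (t k) - U k) v
      = formAh q a b c (R (t k)) v - formAh q a b c (U k) v := by
    have h4 := formAh_add_left (q := q) hΩ hΩb hcoef ((tame Ω).sub_mem hRt hUt) hUt hvt
    rw [sub_add_cancel] at h4
    linarith
  have h5 : formAh q a b c (R (t k)) v = ip q (w (t k)) v + ip q (c * R (t k)) v := by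
    rw [formAh, hR.eqn _ (hI k le_rfl) v hv]; rfl
  have hi := fun {g : Pt d → ℝ} (hg : g ∈ cb Ω) => integrableOn_of_mem_cb hΩ hΩb hg
  rw [e1, e2, ip_sub_left hΩ (hi hl1R) (hi hl1U) hvt.1, h3, h5,
    ip_sub_left hΩ (hi ((cb Ω).add_mem hl1R hcR)) (hi hS) hvt.1,
    ip_add_left hΩ (hi hl1R) (hi hcR) hvt.1]
  have h6 := hUe v hv
  rw [hf] at h6
  linarith

/-- The variation of the Ritz error is controlled by the integral of its time derivative. -/
lemma ofReal_variation_le (h : IsSolution Ω α T a b c f u₀ u w) (hΩ : IsOpen Ω)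
    (hΩb : Bornology.IsBounded Ω) (hp : p = 2 ∨ p = ⊤)
    (hreg : ∀ x ∈ Ω, TimeRegular α T K (u x)) (hα : α ∈ Ioo (0 : ℝ) 1) (hK : 0 ≤ K)
    (ht : StrictMono t) (ht0 : t 0 = 0) {R : ℝ → Pt d → ℝ} (hR : IsRitz 𝒯 ℓ q T a b w R)
    {m : ℕ} (hmT : t m ≤ T) :
    ENNReal.ofReal (variation Ω p (fun j x => R (t j) x - u x (t j)) m)
      ≤ ∫⁻ s in Ioo 0 (t m), nrm Ω p (fun x => deriv (fun s => R s x - u x s) s) := by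
  have hcb : ∀ s ∈ Icc 0 T, (fun x => R s x - u x s) ∈ cb Ω := fun s hs =>
    (cb Ω).sub_mem (Triangulation.feSpace_mem_cb hΩ hΩb (hR.mem s hs)) (slice_mem_cb hΩb h.cont hs)
  induction m with
  | zero => simp [variation_zero]
  | succ n ih =>
    have hnT : t n ≤ T := (ht.monotone n.le_succ).trans hmT
    have hn := mem_Icc_mesh ht ht0 n.le_succ hmT
    have hn' := mem_Icc_mesh ht ht0 (le_refl (n + 1)) hmT
    have := Triangulation.finiteDimensional_feSpace 𝒯 ℓ
    have h1 := nrm_ritz_sub_le hΩ hΩb hp h.cont hreg hα hK (V := 𝒯.feSpace ℓ)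
      (fun v hv => hv.2.2) (fun v hv => Triangulation.feSpace_mem_cb hΩ hΩb hv) hR.mem hR.cont
      hR.diff hn.1 (ht n.lt_succ_self).le hmT
    have h2 : ENNReal.ofReal (nn Ω p ((fun x => R (t (n + 1)) x - u x (t (n + 1)))
        - fun x => R (t n) x - u x (t n)))
        ≤ ∫⁻ s in Ioo (t n) (t (n + 1)), nrm Ω p (fun x => deriv (fun s => R s x - u x s) s) := by
      rw [ofReal_nn hΩ hΩb ((cb Ω).sub_mem (hcb _ hn') (hcb _ hn))]
      exact h1
    rw [variation_succ]
    refine (ENNReal.ofReal_add_le).trans ((add_le_add (ih hnT) h2).trans ?_)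
    have hdisj : Disjoint (Ioo 0 (t n)) (Ioo (t n) (t (n + 1))) :=
      disjoint_left.2 fun s hs hs' => lt_asymm hs.2 hs'.1
    rw [← lintegral_union measurableSet_Ioo hdisj]
    refine lintegral_mono_set (union_subset (Ioo_subset_Ioo_right (ht n.lt_succ_self).le)
      (Ioo_subset_Ioo_left hn.1))

/-- The norms of the error `R_h u - u_h` satisfy a scalar problem for the L1 operator. -/
lemma l1_nn_error_le (h : IsSolution Ω α T a b c f u₀ u w) (hΩ : IsOpen Ω)
    (hΩb : Bornology.IsBounded Ω) (hcoef : IsCoeff Ω a b c) (hp : 1 ≤ p)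
    (hreg : ∀ x ∈ Ω, TimeRegular α T K (u x)) (hα : α ∈ Ioo (0 : ℝ) 1) (hK : 0 ≤ K)
    (ht : StrictMono t) (ht0 : t 0 = 0) {M m k : ℕ} (hm : m ≤ M) (hMT : t M ≤ T)
    (hk : k ∈ Finset.Icc 1 m) (hS : StepStable 𝒯 ℓ q a b c p (kappa α t k))
    {U₀ : Pt d → ℝ} (hU₀ : U₀ ∈ cb Ω) {U : ℕ → Pt d → ℝ}
    (hU : IsFESolution 𝒯 ℓ q α t M a b c f U₀ U) {R : ℝ → Pt d → ℝ}
    (hR : IsRitz 𝒯 ℓ q T a b w R) {c₀ : ℝ} (hc₀ : 0 ≤ c₀) (hc : ∀ x ∈ Ω, |c x| ≤ c₀) :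
    l1 α t (fun j => nn Ω p (R (t j) - U j)) k
      ≤ l1 α t (variation Ω p fun j x => R (t j) x - u x (t j)) k + nn Ω p (truncErr α t u k)
        + c₀ * (nn Ω p (fun x => R (t 0) x - u x (t 0))
          + variation Ω p (fun j x => R (t j) x - u x (t j)) m) := by
  obtain ⟨hk1, hkm⟩ := Finset.mem_Icc.1 hk
  have hkT : t k ≤ T := (ht.monotone (hkm.trans hm)).trans hMT
  have hI : ∀ j ≤ k, t j ∈ Icc 0 T := fun j hj => mem_Icc_mesh ht ht0 hj hkT
  have hccb := mem_cb_of_continuousOn_closure hΩb hcoef.c_cont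
  have hRcb : ∀ j ≤ k, R (t j) ∈ cb Ω := fun j hj =>
    Triangulation.feSpace_mem_cb hΩ hΩb (hR.mem _ (hI j hj))
  have hρ : ∀ j ≤ k, (fun x => R (t j) x - u x (t j)) ∈ cb Ω := fun j hj =>
    (cb Ω).sub_mem (hRcb j hj) (slice_mem_cb hΩb h.cont (hI j hj))
  have hkM : k ∈ Finset.Icc 1 M := Finset.mem_Icc.2 ⟨hk1, hkm.trans hm⟩
  have hl1 := l1_mem_cb (α := α) (t := t) (U := fun j x => R (t j) x - u x (t j)) hk1 hρ
  have htr := truncErr_mem_cb hΩb h.cont hreg hα hK ht ht0 hkT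
  have hcρ := (cb Ω).mul_mem hccb (hρ k le_rfl)
  have h1 := l1_nn_le hΩ hΩb hp hα ht hk1 hS (e := fun j => R (t j) - U j)
    (fun j hj => (cb Ω).sub_mem (hRcb j hj) (hU.mem_cb hΩ hΩb hU₀ (hj.trans (hkm.trans hm))))
    ((𝒯.feSpace ℓ).sub_mem (hR.mem _ (hI k le_rfl)) (hU.2 k hkM).1)
    ((cb Ω).add_mem ((cb Ω).add_mem hl1 htr) hcρ)
    fun v hv => error_equation h hΩ hΩb hcoef hreg hα hK ht ht0 hkM hMT hU₀ hU hR hv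
  have h2 := nn_add_le hΩ hΩb hp ((cb Ω).add_mem hl1 htr) hcρ
  have h3 := nn_add_le hΩ hΩb hp hl1 htr
  have h4 := nn_l1_le_l1_variation hΩ hΩb hp hα ht hρ
  have h5 := nn_mul_le (p := p) hΩ hΩb (hρ k le_rfl) hc₀ hc
  have h6 := nn_le_add_variation hΩ hΩb hp hρ
  have h7 := variation_mono (Ω := Ω) (p := p) (fun j x => R (t j) x - u x (t j)) hkm
  have h8 := mul_le_mul_of_nonneg_left (h6.trans (add_le_add_right h7 _)) hc₀
  linarith

end error

/-! ### Error bounds -/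

section scalar

variable {α : ℝ} {t : ℕ → ℝ}

lemma l1_const (α : ℝ) (t : ℕ → ℝ) (k : ℝ) (m : ℕ) : l1 α t (fun _ => k) m = 0 := by
  simp [l1_eq_sum_wgt]

/-- The step function `Γ(1-α) 1_{j ≥ 1}` as a barrier. -/
lemma le_of_l1_le_add_rpow (hα : α ∈ Ioo (0 : ℝ) 1) (ht : StrictMono t) (ht0 : t 0 = 0) {m : ℕ}
    (hm : 1 ≤ m) {E W : ℕ → ℝ} (hW : W 0 = 0) {F : ℝ} (hF : 0 ≤ F)
    (h : ∀ k ∈ Finset.Icc 1 m, l1 α t E k ≤ l1 α t W k + F * t k ^ (-α)) :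
    E m ≤ E 0 + W m + Real.Gamma (1 - α) * F := by
  have h1 := le_of_l1_le hα ht (E := E) (n := m)
    (V := fun j => (E 0 + W j) + F * (if j = 0 then 0 else Real.Gamma (1 - α)))
    (by simp [hW]) (fun k hk => ?_) m le_rfl
  · simp only [if_neg (by omega : m ≠ 0)] at h1
    linarith
  · rw [l1_add α t (fun j => E 0 + W j), l1_add α t (fun _ => E 0) W, l1_const, l1_const_mul]
    have h2 := rpow_le_l1_step hα ht ht0 (Finset.mem_Icc.1 hk).1
    have := mul_le_mul_of_nonneg_left h2 hF
    linarith [h k hk]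

/-- The right-hand side `t_k^{-α}` is absorbed by the step function barrier, and what remains is
handled by inverting the L1 operator. -/
lemma le_of_l1_le_add_rpow_uniform (hα : α ∈ Ioo (0 : ℝ) 1) {s : ℝ} (hs : 1 < s) {T : ℝ}
    (hT : 0 < T) {M : ℕ} (hM : 1 ≤ M) {m : ℕ} (hm : 1 ≤ m) {E W : ℕ → ℝ} (hW : W 0 = 0)
    {F G : ℝ} (hF : 0 ≤ F) (hG : 0 ≤ G)
    (h : ∀ k ∈ Finset.Icc 1 m, l1 α (mesh T 1 M) E k
      ≤ l1 α (mesh T 1 M) W k + G * mesh T 1 M k ^ (-α) + F * (k : ℝ) ^ (-s)) :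
    E m ≤ E 0 + W m + Real.Gamma (1 - α) * G
      + (Real.Gamma (1 - α) * (1 - α)) * (2 ^ s * (zetaBound s + 1 / α))
        * (T / M) ^ α * F * (m : ℝ) ^ (α - 1) := by
  have ht : StrictMono (mesh T 1 M) := mesh_strictMono hT le_rfl hM
  have h1 := le_of_l1_le_rpow hα hs hT hM hF hm
    (E := fun j => E j - (W j + G * (if j = 0 then 0 else Real.Gamma (1 - α)))) fun k hk => ?_
  · simp only [if_neg (by omega : m ≠ 0), if_pos, hW] at h1
    linarith
  · rw [l1_sub α _ E, l1_add α _ W, l1_const_mul]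
    have h2 := rpow_le_l1_step hα ht (mesh_zero le_rfl) (Finset.mem_Icc.1 hk).1
    have := mul_le_mul_of_nonneg_left h2 hG
    linarith [h k hk]

end scalar

section bounds

variable {d : ℕ} {Ω : Set (Pt d)} {𝒯 : Triangulation Ω} {ℓ : ℕ} {q : Option (Quadrature 𝒯)}
  {a b : Fin d → Pt d → ℝ} {c : Pt d → ℝ} {p : ℝ≥0∞} {α T K : ℝ} {t : ℕ → ℝ}
  {f : Pt d → ℝ → ℝ} {u₀ : Pt d → ℝ} {u : Pt d → ℝ → ℝ} {w : ℝ → Pt d → ℝ}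

/-- The Ritz error at the initial time together with its variation up to `t_m`. -/
noncomputable def ritzTotal (Ω : Set (Pt d)) (p : ℝ≥0∞) (t : ℕ → ℝ) (u : Pt d → ℝ → ℝ)
    (R : ℝ → Pt d → ℝ) (m : ℕ) : ℝ :=
  nn Ω p (fun x => R (t 0) x - u x (t 0)) + variation Ω p (fun j x => R (t j) x - u x (t j)) m

lemma ritzTotal_nonneg (R : ℝ → Pt d → ℝ) (m : ℕ) : 0 ≤ ritzTotal Ω p t u R m :=
  add_nonneg (nn_nonneg _) (Finset.sum_nonneg fun _ _ => nn_nonneg _)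

lemma ofReal_ritzTotal_le (h : IsSolution Ω α T a b c f u₀ u w) (hΩ : IsOpen Ω)
    (hΩb : Bornology.IsBounded Ω) (hp : p = 2 ∨ p = ⊤)
    (hreg : ∀ x ∈ Ω, TimeRegular α T K (u x)) (hα : α ∈ Ioo (0 : ℝ) 1) (hK : 0 ≤ K)
    (ht : StrictMono t) (ht0 : t 0 = 0) {R : ℝ → Pt d → ℝ} (hR : IsRitz 𝒯 ℓ q T a b w R)
    {m : ℕ} (hmT : t m ≤ T) :
    ENNReal.ofReal (ritzTotal Ω p t u R m)
      ≤ ritzError Ω p (fun x s => R s x - u x s) (t m) := by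
  have hI := mem_Icc_mesh ht ht0 (Nat.zero_le m) hmT
  have h1 := ofReal_variation_le h hΩ hΩb hp hreg hα hK ht ht0 hR hmT
  refine ENNReal.ofReal_add_le.trans (add_le_add ?_ h1)
  have hcb : (fun x => R (t 0) x - u x (t 0)) ∈ cb Ω :=
    (cb Ω).sub_mem (Triangulation.feSpace_mem_cb hΩ hΩb (hR.mem _ hI)) (slice_mem_cb hΩb h.cont hI)
  rw [ofReal_nn hΩ hΩb hcb, ht0]
  exact le_max_left _ _

/-- The error is split as `(u - R_h u) + (R_h u - u_h)`. -/
lemma nrm_error_le (h : IsSolution Ω α T a b c f u₀ u w) (hΩ : IsOpen Ω)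
    (hΩb : Bornology.IsBounded Ω) (hp : p = 2 ∨ p = ⊤)
    (hreg : ∀ x ∈ Ω, TimeRegular α T K (u x)) (hα : α ∈ Ioo (0 : ℝ) 1) (hK : 0 ≤ K)
    (ht : StrictMono t) (ht0 : t 0 = 0) {M m : ℕ} (hm : m ≤ M) (hMT : t M ≤ T)
    {U₀ : Pt d → ℝ} (hU₀ : U₀ ∈ cb Ω) {U : ℕ → Pt d → ℝ}
    (hU : IsFESolution 𝒯 ℓ q α t M a b c f U₀ U) {R : ℝ → Pt d → ℝ}
    (hR : IsRitz 𝒯 ℓ q T a b w R) {X B : ℝ} (hB : 0 ≤ B)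
    (hX : nn Ω p (R (t m) - U m) ≤ nn Ω p (R (t 0) - U 0)
      + variation Ω p (fun j x => R (t j) x - u x (t j)) m + B * ritzTotal Ω p t u R m + X) :
    nrm Ω p (fun x => u x (t m) - U m x) ≤ nrm Ω p (fun x => u₀ x - U₀ x) + ENNReal.ofReal X
      + ENNReal.ofReal (2 + B) * ritzError Ω p (fun x s => R s x - u x s) (t m) := by
  have hp1 : 1 ≤ p := by rcases hp with rfl | rfl <;> simp
  have hmT : t m ≤ T := (ht.monotone hm).trans hMT
  have hI : ∀ j ≤ m, t j ∈ Icc 0 T := fun j hj => mem_Icc_mesh ht ht0 hj hmT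
  have hRcb : ∀ j ≤ m, R (t j) ∈ cb Ω := fun j hj =>
    Triangulation.feSpace_mem_cb hΩ hΩb (hR.mem _ (hI j hj))
  have hucb : ∀ j ≤ m, (fun x => u x (t j)) ∈ cb Ω := fun j hj => slice_mem_cb hΩb h.cont (hI j hj)
  have hUcb : ∀ j ≤ m, U j ∈ cb Ω := fun j hj => hU.mem_cb hΩ hΩb hU₀ (hj.trans hm)
  have hρ : ∀ j ≤ m, (fun x => R (t j) x - u x (t j)) ∈ cb Ω := fun j hj =>
    (cb Ω).sub_mem (hRcb j hj) (hucb j hj)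
  have hcb0 : (fun x => u x (t 0) - U 0 x) ∈ cb Ω :=
    (cb Ω).sub_mem (hucb 0 (Nat.zero_le _)) (hUcb 0 (Nat.zero_le _))
  have h0 : nrm Ω p (fun x => u₀ x - U₀ x)
      = ENNReal.ofReal (nn Ω p (fun x => u x (t 0) - U 0 x)) := by
    rw [ofReal_nn hΩ hΩb hcb0]
    refine eLpNorm_congr_ae ?_
    filter_upwards [ae_restrict_mem hΩ.measurableSet] with x hx
    rw [ht0, h.init x hx, hU.1]
  have h1 : nn Ω p (R (t 0) - U 0)
      ≤ nn Ω p (fun x => R (t 0) x - u x (t 0)) + nn Ω p (fun x => u x (t 0) - U 0 x) := by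
    have := nn_add_le hΩ hΩb hp1 (hρ 0 (Nat.zero_le _)) hcb0
    refine le_trans (le_of_eq (congrArg (nn Ω p) ?_)) this
    ext x; simp
  have h2 : nn Ω p (fun x => u x (t m) - U m x)
      ≤ nn Ω p (R (t m) - U m) + nn Ω p (fun x => R (t m) x - u x (t m)) := by
    have := nn_sub_le hΩ hΩb hp1 ((cb Ω).sub_mem (hRcb m le_rfl) (hUcb m le_rfl)) (hρ m le_rfl)
    refine le_trans (le_of_eq (congrArg (nn Ω p) ?_)) this
    ext x; simp
  have h3 := nn_le_add_variation hΩ hΩb hp1 hρ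
  have h4 : nn Ω p (fun x => u x (t m) - U m x) ≤ nn Ω p (fun x => u x (t 0) - U 0 x) + X
      + (2 + B) * ritzTotal Ω p t u R m := by
    rw [ritzTotal] at hX ⊢; linarith
  have h5 := ofReal_ritzTotal_le h hΩ hΩb hp hreg hα hK ht ht0 hR hmT
  have h6 : nrm Ω p (fun x => u x (t m) - U m x)
      = ENNReal.ofReal (nn Ω p (fun x => u x (t m) - U m x)) :=
    (ofReal_nn hΩ hΩb ((cb Ω).sub_mem (hucb m le_rfl) (hUcb m le_rfl))).symm
  rw [h6, h0]
  refine (ENNReal.ofReal_le_ofReal h4).trans (ENNReal.ofReal_add_le.trans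
    (add_le_add ENNReal.ofReal_add_le ?_))
  rw [ENNReal.ofReal_mul (by linarith)]
  exact mul_le_mul_right h5 _

/-- A constant right-hand side on `(0, T]` is dominated by a multiple of `s^{-α}`. -/
lemma one_le_mul_rpow_neg {T s : ℝ} (hα : 0 ≤ α) (hs : 0 < s) (hsT : s ≤ T) :
    1 ≤ T ^ α * s ^ (-α) := by
  rw [Real.rpow_neg hs.le, ← div_eq_mul_inv, one_le_div (Real.rpow_pos_of_pos hs _)]
  exact Real.rpow_le_rpow hs.le hsT hα

end bounds

section main

variable {d : ℕ} {Ω : Set (Pt d)} {𝒯 : Triangulation Ω} {ℓ : ℕ} {q : Option (Quadrature 𝒯)}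
  {a b : Fin d → Pt d → ℝ} {c : Pt d → ℝ} {p : ℝ≥0∞} {α T K r : ℝ}
  {f : Pt d → ℝ → ℝ} {u₀ : Pt d → ℝ} {u : Pt d → ℝ → ℝ} {w : ℝ → Pt d → ℝ}

/-- The bound of part (i) with explicit constants, for a finite bound `P` of the `ψ^j`. -/
lemma nrm_error_le_graded (h : IsSolution Ω α T a b c f u₀ u w) (hΩ : IsOpen Ω)
    (hΩb : Bornology.IsBounded Ω) (hcoef : IsCoeff Ω a b c) (hp : p = 2 ∨ p = ⊤)
    (hreg : ∀ x ∈ Ω, TimeRegular α T K (u x)) (hα : α ∈ Ioo (0 : ℝ) 1) (hK : 0 ≤ K)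
    (hT : 0 < T) (hr : 1 ≤ r) {M m : ℕ} (hM : 1 ≤ M) (hm : m ∈ Finset.Icc 1 M)
    (hS : ∀ k ∈ Finset.Icc 1 M, StepStable 𝒯 ℓ q a b c p (kappa α (mesh T r M) k))
    {U₀ : Pt d → ℝ} (hU₀ : U₀ ∈ cb Ω) {U : ℕ → Pt d → ℝ}
    (hU : IsFESolution 𝒯 ℓ q α (mesh T r M) M a b c f U₀ U) {R : ℝ → Pt d → ℝ}
    (hR : IsRitz 𝒯 ℓ q T a b w R) {c₀ : ℝ} (hc₀ : 0 ≤ c₀) (hc : ∀ x ∈ Ω, |c x| ≤ c₀)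
    {P : ℝ} (hP0 : 0 ≤ P) (hP : ∀ j ∈ Finset.Icc 1 m,
      nrm Ω p (psi α (mesh T r M) u j) ≤ ENNReal.ofReal P) :
    nrm Ω p (fun x => u x (mesh T r M m) - U m x) ≤ nrm Ω p (fun x => u₀ x - U₀ x)
      + ENNReal.ofReal (((2 + 2 * r) / α + (2 / α + 2 / (1 - α))) * P)
      + ENNReal.ofReal (2 + Real.Gamma (1 - α) * (c₀ * T ^ α))
        * ritzError Ω p (fun x s => R s x - u x s) (mesh T r M m) := by
  have hp1 : 1 ≤ p := by rcases hp with rfl | rfl <;> simp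
  have hΓ := gamma_pos_of_mem hα
  have hα0 := hα.1
  have hα1 : 0 < 1 - α := by linarith [hα.2]
  obtain ⟨hm1, hmM⟩ := Finset.mem_Icc.1 hm
  set t := mesh T r M with ht_def
  have ht : StrictMono t := mesh_strictMono hT hr hM
  have ht0 : t 0 = 0 := mesh_zero hr
  have hMT : t M ≤ T := (mesh_self hM).le
  set C := (2 + 2 * r) / α + (2 / α + 2 / (1 - α)) with hC
  have hC0 : 0 ≤ C := by positivity
  set D := ritzTotal Ω p t u R m with hD
  have hD0 : 0 ≤ D := ritzTotal_nonneg R m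
  refine nrm_error_le h hΩ hΩb hp hreg hα hK ht ht0 hmM hMT hU₀ hU hR (by positivity) ?_
  have h1 := le_of_l1_le_add_rpow hα ht ht0 hm1 (E := fun j => nn Ω p (R (t j) - U j))
    (W := variation Ω p fun j x => R (t j) x - u x (t j)) (variation_zero _)
    (F := 1 / Real.Gamma (1 - α) * (C * P) + c₀ * T ^ α * D) (by positivity) fun k hk => ?_
  · have e : Real.Gamma (1 - α) * (1 / Real.Gamma (1 - α) * (C * P) + c₀ * T ^ α * D)
        = Real.Gamma (1 - α) * (c₀ * T ^ α) * D + C * P := by field_simp; ring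
    rw [e] at h1
    linarith
  · obtain ⟨hk1, hkm⟩ := Finset.mem_Icc.1 hk
    have hkT : t k ≤ T := (ht.monotone (hkm.trans hmM)).trans hMT
    have htk : 0 < t k := ht0 ▸ ht (by omega)
    have h2 := l1_nn_error_le h hΩ hΩb hcoef hp1 hreg hα hK ht ht0 hmM hMT hk
      (hS k (Finset.mem_Icc.2 ⟨hk1, hkm.trans hmM⟩)) hU₀ hU hR hc₀ hc
    have h3 := nn_truncErr_le hΩ hΩb hp1 h.cont hreg hα hK ht ht0 hkT (N := fun _ => P)
      (fun _ => hP0) fun j hj => hP j (Finset.Icc_subset_Icc_right hkm hj)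
    rw [← Finset.sum_mul] at h3
    have h4 := mul_le_mul_of_nonneg_right (sum_resWgt_le hα hT hr hM hk1) hP0
    have h5 := mul_le_mul_of_nonneg_left h4 (one_div_pos.2 hΓ).le
    have h6 := mul_le_mul_of_nonneg_left (one_le_mul_rpow_neg hα0.le htk hkT)
      (mul_nonneg hc₀ hD0)
    have h7 : c₀ * D = c₀ * (nn Ω p (fun x => R (t 0) x - u x (t 0))
      + variation Ω p (fun j x => R (t j) x - u x (t j)) m) := rfl
    rw [← h7] at h2
    rw [← ht_def, ← hC] at h5
    refine h2.trans ?_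
    calc _ ≤ l1 α t (variation Ω p fun j x => R (t j) x - u x (t j)) k
          + 1 / Real.Gamma (1 - α) * (C * t k ^ (-α) * P) + c₀ * D * (T ^ α * t k ^ (-α)) := by
          linarith
      _ = _ := by ring

/-- The constant in front of the truncation error on uniform meshes. -/
noncomputable def unifConst (α γ : ℝ) : ℝ :=
  (1 - α) * (2 ^ (1 + γ) * (zetaBound (1 + γ) + 1 / α))
    * (2 / α + 2 / (1 - α) + 2 ^ (1 + α) * (zetaBound (1 + γ) + zetaBound (1 + α)))

/-- The bound of part (ii) with explicit constants, for a finite bound `P` of the weighted `ψ^j`. -/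
lemma nrm_error_le_uniform (h : IsSolution Ω α T a b c f u₀ u w) (hΩ : IsOpen Ω)
    (hΩb : Bornology.IsBounded Ω) (hcoef : IsCoeff Ω a b c) (hp : p = 2 ∨ p = ⊤)
    (hreg : ∀ x ∈ Ω, TimeRegular α T K (u x)) (hα : α ∈ Ioo (0 : ℝ) 1) (hK : 0 ≤ K)
    (hT : 0 < T) {γ : ℝ} (hγ : 0 < γ) (hγα : γ ≤ α) {M m : ℕ} (hM : 1 ≤ M)
    (hm : m ∈ Finset.Icc 1 M)
    (hS : ∀ k ∈ Finset.Icc 1 M, StepStable 𝒯 ℓ q a b c p (kappa α (mesh T 1 M) k))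
    {U₀ : Pt d → ℝ} (hU₀ : U₀ ∈ cb Ω) {U : ℕ → Pt d → ℝ}
    (hU : IsFESolution 𝒯 ℓ q α (mesh T 1 M) M a b c f U₀ U) {R : ℝ → Pt d → ℝ}
    (hR : IsRitz 𝒯 ℓ q T a b w R) {c₀ : ℝ} (hc₀ : 0 ≤ c₀) (hc : ∀ x ∈ Ω, |c x| ≤ c₀)
    {P : ℝ} (hP0 : 0 ≤ P) (hP : ∀ j ∈ Finset.Icc 1 m,
      ENNReal.ofReal ((T / M) ^ (-γ) * mesh T 1 M j ^ (1 - α + γ))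
        * nrm Ω p (psi α (mesh T 1 M) u j) ≤ ENNReal.ofReal P) :
    nrm Ω p (fun x => u x (mesh T 1 M m) - U m x) ≤ nrm Ω p (fun x => u₀ x - U₀ x)
      + ENNReal.ofReal (unifConst α γ * (mesh T 1 M m ^ (α - 1) * P))
      + ENNReal.ofReal (2 + Real.Gamma (1 - α) * (c₀ * T ^ α))
        * ritzError Ω p (fun x s => R s x - u x s) (mesh T 1 M m) := by
  have hp1 : 1 ≤ p := by rcases hp with rfl | rfl <;> simp
  have hΓ := gamma_pos_of_mem hα
  have hα0 := hα.1
  have hα1 : 0 < 1 - α := by linarith [hα.2]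
  obtain ⟨hm1, hmM⟩ := Finset.mem_Icc.1 hm
  have hM0 : (0 : ℝ) < M := by exact_mod_cast hM
  have hτ : 0 < T / M := by positivity
  set t := mesh T 1 M with ht_def
  have ht : StrictMono t := mesh_strictMono hT le_rfl hM
  have ht0 : t 0 = 0 := mesh_zero le_rfl
  have hMT : t M ≤ T := (mesh_self hM).le
  set C := 2 / α + 2 / (1 - α) + 2 ^ (1 + α) * (zetaBound (1 + γ) + zetaBound (1 + α)) with hC
  have hz1 := zetaBound_nonneg (1 + γ)
  have hz2 := zetaBound_nonneg (1 + α)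
  have hC0 : 0 ≤ C := by positivity
  set D := ritzTotal Ω p t u R m with hD
  have hD0 : 0 ≤ D := ritzTotal_nonneg R m
  -- the weights in `hP` are inverse to those in the summation lemma
  have hN : ∀ j ∈ Finset.Icc 1 m, nrm Ω p (psi α t u j)
      ≤ ENNReal.ofReal (P * ((T / M) ^ (α - 1) * (j : ℝ) ^ (α - 1 - γ))) := by
    intro j hj
    have hj0 : (0 : ℝ) < j := by exact_mod_cast (Finset.mem_Icc.1 hj).1
    have hs : (T / M) ^ (α - 1) * (j : ℝ) ^ (α - 1 - γ)
        * ((T / M) ^ (-γ) * t j ^ (1 - α + γ)) = 1 := by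
      rw [ht_def, mesh_one, Real.mul_rpow hτ.le hj0.le]
      calc _ = ((T / M) ^ (α - 1) * (T / M) ^ (-γ) * (T / M) ^ (1 - α + γ))
            * ((j : ℝ) ^ (α - 1 - γ) * (j : ℝ) ^ (1 - α + γ)) := by ring
        _ = 1 := by
          rw [← Real.rpow_add hτ, ← Real.rpow_add hτ, ← Real.rpow_add hj0]
          ring_nf
          simp
    have hw0 : 0 ≤ (T / M) ^ (α - 1) * (j : ℝ) ^ (α - 1 - γ) := by positivity
    calc nrm Ω p (psi α t u j) = ENNReal.ofReal ((T / M) ^ (α - 1) * (j : ℝ) ^ (α - 1 - γ))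
          * (ENNReal.ofReal ((T / M) ^ (-γ) * t j ^ (1 - α + γ)) * nrm Ω p (psi α t u j)) := by
          rw [← mul_assoc, ← ENNReal.ofReal_mul hw0, hs, ENNReal.ofReal_one, one_mul]
      _ ≤ ENNReal.ofReal ((T / M) ^ (α - 1) * (j : ℝ) ^ (α - 1 - γ)) * ENNReal.ofReal P :=
          mul_le_mul_right (hP j hj) _
      _ = _ := by rw [← ENNReal.ofReal_mul hw0, mul_comm]
  refine nrm_error_le h hΩ hΩb hp hreg hα hK ht ht0 hmM hMT hU₀ hU hR (by positivity) ?_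
  have h1 := le_of_l1_le_add_rpow_uniform hα (s := 1 + γ) (by linarith) hT hM hm1
    (E := fun j => nn Ω p (R (t j) - U j))
    (W := variation Ω p fun j x => R (t j) x - u x (t j)) (variation_zero _)
    (F := 1 / Real.Gamma (1 - α) * (C * (T / M)⁻¹ * P)) (G := c₀ * T ^ α * D) (by positivity)
    (by positivity) fun k hk => ?_
  · have e : (Real.Gamma (1 - α) * (1 - α)) * (2 ^ (1 + γ) * (zetaBound (1 + γ) + 1 / α))
        * (T / M) ^ α * (1 / Real.Gamma (1 - α) * (C * (T / M)⁻¹ * P)) * (m : ℝ) ^ (α - 1)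
        = unifConst α γ * (t m ^ (α - 1) * P) := by
      rw [ht_def, mesh_one, Real.mul_rpow hτ.le (Nat.cast_nonneg m), Real.rpow_sub_one hτ.ne',
        unifConst, ← hC]
      field_simp
    rw [e] at h1
    linarith
  · obtain ⟨hk1, hkm⟩ := Finset.mem_Icc.1 hk
    have hkT : t k ≤ T := (ht.monotone (hkm.trans hmM)).trans hMT
    have htk : 0 < t k := ht0 ▸ ht (by omega)
    have h2 := l1_nn_error_le h hΩ hΩb hcoef hp1 hreg hα hK ht ht0 hmM hMT hk
      (hS k (Finset.mem_Icc.2 ⟨hk1, hkm.trans hmM⟩)) hU₀ hU hR hc₀ hc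
    have h3 := nn_truncErr_le hΩ hΩb hp1 h.cont hreg hα hK ht ht0 hkT
      (N := fun j => P * ((T / M) ^ (α - 1) * (j : ℝ) ^ (α - 1 - γ)))
      (fun _ => by positivity) fun j hj => hN j (Finset.Icc_subset_Icc_right hkm hj)
    simp only [mul_left_comm _ P, ← Finset.mul_sum] at h3
    have h4 := mul_le_mul_of_nonneg_left (sum_resWgt_mul_le hα hγ hγα hT hM hk1) hP0
    have h5 := mul_le_mul_of_nonneg_left h4 (one_div_pos.2 hΓ).le
    have h6 := mul_le_mul_of_nonneg_left (one_le_mul_rpow_neg hα0.le htk hkT)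
      (mul_nonneg hc₀ hD0)
    have h7 : c₀ * D = c₀ * (nn Ω p (fun x => R (t 0) x - u x (t 0))
      + variation Ω p (fun j x => R (t j) x - u x (t j)) m) := rfl
    rw [← h7] at h2
    rw [← ht_def, ← hC] at h5
    refine h2.trans ?_
    calc _ ≤ l1 α t (variation Ω p fun j x => R (t j) x - u x (t j)) k
          + 1 / Real.Gamma (1 - α) * (P * (C * (T / M)⁻¹ * (k : ℝ) ^ (-(1 + γ))))
          + c₀ * D * (T ^ α * t k ^ (-α)) := by
          linarith
      _ = _ := by ring

end main

end L1FEM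

theorem mainTheorem1
    (d : ℕ) (hd : d = 1 ∨ d = 2 ∨ d = 3)
    (α : ℝ) (hα : α ∈ Set.Ioo (0 : ℝ) 1) (T : ℝ) (hT : 0 < T) (r : ℝ) (hr : 1 ≤ r)
    (p : ℝ≥0∞) (hp : p = 2 ∨ p = ⊤)
    (Ω : Set (Pt d)) (hΩ : IsOpen Ω) (hΩb : Bornology.IsBounded Ω)
    (hΩr : interior (closure Ω) = Ω)
    (a b : Fin d → Pt d → ℝ) (c : Pt d → ℝ) (hcoef : IsCoeff Ω a b c)
    (hsign : ∀ x ∈ Ω, 0 ≤ c x - (p⁻¹).toReal * ∑ k, pd k (b k) x) :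
    ∃ C : ℝ≥0,
      ∀ (f : Pt d → ℝ → ℝ) (u₀ : Pt d → ℝ) (u : Pt d → ℝ → ℝ) (w : ℝ → Pt d → ℝ),
        IsSolution Ω α T a b c f u₀ u w →
      ∀ (𝒯 : Triangulation Ω) (ℓ : ℕ), 1 ≤ ℓ →
      ∀ q : Option (Quadrature 𝒯),
        (∀ z ∈ 𝒯.nodes, z ∈ Ω → ∀ φ, 𝒯.IsHat z φ → 0 < ip q (fun _ => 1) φ) →
      ∀ M : ℕ, 1 ≤ M →
        CondA 𝒯 ℓ q α (mesh T r M) M a b c p →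
      ∀ U₀ : Pt d → ℝ, ContinuousOn U₀ (closure Ω) →
        (∃ U, IsFESolution 𝒯 ℓ q α (mesh T r M) M a b c f U₀ U) ∧
        (∀ U V, IsFESolution 𝒯 ℓ q α (mesh T r M) M a b c f U₀ U →
          IsFESolution 𝒯 ℓ q α (mesh T r M) M a b c f U₀ V → ∀ m ≤ M, U m = V m) ∧
        ∀ U, IsFESolution 𝒯 ℓ q α (mesh T r M) M a b c f U₀ U →
        ∀ R, IsRitz 𝒯 ℓ q T a b w R →
        ∀ m ∈ Finset.Icc 1 M,
          nrm Ω p (fun x => u x (mesh T r M m) - U m x) ≤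
            C * (nrm Ω p (fun x => u₀ x - U₀ x)
              + (Finset.Icc 1 m).sup (fun j => nrm Ω p (psi α (mesh T r M) u j))
              + ritzError Ω p (fun x t => R t x - u x t) (mesh T r M m)) ∧
          (r = 1 →
            nrm Ω p (fun x => u x (mesh T r M m) - U m x) ≤
              C * (nrm Ω p (fun x => u₀ x - U₀ x)
                + ENNReal.ofReal (mesh T r M m ^ (α - 1)) *
                  (Finset.Icc 1 m).sup (fun j =>
                    ENNReal.ofReal ((T / M) ^ (-min α (1 - α))
                        * mesh T r M j ^ (1 - α + min α (1 - α)))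
                      * nrm Ω p (psi α (mesh T r M) u j))
                + ritzError Ω p (fun x t => R t x - u x t) (mesh T r M m))) := by
  have hΓ := gamma_pos_of_mem hα
  have hα0 := hα.1
  have hα1 : 0 < 1 - α := by linarith [hα.2]
  obtain ⟨c₁, hc₁⟩ := (mem_cb_of_continuousOn_closure hΩb hcoef.c_cont).2
  obtain ⟨c₀, hc₀, hc⟩ : ∃ c₀, 0 ≤ c₀ ∧ ∀ x ∈ Ω, |c x| ≤ c₀ :=
    ⟨max c₁ 0, le_max_right _ _, fun x hx => (hc₁ x hx).trans (le_max_left _ _)⟩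
  set γ := min α (1 - α) with hγdef
  have hγ : 0 < γ := lt_min hα0 hα1
  have hγα : γ ≤ α := min_le_left _ _
  set C₁ := (2 + 2 * r) / α + (2 / α + 2 / (1 - α)) with hC₁
  set C₂ := unifConst α γ with hC₂
  set B := Real.Gamma (1 - α) * (c₀ * T ^ α) with hB
  have hC₁0 : 0 ≤ C₁ := by positivity
  have hC₂0 : 0 ≤ C₂ := by
    have hz1 := zetaBound_nonneg (1 + γ)
    have hz2 := zetaBound_nonneg (1 + α)
    rw [hC₂, unifConst]; positivity
  have hB0 : 0 ≤ B := by positivity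
  have key : ∀ {y A X Z : ℝ≥0∞} {k : ℝ}, k ≤ C₁ + C₂ →
      y ≤ A + ENNReal.ofReal k * X + ENNReal.ofReal (2 + B) * Z →
      y ≤ ((2 + B + (C₁ + C₂)).toNNReal : ℝ≥0∞) * (A + X + Z) := by
    intro y A X Z k hk hy
    refine hy.trans ?_
    rw [mul_add, mul_add]
    refine add_le_add (add_le_add ?_ ?_) ?_
    · refine le_mul_of_one_le_left' ?_
      exact ENNReal.one_le_ofReal.2 (by linarith)
    · exact mul_le_mul_left (ENNReal.ofReal_le_ofReal (by linarith)) _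
    · exact mul_le_mul_left (ENNReal.ofReal_le_ofReal (by linarith)) _
  have hCne : ((2 + B + (C₁ + C₂)).toNNReal : ℝ≥0∞) ≠ 0 :=
    (ENNReal.ofReal_pos.2 (by linarith)).ne'
  refine ⟨(2 + B + (C₁ + C₂)).toNNReal, ?_⟩
  intro f u₀ u w h 𝒯 ℓ _ q hpos M hM hA U₀ hU₀c
  have ht : StrictMono (mesh T r M) := mesh_strictMono hT hr hM
  have ht0 : mesh T r M 0 = 0 := mesh_zero hr
  have hMT : mesh T r M M ≤ T := (mesh_self hM).le
  obtain ⟨K, hK, hreg⟩ := h.exists_timeRegular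
  have hS : ∀ m ∈ Finset.Icc 1 M, StepStable 𝒯 ℓ q a b c p (kappa α (mesh T r M) m) :=
    fun m hm => stepStable_of_condA hΩ hΩb hΩr hcoef hp hsign hα ht hpos hA hm
  have hU₀ : U₀ ∈ cb Ω := mem_cb_of_continuousOn_closure hΩb hU₀c
  refine ⟨exists_isFESolution hΩ hΩb hcoef hp hα ht hS (fun m hm => ?_) hU₀,
    fun U V hU hV => isFESolution_unique hΩ hΩb hcoef hp hα ht hS hU₀ hU hV,
    fun U hU R hR m hm => ⟨?_, ?_⟩⟩
  · obtain ⟨hm1, hmM⟩ := Finset.mem_Icc.1 hm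
    exact h.integrableOn_source hΩ hΩb hcoef hreg hα hK ht ht0 hm1
      ((ht.monotone hmM).trans hMT)
  · set X := (Finset.Icc 1 m).sup (fun j => nrm Ω p (psi α (mesh T r M) u j)) with hX
    by_cases htop : X = ⊤
    · rw [htop]; simp [ENNReal.mul_top hCne]
    · refine key (k := C₁) (by linarith) ?_
      have h1 := nrm_error_le_graded h hΩ hΩb hcoef hp hreg hα hK hT hr hM hm hS hU₀ hU hR hc₀ hc
        (P := X.toReal) ENNReal.toReal_nonneg fun j hj => by
          rw [ENNReal.ofReal_toReal htop]
          exact Finset.le_sup (f := fun j => nrm Ω p (psi α (mesh T r M) u j)) hj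
      rwa [ENNReal.ofReal_mul hC₁0, ENNReal.ofReal_toReal htop] at h1
  · rintro rfl
    set X := (Finset.Icc 1 m).sup (fun j =>
      ENNReal.ofReal ((T / M) ^ (-γ) * mesh T 1 M j ^ (1 - α + γ))
        * nrm Ω p (psi α (mesh T 1 M) u j)) with hX
    have htm : 0 < mesh T 1 M m := by
      have := ht (show 0 < m from (Finset.mem_Icc.1 hm).1)
      rwa [ht0] at this
    have htm' : 0 < mesh T 1 M m ^ (α - 1) := Real.rpow_pos_of_pos htm _
    by_cases htop : X = ⊤
    · rw [htop, ENNReal.mul_top (ENNReal.ofReal_pos.2 htm').ne']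
      simp [ENNReal.mul_top hCne]
    · refine key (k := C₂) (by linarith) ?_
      have h1 := nrm_error_le_uniform h hΩ hΩb hcoef hp hreg hα hK hT hγ hγα hM hm hS hU₀ hU hR
        hc₀ hc (P := X.toReal) ENNReal.toReal_nonneg fun j hj => by
          rw [ENNReal.ofReal_toReal htop]
          exact Finset.le_sup (f := fun j =>
            ENNReal.ofReal ((T / M) ^ (-γ) * mesh T 1 M j ^ (1 - α + γ))
              * nrm Ω p (psi α (mesh T 1 M) u j)) hj
      rwa [ENNReal.ofReal_mul hC₂0, ENNReal.ofReal_mul htm'.le, ENNReal.ofReal_toReal htop] at h1
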